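/- Let $M$ be a smooth (Hausdorff, second countable) $m$-dimensional manifold and $E\to M$ a smooth complex vector bundle of rank $k$. Let $E^\vee:=L(E,DM)$ be the functional dual bundle ($DM$ is the bundle of complex $1$-densities), let $\Gamma_c(E^\vee)$ be the space of its smooth compactly supported sections with the standard strict $(LF)$-space topology, and let $\mathcal D'(M;E)$ be its strong dual. For a chart $(O,x)$ of $M$ over which $E$ is trivialised by $\Phi:E|_O\to O\times\mathbb C^k$, and $u\in\mathcal D'(M;E)$, let $u^j_\Phi\in\mathcal D'(x(O))$, $j=1,\dots,k$, be the components of $u$, i.e. $\langle u^j_\Phi,\phi\rangle=\langle u,(\phi\circ x)\sigma^j\rangle$, where $\sigma^j_p(e)=(\Phi_p e)^j\,|dx^1\wedge\dots\wedge dx^m|_p$. Put $\mathcal Ff(\xi)=\int e^{-ix\xi}f(x)\,dx$ and $\langle\xi\rangle=(1+|\xi|^2)^{1/2}$. A cone in $\mathbb R^m$ is a set stable under multiplication by positive numbers. For an open set $U\subseteq\mathbb R^m$, $v\in\mathcal D'(U)$ and $r\in\mathbb R$, a point $(y,\xi)\in U\times(\mathbb R^m\setminus\{0\})$ is not in the Sobolev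 wave front set $WF^r(v)$ if there are an open cone $V\ni\xi$ and $\varphi\in\mathcal D(U)$ with $\varphi(y)\neq0$ such that $\|\langle\cdot\rangle^r\mathcal F(\varphi v)\|_{L^2(V)}<\infty$; it is not in the wave front set $WF(v)$ if there are such $V,\varphi$ with $\|\langle\cdot\rangle^\nu\mathcal F(\varphi v)\|_{L^\infty(V)}<\infty$ for all $\nu>0$. For $u\in\mathcal D'(M;E)$, the sets $WF^r(u),WF(u)\subseteq T^*M\setminus0$ consist of the covectors $\xi_l\,dx^l|_p$ such that $(x(p),(\xi_1,\dots,\xi_m))$ lies in $\bigcup_j WF^r(u^j_\Phi)$, respectively $\bigcup_j WF(u^j_\Phi)$ (this does not depend on the chart and the trivialisation). Let $L$ be a closed conic subset of $T^*M\setminus0$, and set $$\mathcal D'^r_L(M;E):=\{u\in\mathcal D'(M;E): WF^r(u)\subseteq L\},\qquad \mathcal D'_L(M;E):=\{u\in\mathcal D'(M;E): WF(u)\subseteq L\}.$$ The space $\mathcal D'^r_L(M;E)$ carries the locally convex topology given by the continuous seminorms of $\mathcal D'(M;E)$ and all the seminorms $$\mathfrak p^{\Phi}_{r;\varphi,V}(u)=\max_{1\le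 j\le k}\|\langle\cdot\rangle^r\mathcal F((\varphi\circ x^{-1})u^j_\Phi)\|_{L^2(V)},$$ where $(O,x)$, $\Phi$ are as above, $\varphi\in\mathcal D(O)$ and $V\subseteq\mathbb R^m$ is a closed cone such that no covector $\xi_l\,dx^l|_p\in L$ has $p\in\operatorname{supp}\varphi$ and $(\xi_1,\dots,\xi_m)\in V$. The space $\mathcal D'_L(M;E)$ carries the (Hörmander / Brouder–Dabrowski) locally convex topology given by the continuous seminorms of $\mathcal D'(M;E)$ and all the seminorms $$\mathfrak q^{\Phi}_{\nu;\varphi,V}(u)=\max_{1\le j\le k}\|\langle\cdot\rangle^\nu\mathcal F((\varphi\circ x^{-1})u^j_\Phi)\|_{L^\infty(V)},\qquad \nu>0,$$ with the same $(O,x)$, $\Phi$, $\varphi$, $V$. Then $\mathcal D'_L(M;E)=\bigcap_{r\in\mathbb R}\mathcal D'^r_L(M;E)$ as sets, and topologically $$\mathcal D'_L(M;E)=\varprojlim_{r\to\infty}\mathcal D'^r_L(M;E),$$ where the linking maps of the projective limit are the canonical inclusions $\mathcal D'^{r_2}_L(M;E)\subseteq\mathcal D'^{r_1}_L(M;E)$,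 $r_1\le r_2$; that is, the map $u\mapsto(u)_{r\in\mathbb R}$ is a homeomorphism of $\mathcal D'_L(M;E)$ onto the space of compatible families in $\prod_{r\in\mathbb R}\mathcal D'^r_L(M;E)$. -/

import Mathlib

open Set Filter Topology MeasureTheory Bundle Distributions
open scoped Manifold ContDiff ENNReal

noncomputable section

/-! ## Wave front sets in open subsets of Euclidean space -/

section Euclidean

variable {m : ℕ} {Ω : TopologicalSpace.Opens (EuclideanSpace ℝ (Fin m))}

/-- The test function `x ↦ exp (-i x·ξ) φ x`. -/
def modulate (ξ : EuclideanSpace ℝ (Fin m)) (φ : 𝓓(Ω, ℂ)) : 𝓓(Ω, ℂ) where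
  toFun x := Complex.exp (-(Complex.I * ((inner ℝ x ξ : ℝ) : ℂ))) * φ x
  contDiff' := by
    have h1 : ContDiff ℝ ∞ fun x : EuclideanSpace ℝ (Fin m) => ((inner ℝ x ξ : ℝ) : ℂ) :=
      Complex.ofRealCLM.contDiff.comp (contDiff_id.inner ℝ contDiff_const)
    exact ((contDiff_const.mul h1).neg.cexp).mul φ.contDiff
  hasCompactSupport' := φ.hasCompactSupport.mul_left
  tsupport_subset' := (tsupport_mul_subset_right).trans φ.tsupport_subset

/-- The Fourier transform `ℱ (φ v) (ξ) = ⟨v, exp (-i · ξ) φ⟩` of the compactly supported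
distribution `φ v`, where `v` is a distribution on `Ω`. (Only the values of `v` enter here and
below, so these definitions are written for linear functionals on the test functions; they are
applied to distributions only.) -/
def fourierLoc (v : 𝓓(Ω, ℂ) →ₗ[ℂ] ℂ) (φ : 𝓓(Ω, ℂ)) (ξ : EuclideanSpace ℝ (Fin m)) : ℂ :=
  v (modulate ξ φ)

/-- `‖⟨·⟩ ^ r ℱ (φ v)‖` in `L^q(V)`, with values in `[0, ∞]`; here `⟨ξ⟩ = (1 + |ξ|²)^(1/2)`. -/
def coneNorm (q : ℝ≥0∞) (r : ℝ) (v : 𝓓(Ω, ℂ) →ₗ[ℂ] ℂ) (φ : 𝓓(Ω, ℂ))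
    (V : Set (EuclideanSpace ℝ (Fin m))) : ℝ≥0∞ :=
  eLpNorm (fun ξ => (((1 + ‖ξ‖ ^ 2) ^ (r / 2) : ℝ) : ℂ) * fourierLoc v φ ξ) q (volume.restrict V)

/-- Cones are the sets that are stable under multiplication by positive numbers. -/
def IsCone (V : Set (EuclideanSpace ℝ (Fin m))) : Prop :=
  ∀ ξ ∈ V, ∀ t : ℝ, 0 < t → t • ξ ∈ V

/-- The Sobolev wave front set `WF^r(v) ⊆ Ω × (ℝ^m \ {0})` of order `r`. -/
def euclSobolevWF (r : ℝ) (v : 𝓓(Ω, ℂ) →ₗ[ℂ] ℂ) :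
    Set (EuclideanSpace ℝ (Fin m) × EuclideanSpace ℝ (Fin m)) :=
  {z | z.1 ∈ Ω ∧ z.2 ≠ 0 ∧
    ¬ ∃ V : Set (EuclideanSpace ℝ (Fin m)), IsOpen V ∧ IsCone V ∧ z.2 ∈ V ∧
      ∃ φ : 𝓓(Ω, ℂ), φ z.1 ≠ 0 ∧ coneNorm 2 r v φ V < ⊤}

/-- The (smooth) wave front set `WF(v) ⊆ Ω × (ℝ^m \ {0})`. -/
def euclWF (v : 𝓓(Ω, ℂ) →ₗ[ℂ] ℂ) :
    Set (EuclideanSpace ℝ (Fin m) × EuclideanSpace ℝ (Fin m)) :=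
  {z | z.1 ∈ Ω ∧ z.2 ≠ 0 ∧
    ¬ ∃ V : Set (EuclideanSpace ℝ (Fin m)), IsOpen V ∧ IsCone V ∧ z.2 ∈ V ∧
      ∃ φ : 𝓓(Ω, ℂ), φ z.1 ≠ 0 ∧ ∀ ν : ℝ, 0 < ν → coneNorm ⊤ ν v φ V < ⊤}

lemma coneNorm_mono {q : ℝ≥0∞} {r₁ r₂ : ℝ} (h : r₁ ≤ r₂) (v : 𝓓(Ω, ℂ) →ₗ[ℂ] ℂ) (φ : 𝓓(Ω, ℂ))
    (V : Set (EuclideanSpace ℝ (Fin m))) : coneNorm q r₁ v φ V ≤ coneNorm q r₂ v φ V := by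
  refine eLpNorm_mono fun ξ => ?_
  have h1 : (1 : ℝ) ≤ 1 + ‖ξ‖ ^ 2 := by nlinarith [sq_nonneg ‖ξ‖]
  have h0 : (0 : ℝ) ≤ 1 + ‖ξ‖ ^ 2 := by linarith
  rw [norm_mul, norm_mul, Complex.norm_real, Complex.norm_real,
    Real.norm_of_nonneg (Real.rpow_nonneg h0 _), Real.norm_of_nonneg (Real.rpow_nonneg h0 _)]
  gcongr

lemma euclSobolevWF_mono {r₁ r₂ : ℝ} (h : r₁ ≤ r₂) (v : 𝓓(Ω, ℂ) →ₗ[ℂ] ℂ) :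
    euclSobolevWF r₁ v ⊆ euclSobolevWF r₂ v := by
  rintro z ⟨h1, h2, h3⟩
  refine ⟨h1, h2, fun ⟨V, hV, hc, hz, φ, hφ, hb⟩ => h3 ⟨V, hV, hc, hz, φ, hφ, ?_⟩⟩
  exact (coneNorm_mono h v φ V).trans_lt hb

end Euclidean

/-! ## Densities -/

/-- The complex `1`-densities on an `m`-dimensional real vector space `W`. -/
def Density (m : ℕ) (W : Type*) [AddCommGroup W] [Module ℝ W] :
    Submodule ℂ ((Fin m → W) → ℂ) where
  carrier := {d | ∀ (A : W →ₗ[ℝ] W) (w : Fin m → W),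
    d (fun i => A (w i)) = ((|LinearMap.det A| : ℝ) : ℂ) * d w}
  add_mem' := by
    intro a b ha hb A w
    simp only [Pi.add_apply, ha A w, hb A w]; ring
  zero_mem' := by intro A w; simp
  smul_mem' := by
    intro c a ha A w
    simp only [Pi.smul_apply, smul_eq_mul, ha A w]; ring

/-! ## Complex vector bundles over real manifolds -/

section Manifold

variable (m k : ℕ) {M : Type*} [TopologicalSpace M]
  [ChartedSpace (EuclideanSpace ℝ (Fin m)) M]

section Bundle

variable (E : M → Type*)
  [∀ p, AddCommGroup (E p)] [∀ p, Module ℂ (E p)] [∀ p, TopologicalSpace (E p)]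
  [TopologicalSpace (TotalSpace (Fin k → ℂ) E)] [FiberBundle (Fin k → ℂ) E]
  [VectorBundle ℂ (Fin k → ℂ) E]

/-- The complex vector bundle `E` of rank `k` over the real manifold `M` is smooth: the
transition functions of its bundle atlas are smooth maps into `L(ℂ^k, ℂ^k)`. (This is
`ContMDiffVectorBundle` for a real base and complex fibres.) -/
class SmoothComplexVectorBundle : Prop where
  contMDiffOn_coordChangeL :
    ∀ (e e' : Trivialization (Fin k → ℂ) (π (Fin k → ℂ) E))
      [MemTrivializationAtlas e] [MemTrivializationAtlas e'],
      ContMDiffOn (𝓡 m) 𝓘(ℝ, (Fin k → ℂ) →L[ℂ] (Fin k → ℂ)) ∞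
        (fun p : M => (e.coordChangeL ℂ e' p : (Fin k → ℂ) →L[ℂ] (Fin k → ℂ)))
        (e.baseSet ∩ e'.baseSet)

/-- A chart `(O, x)` of `M` (in the maximal smooth atlas), together with a smooth local
trivialisation `Φ` of `E` over `O`. -/
structure TrivChart where
  chart : OpenPartialHomeomorph M (EuclideanSpace ℝ (Fin m))
  chart_mem : chart ∈ IsManifold.maximalAtlas (𝓡 m) ∞ M
  triv : Trivialization (Fin k → ℂ) (π (Fin k → ℂ) E)
  [isLinear : triv.IsLinear ℂ]
  smooth_to : ∀ (e : Trivialization (Fin k → ℂ) (π (Fin k → ℂ) E)) [MemTrivializationAtlas e],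
    ContMDiffOn (𝓡 m) 𝓘(ℝ, (Fin k → ℂ) →L[ℂ] (Fin k → ℂ)) ∞
      (fun p : M => (triv.coordChangeL ℂ e p : (Fin k → ℂ) →L[ℂ] (Fin k → ℂ)))
      (triv.baseSet ∩ e.baseSet)
  smooth_from : ∀ (e : Trivialization (Fin k → ℂ) (π (Fin k → ℂ) E)) [MemTrivializationAtlas e],
    ContMDiffOn (𝓡 m) 𝓘(ℝ, (Fin k → ℂ) →L[ℂ] (Fin k → ℂ)) ∞
      (fun p : M => (e.coordChangeL ℂ triv p : (Fin k → ℂ) →L[ℂ] (Fin k → ℂ)))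
      (e.baseSet ∩ triv.baseSet)
  source_subset : chart.source ⊆ triv.baseSet

attribute [instance] TrivChart.isLinear

end Bundle

/-- The coordinate vector fields `∂/∂x^i` of the chart `x` at the point `x⁻¹ t`. -/
def coordVec (x : OpenPartialHomeomorph M (EuclideanSpace ℝ (Fin m)))
    (t : EuclideanSpace ℝ (Fin m)) (i : Fin m) : TangentSpace (𝓡 m) (x.symm t) :=
  mfderiv (𝓡 m) (𝓡 m) x.symm t (EuclideanSpace.single i (1 : ℝ))

/-- Expression of a vector in the coordinates of the chart `x`. -/
def dChart (x : OpenPartialHomeomorph M (EuclideanSpace ℝ (Fin m))) (p : M) :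
    TangentSpace (𝓡 m) p →L[ℝ] EuclideanSpace ℝ (Fin m) :=
  mfderiv (𝓡 m) (𝓡 m) x p

/-- The density `λ^x = |dx¹ ∧ … ∧ dx^m|` at `p`, which takes the value `1` on the coordinate
vectors of the chart `x`. -/
def chartDensity (x : OpenPartialHomeomorph M (EuclideanSpace ℝ (Fin m))) (p : M) :
    Density m (TangentSpace (𝓡 m) p) :=
  ⟨fun w => ((|(EuclideanSpace.basisFun (Fin m) ℝ).toBasis.det fun i => dChart m x p (w i)| : ℝ) :
      ℂ), by
    intro A w
    let L : EuclideanSpace ℝ (Fin m) →ₗ[ℝ] EuclideanSpace ℝ (Fin m) := (dChart m x p).toLinearMap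
    let A' : EuclideanSpace ℝ (Fin m) →ₗ[ℝ] EuclideanSpace ℝ (Fin m) := A
    let b := (EuclideanSpace.basisFun (Fin m) ℝ).toBasis
    have h1 : b.det (fun i => dChart m x p (A (w i))) = L.det * (A'.det * b.det w) := by
      rw [← Module.Basis.det_comp b A' w, ← Module.Basis.det_comp b L (A' ∘ w)]; rfl
    have h2 : b.det (fun i => dChart m x p (w i)) = L.det * b.det w := by
      rw [← Module.Basis.det_comp b L w]; rfl
    have h3 : A'.det = LinearMap.det A := rfl
    change ((|b.det (fun i => dChart m x p (A (w i)))| : ℝ) : ℂ) =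
      ((|LinearMap.det A| : ℝ) : ℂ) * ((|b.det (fun i => dChart m x p (w i))| : ℝ) : ℂ)
    rw [h1, h2, abs_mul, abs_mul, abs_mul, h3]
    push_cast
    ring⟩

section Sections

variable {m k} {E : M → Type*}
  [∀ p, AddCommGroup (E p)] [∀ p, Module ℂ (E p)] [∀ p, TopologicalSpace (E p)]
  [TopologicalSpace (TotalSpace (Fin k → ℂ) E)] [FiberBundle (Fin k → ℂ) E]
  [VectorBundle ℂ (Fin k → ℂ) E]

variable (m E) in
/-- Arbitrary sections of the bundle `E^∨ = L(E, DM)`, whose fibre at `p` consists of the linear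
maps from `E_p` to the densities on `T_p M`. -/
def RoughSection : Type _ := ∀ p : M, E p →ₗ[ℂ] Density m (TangentSpace (𝓡 m) p)

instance : AddCommGroup (RoughSection m E) :=
  inferInstanceAs (AddCommGroup (∀ p : M, E p →ₗ[ℂ] Density m (TangentSpace (𝓡 m) p)))

instance : Module ℂ (RoughSection m E) :=
  inferInstanceAs (Module ℂ (∀ p : M, E p →ₗ[ℂ] Density m (TangentSpace (𝓡 m) p)))

/-- The domain `x(O) ⊆ ℝ^m` of the coordinates. -/
def TrivChart.dom (c : TrivChart m k E) : TopologicalSpace.Opens (EuclideanSpace ℝ (Fin m)) :=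
  ⟨c.chart.target, c.chart.open_target⟩

/-- The local frame `σ^j` of the functional dual bundle `E^∨ = L(E, DM)` which is induced by
`(O, x, Φ)`: `σ^j_p (e) = (Φ_p e)_j λ^x_p`. -/
def TrivChart.frame (c : TrivChart m k E) (j : Fin k) (p : M) :
    E p →ₗ[ℂ] Density m (TangentSpace (𝓡 m) p) :=
  ((LinearMap.proj j).comp (c.triv.linearMapAt ℂ p)).smulRight (chartDensity m c.chart p)

/-- The coefficients `φ_j ∘ x⁻¹` of a section `φ = ∑ φ_j σ^j` of `E^∨`: the value of `φ` at the
`j`-th vector of the frame of `E` and the coordinate vectors of `x`. -/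
def TrivChart.coeff (c : TrivChart m k E) (j : Fin k)
    (φ : RoughSection m E) (t : EuclideanSpace ℝ (Fin m)) : ℂ :=
  (φ (c.chart.symm t) (c.triv.symmₗ ℂ (c.chart.symm t) (Pi.single j 1))).1 (coordVec m c.chart t)

variable (m k E) in
/-- The space `Γ_c(E^∨)` of smooth compactly supported sections of `E^∨ = L(E, DM)`; smoothness
means that the coefficients in the local frames are smooth. -/
def testSections : Submodule ℂ (RoughSection m E) where
  carrier := {φ | (∀ (c : TrivChart m k E) (j : Fin k),
      ContDiffOn ℝ ∞ (c.coeff j φ) c.chart.target) ∧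
      ∃ K : Set M, IsCompact K ∧ ∀ p ∉ K, φ p = 0}
  add_mem' := by
    rintro a b ⟨ha, K, hK, ha'⟩ ⟨hb, K', hK', hb'⟩
    refine ⟨fun c j => (ha c j).add (hb c j), K ∪ K', hK.union hK', fun p hp => ?_⟩
    simp only [mem_union, not_or] at hp
    change a p + b p = 0
    rw [ha' p hp.1, hb' p hp.2, add_zero]
  zero_mem' := ⟨fun c j => contDiffOn_const (c := (0 : ℂ)), ∅, isCompact_empty, fun p _ => rfl⟩
  smul_mem' := by
    rintro z a ⟨ha, K, hK, ha'⟩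
    exact ⟨fun c j => contDiffOn_const.smul (ha c j), K, hK, fun p hp => by
      change z • a p = 0
      rw [ha' p hp, smul_zero]⟩

variable (m k E) in
/-- The space `Γ_c(E^∨)`. -/
def TestSection : Type _ := testSections m k E

instance : AddCommGroup (TestSection m k E) := inferInstanceAs (AddCommGroup (testSections m k E))

instance : Module ℂ (TestSection m k E) := inferInstanceAs (Module ℂ (testSections m k E))

/-- The value of a test section at a point. -/
def TestSection.val (φ : TestSection m k E) (p : M) :
    E p →ₗ[ℂ] Density m (TangentSpace (𝓡 m) p) := φ.1 p

variable (m k E) in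
/-- The space `Γ_K(E^∨)` of the smooth sections of `E^∨` with support in `K`. -/
def SupportedSection (K : Set M) : Type _ := {φ : TestSection m k E // ∀ p ∉ K, φ.val p = 0}

/-- The Fréchet topology of `Γ_K(E^∨)`: uniform convergence, on the compact subsets of `x(O)`, of
all derivatives of the coefficients with respect to all `(O, x, Φ)`. -/
instance (K : Set M) : TopologicalSpace (SupportedSection m k E K) :=
  ⨅ (c : TrivChart m k E) (j : Fin k) (n : ℕ),
    TopologicalSpace.induced (fun φ =>
      UniformOnFun.ofFun {S : Set (EuclideanSpace ℝ (Fin m)) | IsCompact S ∧ S ⊆ c.chart.target}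
        (iteratedFDeriv ℝ n (c.coeff j φ.1.1))) inferInstance

/-- The `(LF)`-topology of `Γ_c(E^∨)`: the finest locally convex topology for which all the
inclusions `Γ_K(E^∨) → Γ_c(E^∨)`, `K` compact, are continuous. -/
instance : TopologicalSpace (TestSection m k E) :=
  sInf {t | @IsTopologicalAddGroup (TestSection m k E) t _ ∧
    @ContinuousSMul ℂ (TestSection m k E) _ _ t ∧
    @LocallyConvexSpace ℝ (TestSection m k E) _ _ _ _ t ∧
    ∀ K : Set M, IsCompact K →
      @Continuous (SupportedSection m k E K) (TestSection m k E) _ t Subtype.val}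

instance : IsTopologicalAddGroup (TestSection m k E) :=
  topologicalAddGroup_sInf fun _ ht => ht.1

instance : ContinuousSMul ℂ (TestSection m k E) :=
  continuousSMul_sInf fun _ ht => ht.2.1

instance : LocallyConvexSpace ℝ (TestSection m k E) :=
  .sInf fun _ ht => ht.2.2.1

variable (m k E) in
/-- The space `𝒟'(M; E)` of distributional sections of `E`: the strong dual of `Γ_c(E^∨)`. -/
abbrev DistSection : Type _ := StrongDual ℂ (TestSection m k E)


/-- The transition functions between two smooth local trivialisations are smooth. -/
lemma TrivChart.contMDiffOn_coordChangeL (c c' : TrivChart m k E) :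
    ContMDiffOn (𝓡 m) 𝓘(ℝ, (Fin k → ℂ) →L[ℂ] (Fin k → ℂ)) ∞
      (fun p : M => (c.triv.coordChangeL ℂ c'.triv p : (Fin k → ℂ) →L[ℂ] (Fin k → ℂ)))
      (c.triv.baseSet ∩ c'.triv.baseSet) := by
  rintro p ⟨hp, hp'⟩
  set e := trivializationAt (Fin k → ℂ) E p with he
  have hpe : p ∈ e.baseSet := FiberBundle.mem_baseSet_trivializationAt' p
  have h1 := ((c.smooth_to e).contMDiffAt
    ((c.triv.open_baseSet.inter e.open_baseSet).mem_nhds ⟨hp, hpe⟩))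
  have h2 := ((c'.smooth_from e).contMDiffAt
    ((e.open_baseSet.inter c'.triv.open_baseSet).mem_nhds ⟨hpe, hp'⟩))
  refine ContMDiffAt.contMDiffWithinAt ?_
  have hbil : ContDiff ℝ ∞ (fun z : ((Fin k → ℂ) →L[ℂ] (Fin k → ℂ)) ×
      ((Fin k → ℂ) →L[ℂ] (Fin k → ℂ)) => z.1.comp z.2) := by
    have := (ContinuousLinearMap.compL ℂ (Fin k → ℂ) (Fin k → ℂ) (Fin k → ℂ)).isBoundedBilinearMap
    exact (this.contDiff (n := ∞)).restrict_scalars ℝ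
  have h3 := hbil.contMDiff.contMDiffAt.comp p (h2.prodMk_space h1)
  refine h3.congr_of_eventuallyEq ?_
  filter_upwards [(c.triv.open_baseSet.inter (e.open_baseSet.inter c'.triv.open_baseSet)).mem_nhds
    ⟨hp, hpe, hp'⟩] with q hq
  ext1 v
  simp only [Function.comp, ContinuousLinearMap.comp_apply, ContinuousLinearEquiv.coe_coe]
  rw [Trivialization.coordChangeL_apply _ _ ⟨hq.1, hq.2.2⟩,
    Trivialization.coordChangeL_apply _ _ ⟨hq.2.1, hq.2.2⟩,
    Trivialization.coordChangeL_apply _ _ ⟨hq.1, hq.2.1⟩]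
  rw [Trivialization.symm_apply_apply_mk _ hq.2.1]

open Classical in
/-- The rough section `(ϕ ∘ x) σ^j`, extended by zero outside `O`. -/
def TrivChart.roughSection (c : TrivChart m k E) (j : Fin k) (ϕ : 𝓓(c.dom, ℂ)) :
    RoughSection m E :=
  fun p => if p ∈ c.chart.source then ϕ (c.chart p) • c.frame j p else 0

lemma TrivChart.dChart_coordVec [IsManifold (𝓡 m) ∞ M] (c c' : TrivChart m k E)
    {t : EuclideanSpace ℝ (Fin m)} (ht : t ∈ c'.chart.target)
    (hs : c'.chart.symm t ∈ c.chart.source) (i : Fin m) :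
    dChart m c.chart (c'.chart.symm t) (coordVec m c'.chart t i) =
      fderiv ℝ (fun s => c.chart (c'.chart.symm s)) t (EuclideanSpace.single i 1) := by
  have h1 : MDifferentiableAt (𝓡 m) (𝓡 m) c.chart (c'.chart.symm t) :=
    ((contMDiffOn_of_mem_maximalAtlas c.chart_mem).contMDiffAt
      (c.chart.open_source.mem_nhds hs)).mdifferentiableAt (by simp)
  have h2 : MDifferentiableAt (𝓡 m) (𝓡 m) c'.chart.symm t :=
    ((contMDiffOn_symm_of_mem_maximalAtlas c'.chart_mem).contMDiffAt
      (c'.chart.open_target.mem_nhds ht)).mdifferentiableAt (by simp)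
  have h3 := mfderiv_comp t h1 h2
  have h4 : fderiv ℝ (fun s => c.chart (c'.chart.symm s)) t =
      mfderiv (𝓡 m) (𝓡 m) (c.chart ∘ c'.chart.symm) t := mfderiv_eq_fderiv.symm
  rw [h4, h3]
  rfl

lemma TrivChart.contDiffAt_transition [IsManifold (𝓡 m) ∞ M] (c c' : TrivChart m k E)
    {t : EuclideanSpace ℝ (Fin m)} (ht : t ∈ c'.chart.target)
    (hs : c'.chart.symm t ∈ c.chart.source) :
    ContDiffAt ℝ ∞ (fun s => c.chart (c'.chart.symm s)) t := by
  rw [← contMDiffAt_iff_contDiffAt]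
  exact ((contMDiffOn_of_mem_maximalAtlas c.chart_mem).contMDiffAt
      (c.chart.open_source.mem_nhds hs)).comp t
    ((contMDiffOn_symm_of_mem_maximalAtlas c'.chart_mem).contMDiffAt
      (c'.chart.open_target.mem_nhds ht))

lemma TrivChart.det_transition_ne_zero [IsManifold (𝓡 m) ∞ M] (c c' : TrivChart m k E)
    {t : EuclideanSpace ℝ (Fin m)} (ht : t ∈ c'.chart.target)
    (hs : c'.chart.symm t ∈ c.chart.source) :
    ((EuclideanSpace.basisFun (Fin m) ℝ).toBasis.det fun i =>
      fderiv ℝ (fun s => c.chart (c'.chart.symm s)) t (EuclideanSpace.single i 1)) ≠ 0 := by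
  set b := (EuclideanSpace.basisFun (Fin m) ℝ).toBasis with hb
  set g := fun s => c.chart (c'.chart.symm s) with hg
  set g' := fun s => c'.chart (c.chart.symm s) with hg'
  have hgt : c.chart.symm (g t) = c'.chart.symm t := c.chart.left_inv hs
  have hd : DifferentiableAt ℝ g t := (c.contDiffAt_transition c' ht hs).differentiableAt (by simp)
  have hd' : DifferentiableAt ℝ g' (g t) :=
    (c'.contDiffAt_transition c (c.chart.map_source hs)
      (by rw [hgt]; exact c'.chart.map_target ht)).differentiableAt (by simp)
  have hid : (g' ∘ g) =ᶠ[𝓝 t] id := by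
    filter_upwards [c'.chart.open_target.mem_nhds ht, (c'.chart.symm.continuousAt ht)
      (c.chart.open_source.mem_nhds hs)] with s h1 h2
    change c'.chart (c.chart.symm (c.chart (c'.chart.symm s))) = s
    rw [c.chart.left_inv h2, c'.chart.right_inv h1]
  have hcomp : (fderiv ℝ g' (g t)).comp (fderiv ℝ g t) = ContinuousLinearMap.id ℝ _ := by
    rw [← fderiv_comp t hd' hd, hid.fderiv_eq, fderiv_id]
  have hdet : LinearMap.det (fderiv ℝ g' (g t)).toLinearMap *
      LinearMap.det (fderiv ℝ g t).toLinearMap = 1 := by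
    rw [← LinearMap.det_comp, ← ContinuousLinearMap.toLinearMap_comp, hcomp]
    exact LinearMap.det_id
  have h1 : (fun i => fderiv ℝ g t (EuclideanSpace.single i 1)) = (fderiv ℝ g t).toLinearMap ∘ b := by
    funext i; simp [hb]
  rw [h1, Module.Basis.det_comp, Module.Basis.det_self, mul_one]
  exact right_ne_zero_of_mul_eq_one hdet

lemma TrivChart.coeff_eq [IsManifold (𝓡 m) ∞ M] (c c' : TrivChart m k E) (j l : Fin k)
    (ϕ : 𝓓(c.dom, ℂ)) {t : EuclideanSpace ℝ (Fin m)} (ht : t ∈ c'.chart.target)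
    (hs : c'.chart.symm t ∈ c.chart.source) :
    c'.coeff l (c.roughSection j ϕ) t = ϕ (c.chart (c'.chart.symm t)) *
      (c'.triv.coordChangeL ℂ c.triv (c'.chart.symm t) (Pi.single l 1) j *
      ((|(EuclideanSpace.basisFun (Fin m) ℝ).toBasis.det fun i =>
        fderiv ℝ (fun s => c.chart (c'.chart.symm s)) t (EuclideanSpace.single i 1)| : ℝ) : ℂ)) := by
  have hp : c'.chart.symm t ∈ c'.triv.baseSet := c'.source_subset (c'.chart.map_target ht)
  have hp' : c'.chart.symm t ∈ c.triv.baseSet := c.source_subset hs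
  have h1 : c.roughSection j ϕ (c'.chart.symm t) =
    ϕ (c.chart (c'.chart.symm t)) • c.frame j (c'.chart.symm t) := if_pos hs
  have h2 : c.triv.linearMapAt ℂ (c'.chart.symm t)
      (c'.triv.symmₗ ℂ (c'.chart.symm t) (Pi.single l 1)) =
      c'.triv.coordChangeL ℂ c.triv (c'.chart.symm t) (Pi.single l 1) := by
    rw [Trivialization.coordChangeL_apply _ _ ⟨hp, hp'⟩,
      Trivialization.coe_linearMapAt_of_mem _ hp', Trivialization.coe_symmₗ _ hp]
  have h3 : (fun i : Fin m =>
      fderiv ℝ (fun s => c.chart (c'.chart.symm s)) t (EuclideanSpace.single i 1)) =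
      fun i => dChart m c.chart (c'.chart.symm t) (coordVec m c'.chart t i) :=
    funext fun i => (c.dChart_coordVec c' ht hs i).symm
  rw [← h2, h3]
  unfold TrivChart.coeff
  rw [h1]
  rfl

lemma TrivChart.contDiffOn_coeff [T2Space M] [IsManifold (𝓡 m) ∞ M]
    (c c' : TrivChart m k E) (j l : Fin k) (ϕ : 𝓓(c.dom, ℂ)) :
    ContDiffOn ℝ ∞ (c'.coeff l (c.roughSection j ϕ)) c'.chart.target := by
  intro t ht
  refine ContDiffAt.contDiffWithinAt ?_
  have hcont : ContinuousAt c'.chart.symm t := c'.chart.symm.continuousAt ht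
  by_cases hs : c'.chart.symm t ∈ c.chart.source
  · have hg := c.contDiffAt_transition c' ht hs
    have hev : c'.coeff l (c.roughSection j ϕ) =ᶠ[𝓝 t] fun t => ϕ (c.chart (c'.chart.symm t)) *
        (c'.triv.coordChangeL ℂ c.triv (c'.chart.symm t) (Pi.single l 1) j *
        ((|(EuclideanSpace.basisFun (Fin m) ℝ).toBasis.det fun i =>
        fderiv ℝ (fun s => c.chart (c'.chart.symm s)) t (EuclideanSpace.single i 1)| : ℝ) : ℂ)) := by
      filter_upwards [c'.chart.open_target.mem_nhds ht,
        hcont (c.chart.open_source.mem_nhds hs)] with s h1 h2 using c.coeff_eq c' j l ϕ h1 h2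
    refine ContDiffAt.congr_of_eventuallyEq ?_ hev
    refine (ϕ.contDiff.contDiffAt.comp t hg).mul (ContDiffAt.mul ?_ ?_)
    · have h1 := ((c'.contMDiffOn_coordChangeL c).contMDiffAt
        ((c'.triv.open_baseSet.inter c.triv.open_baseSet).mem_nhds
          ⟨c'.source_subset (c'.chart.map_target ht), c.source_subset hs⟩)).comp t
        ((contMDiffOn_symm_of_mem_maximalAtlas c'.chart_mem).contMDiffAt
          (c'.chart.open_target.mem_nhds ht))
      rw [contMDiffAt_iff_contDiffAt] at h1
      let T : ((Fin k → ℂ) →L[ℂ] (Fin k → ℂ)) →L[ℝ] ℂ :=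
        ((ContinuousLinearMap.proj (R := ℂ) (φ := fun _ : Fin k => ℂ) j).comp
          (ContinuousLinearMap.apply ℂ (Fin k → ℂ) (Pi.single l (1 : ℂ)))).restrictScalars ℝ
      exact T.contDiff.contDiffAt.comp t h1
    · have hdet : ContDiffAt ℝ ∞ (fun t => (EuclideanSpace.basisFun (Fin m) ℝ).toBasis.det fun i =>
          fderiv ℝ (fun s => c.chart (c'.chart.symm s)) t (EuclideanSpace.single i 1)) t := by
        simp_rw [Module.Basis.det_apply, Matrix.det_apply]
        refine ContDiffAt.sum fun σ _ => ContDiffAt.const_smul _ ?_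
        refine contDiffAt_prod fun i _ => ?_
        have h1 : ContDiffAt ℝ ∞ (fderiv ℝ (fun s => c.chart (c'.chart.symm s))) t :=
          hg.fderiv_right (by simp)
        have h2 := h1.clm_apply (contDiffAt_const (c := EuclideanSpace.single i (1 : ℝ)))
        exact (EuclideanSpace.proj (σ i)).contDiff.contDiffAt.comp t h2
      refine Complex.ofRealCLM.contDiff.contDiffAt.comp t (ContDiffAt.comp t (contDiffAt_abs ?_) hdet)
      exact c.det_transition_ne_zero c' ht hs
  · set K := c.chart.symm '' tsupport ϕ
    have hK : IsCompact K := (ϕ.hasCompactSupport.isCompact).image_of_continuousOn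
      (c.chart.continuousOn_symm.mono ϕ.tsupport_subset)
    have hKs : K ⊆ c.chart.source := by
      rintro _ ⟨s, hs, rfl⟩
      exact c.chart.map_target (ϕ.tsupport_subset hs)
    have hmem : Kᶜ ∈ 𝓝 (c'.chart.symm t) := hK.isClosed.isOpen_compl.mem_nhds fun h => hs (hKs h)
    refine (contDiffAt_const (c := (0 : ℂ))).congr_of_eventuallyEq ?_
    filter_upwards [hcont hmem] with s hsK
    have h0 : c.roughSection j ϕ (c'.chart.symm s) = 0 := by
      unfold TrivChart.roughSection
      split_ifs with h
      · have : ϕ (c.chart (c'.chart.symm s)) = 0 := by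
          by_contra hne
          exact hsK ⟨c.chart (c'.chart.symm s), subset_tsupport _ hne, c.chart.left_inv h⟩
        rw [this, zero_smul]
      · rfl
    unfold TrivChart.coeff
    rw [h0]; rfl

/-- The test section `(ϕ ∘ x) σ^j` of `E^∨`, linear in the test function `ϕ` on `x(O)`. -/
def TrivChart.localSection [T2Space M] [IsManifold (𝓡 m) ∞ M] (c : TrivChart m k E) (j : Fin k) :
    𝓓(c.dom, ℂ) →ₗ[ℂ] TestSection m k E where
  toFun ϕ := ⟨c.roughSection j ϕ, fun c' l => c.contDiffOn_coeff c' j l ϕ,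
    c.chart.symm '' tsupport ϕ, (ϕ.hasCompactSupport.isCompact).image_of_continuousOn
      (c.chart.continuousOn_symm.mono ϕ.tsupport_subset), fun p hp => by
      unfold TrivChart.roughSection
      split_ifs with h
      · have : ϕ (c.chart p) = 0 := by
          by_contra hne
          exact hp ⟨c.chart p, subset_tsupport _ hne, c.chart.left_inv h⟩
        rw [this, zero_smul]
      · rfl⟩
  map_add' ϕ ψ := by
    refine Subtype.ext (funext fun p => ?_)
    change c.roughSection j (ϕ + ψ) p = c.roughSection j ϕ p + c.roughSection j ψ p
    unfold TrivChart.roughSection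
    split_ifs
    · exact add_smul (ϕ (c.chart p)) (ψ (c.chart p)) (c.frame j p)
    · simp
  map_smul' z ϕ := by
    refine Subtype.ext (funext fun p => ?_)
    change c.roughSection j (z • ϕ) p = z • c.roughSection j ϕ p
    unfold TrivChart.roughSection
    split_ifs
    · exact mul_smul z (ϕ (c.chart p)) (c.frame j p)
    · simp

/-- The local representation `u^j_Φ` of `u ∈ 𝒟'(M; E)`: the distribution on `x(O)` given by
`⟨u^j_Φ, ϕ⟩ = ⟨u, (ϕ ∘ x) σ^j⟩`. -/
def TrivChart.localRep [T2Space M] [IsManifold (𝓡 m) ∞ M] (c : TrivChart m k E) (j : Fin k)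
    (u : DistSection m k E) : 𝓓(c.dom, ℂ) →ₗ[ℂ] ℂ :=
  u.toLinearMap.comp (c.localSection j)

end Sections

/-! ## The cotangent bundle and wave front sets on manifolds -/

variable (M) in
/-- The cotangent bundle without its zero section, `T*M \ 0`, as a subspace of the cotangent
bundle `T*M`, which is the bundle of real linear functionals on the tangent spaces. -/
abbrev CotangentMinusZero [IsManifold (𝓡 m) ∞ M] : Type _ :=
  {z : TotalSpace (EuclideanSpace ℝ (Fin m) →L[ℝ] ℝ)
      (fun p : M => TangentSpace (𝓡 m) p →L[ℝ] Bundle.Trivial M ℝ p) // z.2 ≠ 0}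

variable {m k}

/-- The coordinates `(ξ_1, …, ξ_m)`, `ξ_i = ξ(∂/∂x^i)`, of a covector `ξ = ξ_i dx^i` at the point
`p` of the domain of the chart `x`. -/
def covectorCoord (x : OpenPartialHomeomorph M (EuclideanSpace ℝ (Fin m))) (p : M)
    (ξ : TangentSpace (𝓡 m) p →L[ℝ] ℝ) : EuclideanSpace ℝ (Fin m) :=
  WithLp.toLp 2 fun i =>
    ξ (coordVec m x (x p) i)

/-- A subset of `T*M \ 0` is conic if it is stable under `(p, ξ) ↦ (p, t ξ)`, `t > 0`. -/
def IsConic [IsManifold (𝓡 m) ∞ M] (L : Set (CotangentMinusZero m M)) : Prop :=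
  ∀ z ∈ L, ∀ t : ℝ, 0 < t → ∀ w : CotangentMinusZero m M, w.1 = ⟨z.1.1, t • z.1.2⟩ → w ∈ L

section Spaces

variable [T2Space M] [IsManifold (𝓡 m) ∞ M] {E : M → Type*}
  [∀ p, AddCommGroup (E p)] [∀ p, Module ℂ (E p)] [∀ p, TopologicalSpace (E p)]
  [TopologicalSpace (TotalSpace (Fin k → ℂ) E)] [FiberBundle (Fin k → ℂ) E]
  [VectorBundle ℂ (Fin k → ℂ) E]

/-- The Sobolev wave front set `WF^r(u) ⊆ T*M \ 0` of order `r` of `u ∈ 𝒟'(M; E)`: a covector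
over `O` belongs to it if its coordinates belong to the wave front set of some component `u^j_Φ`
of the local representation. (The condition does not depend on the choice of `(O, x, Φ)`.) -/
def sobolevWF (r : ℝ) (u : DistSection m k E) : Set (CotangentMinusZero m M) :=
  {z | ∃ c : TrivChart m k E, z.1.1 ∈ c.chart.source ∧ ∃ j : Fin k,
    (c.chart z.1.1, covectorCoord c.chart z.1.1 z.1.2) ∈ euclSobolevWF r (c.localRep j u)}

/-- The (smooth) wave front set `WF(u) ⊆ T*M \ 0` of `u ∈ 𝒟'(M; E)`. -/
def smoothWF (u : DistSection m k E) : Set (CotangentMinusZero m M) :=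
  {z | ∃ c : TrivChart m k E, z.1.1 ∈ c.chart.source ∧ ∃ j : Fin k,
    (c.chart z.1.1, covectorCoord c.chart z.1.1 z.1.2) ∈ euclWF (c.localRep j u)}

/-- The condition on a test function `ϕ = φ ∘ x⁻¹`, `φ ∈ 𝒟(O)`, and a set `V` that no covector
of `L` over `supp φ` has its coordinates in `V`. -/
def TrivChart.Avoids (c : TrivChart m k E) (L : Set (CotangentMinusZero m M)) (ϕ : 𝓓(c.dom, ℂ))
    (V : Set (EuclideanSpace ℝ (Fin m))) : Prop :=
  ∀ z ∈ L, z.1.1 ∈ c.chart.source → c.chart z.1.1 ∈ tsupport ϕ →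
    covectorCoord c.chart z.1.1 z.1.2 ∉ V

/-- The maximum over the components `j` of `‖⟨·⟩ ^ r ℱ ((φ ∘ x⁻¹) u^j_Φ)‖` in `L^q(V)`: this is
the seminorm `𝔭^Φ_{r; φ, V}` for `q = 2` and the seminorm `𝔮^Φ_{r; φ, V}` for `q = ∞`. -/
def TrivChart.coneSeminorm (c : TrivChart m k E) (q : ℝ≥0∞) (r : ℝ) (ϕ : 𝓓(c.dom, ℂ))
    (V : Set (EuclideanSpace ℝ (Fin m))) (u : DistSection m k E) : ℝ≥0∞ :=
  ⨆ j : Fin k, coneNorm q r (c.localRep j u) ϕ V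

variable (E) in
/-- The set `𝒟'^r_L(M; E)` of the `u ∈ 𝒟'(M; E)` with `WF^r(u) ⊆ L`. -/
def sobolevSet (r : ℝ) (L : Set (CotangentMinusZero m M)) : Set (DistSection m k E) :=
  {u | sobolevWF r u ⊆ L}

variable (E) in
/-- The set `𝒟'_L(M; E)` of the `u ∈ 𝒟'(M; E)` with `WF(u) ⊆ L`. -/
def hormanderSet (L : Set (CotangentMinusZero m M)) : Set (DistSection m k E) :=
  {u | smoothWF u ⊆ L}

variable (k E) in
/-- The topological space `𝒟'^r_L(M; E)`. -/
def SobolevSpace (r : ℝ) (L : Set (CotangentMinusZero m M)) : Type _ :=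
  {u : DistSection m k E // u ∈ sobolevSet E r L}

variable (k E) in
/-- The topological space `𝒟'_L(M; E)`. -/
def HormanderSpace (L : Set (CotangentMinusZero m M)) : Type _ :=
  {u : DistSection m k E // u ∈ hormanderSet E L}

/-- The topology of `𝒟'^r_L(M; E)`: it is generated by the topology of `𝒟'(M; E)` and the balls
of the seminorms `𝔭^Φ_{r; φ, V}` for all `(O, x, Φ)`, all `φ ∈ 𝒟(O)` and all closed cones `V` such
that no covector of `L` over `supp φ` has its coordinates in `V`. -/
instance (r : ℝ) (L : Set (CotangentMinusZero m M)) :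
    TopologicalSpace (SobolevSpace k E r L) :=
  TopologicalSpace.induced (fun u => u.1) inferInstance ⊓
    TopologicalSpace.generateFrom
      {B | ∃ (c : TrivChart m k E) (ϕ : 𝓓(c.dom, ℂ)) (V : Set (EuclideanSpace ℝ (Fin m)))
        (u₀ : SobolevSpace k E r L) (ε : ℝ≥0∞),
        IsClosed V ∧ IsCone V ∧ c.Avoids L ϕ V ∧ 0 < ε ∧
          B = {u | c.coneSeminorm 2 r ϕ V (u.1 - u₀.1) < ε}}

/-- The topology of `𝒟'_L(M; E)`: it is generated by the topology of `𝒟'(M; E)` and the balls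
of the seminorms `𝔮^Φ_{ν; φ, V}` for all `ν > 0`, all `(O, x, Φ)`, all `φ ∈ 𝒟(O)` and all closed
cones `V` such that no covector of `L` over `supp φ` has its coordinates in `V`. -/
instance (L : Set (CotangentMinusZero m M)) : TopologicalSpace (HormanderSpace k E L) :=
  TopologicalSpace.induced (fun u => u.1) inferInstance ⊓
    TopologicalSpace.generateFrom
      {B | ∃ (ν : ℝ) (c : TrivChart m k E) (ϕ : 𝓓(c.dom, ℂ))
        (V : Set (EuclideanSpace ℝ (Fin m))) (u₀ : HormanderSpace k E L) (ε : ℝ≥0∞),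
        0 < ν ∧ IsClosed V ∧ IsCone V ∧ c.Avoids L ϕ V ∧ 0 < ε ∧
          B = {u | c.coneSeminorm ⊤ ν ϕ V (u.1 - u₀.1) < ε}}

lemma sobolevWF_mono {r₁ r₂ : ℝ} (h : r₁ ≤ r₂) (u : DistSection m k E) :
    sobolevWF r₁ u ⊆ sobolevWF r₂ u := by
  rintro z ⟨c, hc, j, hj⟩
  exact ⟨c, hc, j, euclSobolevWF_mono h _ hj⟩

/-- The canonical inclusion `𝒟'^{r₂}_L(M; E) ⊆ 𝒟'^{r₁}_L(M; E)`, `r₁ ≤ r₂`. -/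
def SobolevSpace.incl {r₁ r₂ : ℝ} (h : r₁ ≤ r₂) (L : Set (CotangentMinusZero m M))
    (u : SobolevSpace k E r₂ L) : SobolevSpace k E r₁ L :=
  ⟨u.1, (sobolevWF_mono h u.1).trans u.2⟩

variable (k E) in
/-- The projective limit of the spaces `𝒟'^r_L(M; E)`, `r ∈ ℝ`, `r → ∞`, with the canonical
inclusions as linking maps: the space of the compatible families, as a subspace of the
topological product of these spaces. -/
abbrev SobolevProjLimit (L : Set (CotangentMinusZero m M)) : Type _ :=
  {f : ∀ r : ℝ, SobolevSpace k E r L //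
    ∀ (r₁ r₂ : ℝ) (h : r₁ ≤ r₂), SobolevSpace.incl h L (f r₂) = f r₁}

end Spaces

end Manifold

end

/-! Both assertions rest on two comparisons between the seminorms. The easy one is
`exists_coneNorm_two_le`: since `⟨ξ⟩^(-(m+1))` is square integrable on `ℝ^m`, a weighted `L^∞` norm
of order `r + m + 1` on a cone bounds the `L²` norm of order `r` on the same cone.

The converse, `exists_fourierLoc_bound`, loses no derivatives, but it needs a larger cone and the
strong topology. Take `ψ` equal to `1` on `supp φ`. Then `φ = ψ φ`, and `ℱ(φ v)` is the convolution
of a Schwartz function `κ` with `ℱ(φ v)` (`fourierLoc_mul_eq_integral`). For `ξ` in the smaller cone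
the integral over `η` is split. On the larger cone, Peetre's inequality and Cauchy–Schwarz give the
`L²` norm. Off it, `|ξ - η|` dominates `|ξ| + |η|`, so `κ(ξ - η)` decays rapidly in both variables.
The corresponding multiples of the functions `exp(-i x·η) φ` then form a bounded set `B` of test
functions, and this part is controlled by `sup_B |v|`. As `B` does not depend on `v`, this is a
continuous seminorm of the strong dual. No common bound on the orders of the distributions is
needed.

For the equality of sets, a covector outside the closed set `L` has a product neighbourhood in
coordinates that avoids `L`, hence avoids every `WF^r(u)`. One cutoff and one cone inside this
neighbourhood serve all `r`. A compactness argument (`exists_bound_of_disjoint_euclSobolevWF`)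
patches the local estimates of each order together.

For the topologies, a compatible family is a single distribution, and the two comparisons show that
the bijection is continuous in both directions. The larger cone is provided by
`TrivChart.Avoids.exists_isClosed_separated`: the unit directions of `L` over `supp φ` form a
compact set disjoint from the given cone. -/

noncomputable section

/-! ## Parametric families of smooth functions -/

section Parametric

variable {A X F : Type*} [NormedAddCommGroup A] [NormedSpace ℝ A]
  [NormedAddCommGroup X] [NormedSpace ℝ X] [NormedAddCommGroup F] [NormedSpace ℝ F]

set_option synthInstance.maxHeartbeats 400000 in
set_option maxHeartbeats 1000000 in
/-- The partial iterated derivatives of a smooth function of two variables are jointly smooth. -/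
lemma contDiff_iteratedFDeriv_partial {G : A → X → F} (hG : ContDiff ℝ ∞ (Function.uncurry G))
    (n : ℕ) : ContDiff ℝ ∞ (Function.uncurry fun a x => iteratedFDeriv ℝ n (G a) x) := by
  induction n with
  | zero =>
    simp only [iteratedFDeriv_zero_eq_comp, Function.comp_def]
    exact (continuousMultilinearCurryFin0 ℝ X F).symm.contDiff.comp hG
  | succ n ih =>
    simp only [iteratedFDeriv_succ_eq_comp_left]
    let _ : NormedAddCommGroup (X →L[ℝ] X [×n]→L[ℝ] F) := ContinuousLinearMap.toNormedAddCommGroup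
    let _ : NormedSpace ℝ (X →L[ℝ] X [×n]→L[ℝ] F) := ContinuousLinearMap.toNormedSpace
    let e : (X →L[ℝ] X [×n]→L[ℝ] F) ≃ₗᵢ[ℝ] (X [×(n + 1)]→L[ℝ] F) :=
      (continuousMultilinearCurryLeftEquiv ℝ (fun _ : Fin (n + 1) => X) F).symm
    refine ContDiff.comp (g := e) e.contDiff ?_
    -- The parameter is the whole pair `(a, x)`, of which the family uses only `a`.
    -- `ContDiff.fderiv` then differentiates in the separate variable at the point `p.2`, jointly
    -- smoothly in `p`.
    have h : ContDiff ℝ ∞ (Function.uncurry fun (p : A × X) (x : X) =>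
        iteratedFDeriv ℝ n (G p.1) x) :=
      ih.comp ((contDiff_fst.comp contDiff_fst).prodMk contDiff_snd)
    exact h.fderiv contDiff_snd (by simp)

lemma continuous_iteratedFDeriv_partial {G : A → X → F} (hG : ContDiff ℝ ∞ (Function.uncurry G))
    (n : ℕ) : Continuous (Function.uncurry fun a x => iteratedFDeriv ℝ n (G a) x) :=
  (contDiff_iteratedFDeriv_partial hG n).continuous

set_option synthInstance.maxHeartbeats 400000 in
set_option maxHeartbeats 1000000 in
/-- Iterated differentiation under the integral sign. -/
lemma iteratedFDeriv_integral_param [MeasurableSpace A] [BorelSpace A]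
    [SecondCountableTopology A] [CompleteSpace F] {μ : Measure A} {G : A → X → F}
    (hG : ContDiff ℝ ∞ (Function.uncurry G)) {b : ℕ → A → ℝ} (hb : ∀ n, Integrable (b n) μ)
    (hGb : ∀ n a x, ‖iteratedFDeriv ℝ n (G a) x‖ ≤ b n a) (n : ℕ) (x : X) :
    iteratedFDeriv ℝ n (fun x => ∫ a, G a x ∂μ) x = ∫ a, iteratedFDeriv ℝ n (G a) x ∂μ := by
  have hcont : ∀ n x, Continuous fun a => iteratedFDeriv ℝ n (G a) x := fun n x =>
    (continuous_iteratedFDeriv_partial hG n).comp (by fun_prop : Continuous fun a => (a, x))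
  have hint : ∀ n x, Integrable (fun a => iteratedFDeriv ℝ n (G a) x) μ := fun n x =>
    (hb n).mono' (hcont n x).aestronglyMeasurable (.of_forall fun a => hGb n a x)
  have hsm : ∀ a, ContDiff ℝ ∞ (G a) := fun a =>
    hG.comp (contDiff_const.prodMk contDiff_id)
  induction n generalizing x with
  | zero =>
    have h0 := ContinuousLinearMap.integral_comp_comm
      ((continuousMultilinearCurryFin0 ℝ X F).symm.toContinuousLinearEquiv :
        F →L[ℝ] X [×0]→L[ℝ] F) (μ := μ) (φ := fun a => G a x) (by
      refine (hb 0).mono' ?_ (.of_forall fun a => by simpa using hGb 0 a x)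
      exact (hG.continuous.comp
        (by fun_prop : Continuous fun a => (a, x))).aestronglyMeasurable)
    simp only [iteratedFDeriv_zero_eq_comp, Function.comp_def]
    exact h0.symm
  | succ n ih =>
    have hfd : (iteratedFDeriv ℝ n fun x => ∫ a, G a x ∂μ) =
        fun x => ∫ a, iteratedFDeriv ℝ n (G a) x ∂μ := funext ih
    have hnorm : ∀ a x, ‖fderiv ℝ (iteratedFDeriv ℝ n (G a)) x‖ ≤ b (n + 1) a := fun a x => by
      rw [norm_fderiv_iteratedFDeriv]; exact hGb (n + 1) a x
    let _ : NormedAddCommGroup (X →L[ℝ] X [×n]→L[ℝ] F) := ContinuousLinearMap.toNormedAddCommGroup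
    let _ : NormedSpace ℝ (X →L[ℝ] X [×n]→L[ℝ] F) := ContinuousLinearMap.toNormedSpace
    let e : (X →L[ℝ] X [×n]→L[ℝ] F) ≃ₗᵢ[ℝ] (X [×(n + 1)]→L[ℝ] F) :=
      (continuousMultilinearCurryLeftEquiv ℝ (fun _ : Fin (n + 1) => X) F).symm
    have hfc : AEStronglyMeasurable (fun a => fderiv ℝ (iteratedFDeriv ℝ n (G a)) x) μ := by
      refine (e.symm.continuous.comp_aestronglyMeasurable
        (hcont (n + 1) x).aestronglyMeasurable).congr (.of_forall fun a => ?_)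
      simp only [iteratedFDeriv_succ_eq_comp_left]
      exact e.symm_apply_apply _
    have h1 : HasFDerivAt (fun x => ∫ a, iteratedFDeriv ℝ n (G a) x ∂μ)
        (∫ a, fderiv ℝ (iteratedFDeriv ℝ n (G a)) x ∂μ) x := by
      refine hasFDerivAt_integral_of_dominated_of_fderiv_le (s := univ) (bound := b (n + 1))
        univ_mem (.of_forall fun y => (hcont n y).aestronglyMeasurable) (hint n x)
        hfc (.of_forall fun a y _ => hnorm a y) (hb (n + 1))
        (.of_forall fun a y _ => ?_)
      exact (((hsm a).differentiable_iteratedFDeriv (m := n)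
        (by exact_mod_cast WithTop.coe_lt_top n)) y).hasFDerivAt
    rw [iteratedFDeriv_succ_eq_comp_left, Function.comp_apply, hfd, h1.fderiv]
    have h2 := ContinuousLinearMap.integral_comp_comm
      (e.toContinuousLinearEquiv : (X →L[ℝ] X [×n]→L[ℝ] F) →L[ℝ] X [×(n + 1)]→L[ℝ] F) (μ := μ)
      (φ := fun a => fderiv ℝ (iteratedFDeriv ℝ n (G a)) x)
      ((hb (n + 1)).mono' hfc (.of_forall fun a => hnorm a x))
    simp only [iteratedFDeriv_succ_eq_comp_left]
    exact h2.symm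

end Parametric

/-! ### Derivatives of the exponentials `exp(-i x·ξ)`, and auxiliary functional analysis. -/

section Modulation

variable {m : ℕ} {Ω : TopologicalSpace.Opens (EuclideanSpace ℝ (Fin m))}

lemma contDiff_modulation : ContDiff ℝ ∞ (Function.uncurry
    fun (ξ x : EuclideanSpace ℝ (Fin m)) =>
      Complex.exp (-(Complex.I * ((inner ℝ x ξ : ℝ) : ℂ)))) := by
  have h1 : ContDiff ℝ ∞ fun p : EuclideanSpace ℝ (Fin m) × EuclideanSpace ℝ (Fin m) =>
      ((inner ℝ p.2 p.1 : ℝ) : ℂ) :=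
    Complex.ofRealCLM.contDiff.comp (contDiff_snd.inner ℝ contDiff_fst)
  exact (contDiff_const.mul h1).neg.cexp

/-- The exponential is `t ↦ exp(-i t)`, all of whose derivatives have modulus `1`, composed with the
functional `⟨ξ, ·⟩`. Each differentiation contributes a factor `‖ξ‖`. -/
lemma norm_iteratedFDeriv_modulation_le (n : ℕ) (ξ x : EuclideanSpace ℝ (Fin m)) :
    ‖iteratedFDeriv ℝ n (fun x : EuclideanSpace ℝ (Fin m) =>
      Complex.exp (-(Complex.I * ((inner ℝ x ξ : ℝ) : ℂ)))) x‖ ≤ ‖ξ‖ ^ n := by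
  set f : ℝ → ℂ := fun t => Complex.exp ((-Complex.I) * (t : ℂ)) with hf
  have hfs : ContDiff ℝ ∞ f := (contDiff_const.mul Complex.ofRealCLM.contDiff).cexp
  have hd : ∀ n : ℕ, iteratedDeriv n f = fun t => (-Complex.I) ^ n * f t := by
    intro n
    induction n with
    | zero => simp
    | succ n ih =>
      rw [iteratedDeriv_succ, ih]
      funext t
      have h1 : HasDerivAt f (f t * (-Complex.I * 1)) t :=
        ((Complex.ofRealCLM.hasDerivAt (x := t)).const_mul (-Complex.I)).cexp
      rw [(h1.const_mul _).deriv]; ring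
  have he : (fun x : EuclideanSpace ℝ (Fin m) =>
      Complex.exp (-(Complex.I * ((inner ℝ x ξ : ℝ) : ℂ)))) = f ∘ (innerSL ℝ ξ) := by
    funext y
    simp [hf, real_inner_comm]
  rw [he, ContinuousLinearMap.iteratedFDeriv_comp_right _ hfs _ (by exact_mod_cast le_top)]
  refine (ContinuousMultilinearMap.norm_compContinuousLinearMap_le _ _).trans ?_
  rw [norm_iteratedFDeriv_eq_norm_iteratedDeriv, hd]
  have h1 : ‖f (innerSL ℝ ξ x)‖ = 1 := by rw [hf]; simp [Complex.norm_exp]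
  rw [norm_mul, norm_pow, h1]
  simp

end Modulation

/-- A linear functional that is bounded by the norm of a linear map `A` into a normed space factors
continuously through `A`. -/
lemma exists_continuous_factor {W X : Type*} [AddCommGroup W] [Module ℂ W]
    [NormedAddCommGroup X] [NormedSpace ℂ X] (T : W →ₗ[ℂ] ℂ) (A : W →ₗ[ℂ] X) (C : ℝ)
    (hb : ∀ f, ‖T f‖ ≤ C * ‖A f‖) : ∃ ℓ : X →L[ℂ] ℂ, ∀ f, T f = ℓ (A f) := by
  -- The bound forces `T` to vanish on `ker A`, so it descends to a bounded functional on the range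
  -- of `A`. Hahn–Banach extends it, whether or not the range is closed.
  have hker : T ∈ (LinearMap.ker A).dualAnnihilator := by
    rw [Submodule.mem_dualAnnihilator]
    intro f hf
    have h1 := hb f
    rw [LinearMap.mem_ker.1 hf, norm_zero, mul_zero] at h1
    exact norm_le_zero_iff.1 h1
  rw [← LinearMap.range_dualMap_eq_dualAnnihilator_ker] at hker
  obtain ⟨ℓ₀, hℓ₀⟩ := hker
  have hℓ₀' : ∀ f, ℓ₀ (A f) = T f := fun f => LinearMap.congr_fun hℓ₀ f
  let ℓ₁ : StrongDual ℂ (LinearMap.range A) :=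
    (ℓ₀ ∘ₗ (LinearMap.range A).subtype).mkContinuous C (by
      rintro ⟨_, f, rfl⟩
      change ‖ℓ₀ (A f)‖ ≤ C * ‖A f‖
      rw [hℓ₀']
      exact hb f)
  obtain ⟨ℓ, hℓ, -⟩ := exists_extension_norm_eq _ ℓ₁
  exact ⟨ℓ, fun f => (hℓ₀' f).symm.trans (hℓ ⟨A f, f, rfl⟩).symm⟩

/-- The tube lemma: compactness of `K` makes continuity in the parameter uniform over `K`. -/
lemma eventually_forall_dist_lt_of_continuous_uncurry {A X Y : Type*} [TopologicalSpace A]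
    [TopologicalSpace X] [PseudoMetricSpace Y] {g : A → X → Y}
    (hg : Continuous (Function.uncurry g)) {K : Set X} (hK : IsCompact K) (a₀ : A) {ε : ℝ}
    (hε : 0 < ε) : ∀ᶠ a in 𝓝 a₀, ∀ x ∈ K, dist (g a x) (g a₀ x) < ε := by
  refine hK.eventually_forall_of_forall_eventually fun x _ => ?_
  have h1 : Continuous fun p : A × X => dist (Function.uncurry g p) (Function.uncurry g (a₀, p.2)) :=
    hg.dist (hg.comp (by fun_prop : Continuous fun p : A × X => (a₀, p.2)))
  exact h1.continuousAt.eventually_lt continuousAt_const (by simpa using hε)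

/-- Leibniz's rule, with a constant independent of `e`: for the exponentials `R = ‖ξ‖`, and the
growth in `ξ` is polynomial. -/
lemma norm_iteratedFDeriv_mul_le_of_pow {X : Type*} [NormedAddCommGroup X] [NormedSpace ℝ X]
    {e φ : X → ℂ} (he : ContDiff ℝ ∞ e) (hφ : ContDiff ℝ ∞ φ) {C : ℕ → ℝ}
    (hφC : ∀ i x, ‖iteratedFDeriv ℝ i φ x‖ ≤ C i) {R : ℝ} (hR : 0 ≤ R)
    (heR : ∀ i x, ‖iteratedFDeriv ℝ i e x‖ ≤ R ^ i) (n : ℕ) (x : X) :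
    ‖iteratedFDeriv ℝ n (fun x => e x * φ x) x‖ ≤
      (∑ i ∈ Finset.range (n + 1), (n.choose i : ℝ) * C (n - i)) * (1 + R) ^ n := by
  refine (norm_iteratedFDeriv_mul_le (N := ∞) he hφ x (n := n)
    (by exact_mod_cast le_top)).trans ?_
  rw [Finset.sum_mul]
  refine Finset.sum_le_sum fun i hi => ?_
  have h1 : R ^ i ≤ (1 + R) ^ n :=
    (pow_le_pow_left₀ hR (by linarith) i).trans
      (pow_le_pow_right₀ (by linarith) (by simpa [Nat.lt_succ_iff] using hi))
  have h2 := mul_le_mul ((heR i x).trans h1) (hφC (n - i) x) (norm_nonneg _) (by positivity)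
  have h3 := mul_le_mul_of_nonneg_left h2 (Nat.cast_nonneg (α := ℝ) (n.choose i))
  linarith

lemma exists_forall_norm_iteratedFDeriv_le {X F : Type*} [NormedAddCommGroup X] [NormedSpace ℝ X]
    [NormedAddCommGroup F] [NormedSpace ℝ F] {f : X → F} (hf : ContDiff ℝ ∞ f)
    (hc : HasCompactSupport f) (n : ℕ) : ∃ C : ℝ, 0 ≤ C ∧ ∀ x, ‖iteratedFDeriv ℝ n f x‖ ≤ C := by
  obtain ⟨C, hC⟩ := (hf.continuous_iteratedFDeriv
    (by exact_mod_cast le_top)).bounded_above_of_compact_support (hc.iteratedFDeriv n)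
  exact ⟨C, (norm_nonneg _).trans (hC 0), hC⟩

/-! ### The family `exp(-i x·ξ) φ` in the space of test functions. -/

section ModulatedTestFunctions

variable {m : ℕ} {Ω : TopologicalSpace.Opens (EuclideanSpace ℝ (Fin m))}

local notation "ℰ" => EuclideanSpace ℝ (Fin m)

@[simp] lemma modulate_apply (ξ : ℰ) (φ : 𝓓(Ω, ℂ)) (x : ℰ) :
    modulate ξ φ x = Complex.exp (-(Complex.I * ((inner ℝ x ξ : ℝ) : ℂ))) * φ x := rfl

lemma contDiff_modulate (φ : 𝓓(Ω, ℂ)) :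
    ContDiff ℝ ∞ (Function.uncurry fun (ξ x : ℰ) => modulate ξ φ x) :=
  contDiff_modulation.mul (φ.contDiff.comp contDiff_snd)

/-- The modulated test function as an element of the Fréchet space of the smooth functions
supported in a given compact set. -/
def modulateIn {K : TopologicalSpace.Compacts ℰ} (φ : 𝓓(Ω, ℂ)) (hφ : tsupport φ ⊆ K) (ξ : ℰ) :
    𝓓_{K}(ℰ, ℂ) :=
  .of_support_subset (modulate ξ φ).contDiff fun _ hx =>
    hφ (subset_tsupport _ (right_ne_zero_of_mul hx))

lemma norm_iteratedFDeriv_modulate_le (φ : 𝓓(Ω, ℂ)) (n : ℕ) :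
    ∃ C : ℝ, 0 ≤ C ∧ ∀ ξ x : ℰ, ‖iteratedFDeriv ℝ n (modulate ξ φ) x‖ ≤ C * (1 + ‖ξ‖) ^ n := by
  choose C hC0 hC using exists_forall_norm_iteratedFDeriv_le φ.contDiff φ.hasCompactSupport
  refine ⟨∑ i ∈ Finset.range (n + 1), (n.choose i : ℝ) * C (n - i),
    Finset.sum_nonneg fun i _ => mul_nonneg (by positivity) (hC0 _), fun ξ x => ?_⟩
  have he : ContDiff ℝ ∞ fun x : ℰ => Complex.exp (-(Complex.I * ((inner ℝ x ξ : ℝ) : ℂ))) :=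
    (contDiff_const.mul (Complex.ofRealCLM.contDiff.comp
      (contDiff_id.inner ℝ contDiff_const))).neg.cexp
  exact norm_iteratedFDeriv_mul_le_of_pow he φ.contDiff hC (norm_nonneg ξ)
    (fun i x => norm_iteratedFDeriv_modulation_le i ξ x) n x

lemma continuous_modulateIn {K : TopologicalSpace.Compacts ℰ} (φ : 𝓓(Ω, ℂ)) (hφ : tsupport φ ⊆ K) :
    Continuous (modulateIn φ hφ) := by
  rw [ContDiffMapSupportedIn.continuous_iff_comp]
  intro i
  rw [Metric.continuous_iff']
  intro ξ₀ ε hε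
  have hu := eventually_forall_dist_lt_of_continuous_uncurry
    (continuous_iteratedFDeriv_partial (contDiff_modulate φ) i) K.isCompact ξ₀ (half_pos hε)
  filter_upwards [hu] with ξ hξ
  refine (BoundedContinuousFunction.dist_le (by positivity)).2 (fun x => ?_) |>.trans_lt
    (half_lt_self hε)
  simp only [Function.comp_apply, ContDiffMapSupportedIn.structureMapCLM_top_apply]
  by_cases hx : x ∈ (K : Set ℰ)
  · exact (hξ x hx).le
  · rw [(modulateIn φ hφ ξ).iteratedFDeriv_zero_on_compl hx,
      (modulateIn φ hφ ξ₀).iteratedFDeriv_zero_on_compl hx, dist_self]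
    positivity

lemma continuous_modulate (φ : 𝓓(Ω, ℂ)) : Continuous fun ξ => modulate ξ φ :=
  (TestFunction.continuous_ofSupportedIn (K := ⟨tsupport φ, φ.hasCompactSupport⟩)
    φ.tsupport_subset).comp (continuous_modulateIn φ subset_rfl)

lemma continuous_fourierLoc {v : 𝓓(Ω, ℂ) →ₗ[ℂ] ℂ} (hv : Continuous v) (φ : 𝓓(Ω, ℂ)) :
    Continuous (fourierLoc v φ) :=
  hv.comp (continuous_modulate φ)

/-- Modulated test functions with rapidly decreasing coefficients form a bounded set. -/
lemma isVonNBounded_range_smul_modulate {ι : Type*} (φ : 𝓓(Ω, ℂ)) (a : ι → ℂ) (η : ι → ℰ)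
    (ha : ∀ n : ℕ, ∃ C : ℝ, ∀ i, ‖a i‖ * (1 + ‖η i‖) ^ n ≤ C) :
    Bornology.IsVonNBounded ℝ (range fun i => a i • modulate (η i) φ) := by
  have hs : (tsupport φ : Set ℰ) ⊆ (⟨tsupport φ, φ.hasCompactSupport⟩ :
    TopologicalSpace.Compacts ℰ) := subset_rfl
  have h1 : Bornology.IsVonNBounded ℝ (range fun i => a i • modulateIn φ hs (η i)) := by
    rw [(ContDiffMapSupportedIn.withSeminorms ℝ ℰ ℂ ⊤ _).isVonNBounded_iff_seminorm_bounded]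
    intro n
    obtain ⟨C, hC0, hC⟩ := norm_iteratedFDeriv_modulate_le φ n
    obtain ⟨D, hD⟩ := ha n
    -- `D` may be negative if the index type is empty, hence the maximum. The summand `1` makes the
    -- inequality strict.
    refine ⟨max (C * D) 0 + 1, by positivity, ?_⟩
    rintro _ ⟨i, rfl⟩
    refine (lt_add_one _).trans_le' ?_
    rw [ContDiffMapSupportedIn.seminorm_top_le_iff ℝ (le_max_right _ _)]
    intro x _
    refine le_max_of_le_left ?_
    have h2 : iteratedFDeriv ℝ n (a i • modulateIn φ hs (η i) : 𝓓_{_}(ℰ, ℂ)) x =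
        a i • iteratedFDeriv ℝ n (modulate (η i) φ) x :=
      iteratedFDeriv_const_smul_apply ((modulate (η i) φ).contDiff.contDiffAt.of_le
        (by exact_mod_cast le_top))
    rw [h2, norm_smul]
    calc _ ≤ ‖a i‖ * (C * (1 + ‖η i‖) ^ n) := by gcongr; exact hC _ _
      _ = C * (‖a i‖ * (1 + ‖η i‖) ^ n) := by ring
      _ ≤ C * D := by gcongr; exact hD i
  have h2 := h1.image (TestFunction.ofSupportedInCLM (n := ⊤) (F := ℂ) ℝ
    (K := ⟨tsupport φ, φ.hasCompactSupport⟩) φ.tsupport_subset)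
  rw [← range_comp] at h2
  exact h2

/-- The first derivatives of a smooth function supported in `K`. -/
def derivativesIn (K : TopologicalSpace.Compacts ℰ) (s : Finset ℕ) :
    𝓓_{K}(ℰ, ℂ) →L[ℂ] (∀ i : s, BoundedContinuousFunction ℰ (ℰ [×(i : ℕ)]→L[ℝ] ℂ)) :=
  ContinuousLinearMap.pi fun i => ContDiffMapSupportedIn.structureMapCLM ℂ ⊤ (i : ℕ)

lemma finset_sup_seminorm_le_norm_derivativesIn (K : TopologicalSpace.Compacts ℰ) (s : Finset ℕ)
    (f : 𝓓_{K}(ℰ, ℂ)) :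
    (s.sup (ContDiffMapSupportedIn.seminorm ℂ ℰ ℂ ⊤ K)) f ≤ ‖derivativesIn K s f‖ :=
  Seminorm.finset_sup_apply_le (norm_nonneg _) fun i hi =>
    norm_le_pi_norm (derivativesIn K s f) ⟨i, hi⟩

/-- A distribution, restricted to the test functions which are supported in a fixed compact set,
factors through finitely many derivatives. -/
lemma exists_factor_derivativesIn {v : 𝓓(Ω, ℂ) →ₗ[ℂ] ℂ} (hv : Continuous v)
    (K : TopologicalSpace.Compacts ℰ) (hK : (K : Set ℰ) ⊆ Ω) :
    ∃ (s : Finset ℕ) (ℓ : (∀ i : s, BoundedContinuousFunction ℰ (ℰ [×(i : ℕ)]→L[ℝ] ℂ)) →L[ℂ] ℂ),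
      ∀ f : 𝓓_{K}(ℰ, ℂ), v (TestFunction.ofSupportedIn hK f) = ℓ (derivativesIn K s f) := by
  let T : 𝓓_{K}(ℰ, ℂ) →ₗ[ℂ] ℂ :=
    v ∘ₗ (TestFunction.ofSupportedInCLM (n := ⊤) (F := ℂ) ℂ hK).toLinearMap
  have hT : Continuous T := hv.comp (TestFunction.continuous_ofSupportedIn hK)
  -- Over the fixed compact set `v` has finite order, so finitely many sup norms of derivatives
  -- bound it. The Fréchet space can thus be replaced by a Banach space, where Bochner integrals are
  -- available.
  obtain ⟨s, C, -, hq⟩ := Seminorm.bound_of_continuous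
    (ContDiffMapSupportedIn.withSeminorms ℂ ℰ ℂ ⊤ K) ((normSeminorm ℂ ℂ).comp T)
    (continuous_norm.comp hT)
  have hb : ∀ f, ‖T f‖ ≤ C * ‖(derivativesIn K s).toLinearMap f‖ := fun f =>
    (hq f).trans (mul_le_mul_of_nonneg_left (finset_sup_seminorm_le_norm_derivativesIn K s f) C.2)
  obtain ⟨ℓ, hℓ⟩ := exists_continuous_factor
    (X := ∀ i : s, BoundedContinuousFunction ℰ (ℰ [×(i : ℕ)]→L[ℝ] ℂ))
    T (derivativesIn K s).toLinearMap C hb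
  exact ⟨s, ℓ, hℓ⟩

end ModulatedTestFunctions

/-! ### The Fourier transform of a product as a convolution. -/

section Convolution

variable {m : ℕ} {Ω : TopologicalSpace.Opens (EuclideanSpace ℝ (Fin m))}

local notation "ℰ" => EuclideanSpace ℝ (Fin m)

open scoped SchwartzMap FourierTransform in
/-- Fourier inversion for smooth compactly supported functions. -/
lemma exists_schwartz_eq_integral {ψ : ℰ → ℂ} (hψ : ContDiff ℝ ∞ ψ) (hc : HasCompactSupport ψ) :
    ∃ κ : 𝓢(ℰ, ℂ), ∀ x, ψ x = ∫ η, Complex.exp (Complex.I * ((inner ℝ x η : ℝ) : ℂ)) * κ η := by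
  set f : 𝓢(ℰ, ℂ) := hc.toSchwartzMap hψ with hf
  have hpi : (2 * Real.pi) ≠ 0 := by positivity
  -- The transform `𝓕` has the kernel `exp(-2πi x·η)`. The dilation removes the `2π` from the
  -- exponent, and its Jacobian `c` is absorbed into `κ`.
  set e : ℰ ≃L[ℝ] ℰ := ContinuousLinearEquiv.smulLeft (Units.mk0 (2 * Real.pi)⁻¹ (inv_ne_zero hpi))
    with he
  set g : 𝓢(ℰ, ℂ) := SchwartzMap.compCLMOfContinuousLinearEquiv ℂ e (𝓕 f) with hg
  have hge : ∀ v, g ((2 * Real.pi) • v) = 𝓕 f v := fun v => by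
    change 𝓕 f ((2 * Real.pi)⁻¹ • (2 * Real.pi) • v) = _
    rw [inv_smul_smul₀ hpi]
  set c : ℝ := |((2 * Real.pi) ^ Module.finrank ℝ ℰ)⁻¹| with hcdef
  refine ⟨c • g, fun x => ?_⟩
  have h1 : ψ x = 𝓕⁻ (𝓕 f) x := by rw [FourierTransform.fourierInv_fourier_eq]; rfl
  rw [h1, SchwartzMap.fourierInv_coe, Real.fourierInv_eq']
  have h2 := Measure.integral_comp_smul (volume : Measure ℰ)
    (fun η => Complex.exp (Complex.I * ((inner ℝ x η : ℝ) : ℂ)) * g η) (2 * Real.pi)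
  simp only [hge] at h2
  calc _ = ∫ v : ℰ, Complex.exp (Complex.I * ((inner ℝ x ((2 * Real.pi) • v) : ℝ) : ℂ)) * 𝓕 f v := by
        refine integral_congr_ae (.of_forall fun v => ?_)
        simp only [smul_eq_mul, inner_smul_right, real_inner_comm x v]
        rw [mul_comm Complex.I]
    _ = _ := by
        rw [h2, ← integral_smul]
        refine integral_congr_ae (.of_forall fun v => ?_)
        simp only [smul_apply, Complex.real_smul]
        ring

open scoped SchwartzMap in
lemma exists_schwartz_decay (κ : 𝓢(ℰ, ℂ)) (n : ℕ) :
    ∃ C : ℝ, 0 ≤ C ∧ ∀ ζ, ‖κ ζ‖ * (1 + ‖ζ‖) ^ n ≤ C := by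
  refine ⟨2 ^ n * ((Finset.Iic (n, 0)).sup fun m => SchwartzMap.seminorm ℂ m.1 m.2) κ,
    mul_nonneg (by positivity) (apply_nonneg _ _), fun ζ => ?_⟩
  have := SchwartzMap.one_add_le_sup_seminorm_apply (𝕜 := ℂ) (m := (n, 0)) le_rfl le_rfl κ ζ
  rw [norm_iteratedFDeriv_zero] at this
  rwa [mul_comm]

open scoped SchwartzMap in
lemma integrable_schwartz_mul_pow (κ : 𝓢(ℰ, ℂ)) (n : ℕ) :
    Integrable fun ζ => ‖κ ζ‖ * (1 + ‖ζ‖) ^ n := by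
  -- The `m + 1` additional powers leave `(1 + ‖ζ‖)^(-(m+1))`, which is integrable in dimension `m`.
  obtain ⟨C, hC0, hC⟩ := exists_schwartz_decay κ (n + (m + 1))
  have h1 : Integrable fun ζ : ℰ => C * (1 + ‖ζ‖) ^ (-((m + 1 : ℕ) : ℝ)) :=
    (integrable_one_add_norm (by simp)).const_mul C
  refine h1.mono' (by
    have := κ.continuous
    exact (by fun_prop : Continuous fun ζ => ‖κ ζ‖ * (1 + ‖ζ‖) ^ n).aestronglyMeasurable)
    (.of_forall fun ζ => ?_)
  have hp : 0 < 1 + ‖ζ‖ := by positivity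
  rw [Real.norm_of_nonneg (by positivity), Real.rpow_neg hp.le, Real.rpow_natCast,
    ← div_eq_mul_inv, le_div_iff₀ (by positivity)]
  calc _ = ‖κ ζ‖ * (1 + ‖ζ‖) ^ (n + (m + 1)) := by rw [pow_add]; ring
    _ ≤ C := hC ζ

lemma one_add_norm_le_mul (ξ η : ℰ) : 1 + ‖η‖ ≤ (1 + ‖ξ‖) * (1 + ‖ξ - η‖) := by
  have h1 : ‖η‖ ≤ ‖ξ‖ + ‖ξ - η‖ := by
    calc ‖η‖ = ‖ξ - (ξ - η)‖ := by rw [sub_sub_cancel]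
      _ ≤ _ := norm_sub_le _ _
  nlinarith [norm_nonneg ξ, norm_nonneg (ξ - η)]

open scoped SchwartzMap in
lemma integrable_schwartz_sub_mul_pow (κ : 𝓢(ℰ, ℂ)) (ξ : ℰ) (n : ℕ) :
    Integrable fun η => ‖κ (ξ - η)‖ * (1 + ‖η‖) ^ n := by
  have h1 := ((integrable_schwartz_mul_pow κ n).comp_sub_left ξ).const_mul ((1 + ‖ξ‖) ^ n)
  refine h1.mono' (by
    have := κ.continuous
    exact (by fun_prop : Continuous fun η => ‖κ (ξ - η)‖ * (1 + ‖η‖) ^ n).aestronglyMeasurable)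
    (.of_forall fun η => ?_)
  rw [Real.norm_of_nonneg (by positivity)]
  calc _ ≤ ‖κ (ξ - η)‖ * ((1 + ‖ξ‖) * (1 + ‖ξ - η‖)) ^ n := by
        gcongr; exact one_add_norm_le_mul ξ η
    _ = _ := by rw [mul_pow]; ring

/-- A continuous functional on a finite product of spaces of bounded continuous functions commutes
with integrals, which are determined by the integrals of the values of the functions. -/
lemma functional_eq_integral {Z T ι : Type*} [TopologicalSpace Z] [SecondCountableTopology Z]
    [MeasurableSpace Z] [BorelSpace Z] {μ : Measure Z} [TopologicalSpace T] [Fintype ι]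
    {Y : ι → Type*} [∀ i, NormedAddCommGroup (Y i)] [∀ i, NormedSpace ℂ (Y i)]
    [∀ i, CompleteSpace (Y i)] (ℓ : (∀ i, BoundedContinuousFunction T (Y i)) →L[ℂ] ℂ)
    {D : Z → ∀ i, BoundedContinuousFunction T (Y i)} (hD : Continuous D)
    {κ : Z → ℂ} (hκ : Continuous κ) {b : Z → ℝ} (hb : Integrable b μ)
    (hDb : ∀ z, ‖κ z‖ * ‖D z‖ ≤ b z) {d : ∀ i, BoundedContinuousFunction T (Y i)}
    (hd : ∀ i x, d i x = ∫ z, κ z • D z i x ∂μ) : ℓ d = ∫ z, κ z * ℓ (D z) ∂μ := by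
  -- Spaces of bounded continuous functions need not be separable; strong measurability comes from
  -- continuity on the second countable space `Z`. The integral is then identified with `d` by point
  -- evaluations.
  have hint : Integrable (fun z => κ z • D z) μ :=
    hb.mono' (hκ.smul hD).aestronglyMeasurable (.of_forall fun z => by
      rw [norm_smul]; exact hDb z)
  have hI : d = ∫ z, κ z • D z ∂μ := by
    funext i
    ext1 x
    rw [hd]
    exact ((BoundedContinuousFunction.evalCLM ℂ x).comp (ContinuousLinearMap.proj (R := ℂ)
      (φ := fun i => BoundedContinuousFunction T (Y i)) i)).integral_comp_comm hint
  rw [hI, ← ℓ.integral_comp_comm hint]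
  simp only [map_smul, smul_eq_mul]

open scoped SchwartzMap in
-- Insert Fourier inversion for `ψ` and substitute `η ↦ ξ - η`. This is the convolution formula
-- pointwise in `x`, before the distribution is applied.
lemma modulate_mul_eq_integral (φ χ : 𝓓(Ω, ℂ)) {ψ : ℰ → ℂ} {κ : 𝓢(ℰ, ℂ)}
    (hκ : ∀ x, ψ x = ∫ η, Complex.exp (Complex.I * ((inner ℝ x η : ℝ) : ℂ)) * κ η)
    (hχ : ∀ x, χ x = ψ x * φ x) (ξ x : ℰ) :
    modulate ξ χ x = ∫ η, κ (ξ - η) * modulate η φ x := by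
  rw [← integral_sub_left_eq_self _ volume ξ]
  simp only [sub_sub_cancel, modulate_apply]
  rw [hχ, hκ, ← integral_mul_const, ← integral_const_mul]
  refine integral_congr_ae (.of_forall fun η => ?_)
  have h1 : Complex.exp (-(Complex.I * ((inner ℝ x (ξ - η) : ℝ) : ℂ))) =
      Complex.exp (-(Complex.I * ((inner ℝ x ξ : ℝ) : ℂ))) *
        Complex.exp (Complex.I * ((inner ℝ x η : ℝ) : ℂ)) := by
    rw [← Complex.exp_add, inner_sub_right]
    congr 1
    push_cast
    ring
  simp only [h1]
  ring

open scoped SchwartzMap in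
-- Differentiation under the integral is allowed because the growth `(1 + ‖η‖)^n` of the derivatives
-- is beaten by the decay of `κ`.
lemma iteratedFDeriv_modulate_mul_eq_integral (φ χ : 𝓓(Ω, ℂ)) {ψ : ℰ → ℂ} {κ : 𝓢(ℰ, ℂ)}
    (hκ : ∀ x, ψ x = ∫ η, Complex.exp (Complex.I * ((inner ℝ x η : ℝ) : ℂ)) * κ η)
    (hχ : ∀ x, χ x = ψ x * φ x) (ξ x : ℰ) (n : ℕ) :
    iteratedFDeriv ℝ n (modulate ξ χ) x =
      ∫ η, κ (ξ - η) • iteratedFDeriv ℝ n (modulate η φ) x := by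
  have hκs : ContDiff ℝ ∞ κ := κ.smooth ⊤
  have hG : ContDiff ℝ ∞ (Function.uncurry fun (η y : ℰ) => κ (ξ - η) * modulate η φ y) :=
    (hκs.comp (contDiff_const.sub contDiff_fst)).mul (contDiff_modulate φ)
  have hd : ∀ (n : ℕ) (η y : ℰ), iteratedFDeriv ℝ n (fun y => κ (ξ - η) * modulate η φ y) y =
      κ (ξ - η) • iteratedFDeriv ℝ n (modulate η φ) y := fun n η y =>
    iteratedFDeriv_const_smul_apply (f := modulate η φ) (a := κ (ξ - η))
      ((modulate η φ).contDiff.contDiffAt.of_le (by exact_mod_cast le_top))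
  choose C hC0 hC using norm_iteratedFDeriv_modulate_le φ
  have h1 := iteratedFDeriv_integral_param (μ := volume) hG
    (b := fun n η => C n * (‖κ (ξ - η)‖ * (1 + ‖η‖) ^ n))
    (fun n => (integrable_schwartz_sub_mul_pow κ ξ n).const_mul _) (fun n η y => by
      rw [hd, norm_smul]
      calc _ ≤ ‖κ (ξ - η)‖ * (C n * (1 + ‖η‖) ^ n) := by gcongr; exact hC n η y
        _ = _ := by ring) n x
  simp only [hd] at h1
  rw [← h1]
  congr 1
  exact funext fun y => modulate_mul_eq_integral φ χ hκ hχ ξ y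

lemma derivativesIn_apply (K : TopologicalSpace.Compacts ℰ) (s : Finset ℕ) (f : 𝓓_{K}(ℰ, ℂ))
    (i : s) (x : ℰ) : derivativesIn K s f i x = iteratedFDeriv ℝ i f x := by
  change ContDiffMapSupportedIn.structureMapCLM ℂ ⊤ (i : ℕ) f x = _
  rw [ContDiffMapSupportedIn.structureMapCLM_top_apply]

lemma exists_norm_derivativesIn_modulateIn_le {K : TopologicalSpace.Compacts ℰ} (φ : 𝓓(Ω, ℂ))
    (hφ : tsupport φ ⊆ K) (s : Finset ℕ) :
    ∃ (C : ℝ) (n : ℕ), ∀ η, ‖derivativesIn K s (modulateIn φ hφ η)‖ ≤ C * (1 + ‖η‖) ^ n := by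
  choose C hC0 hC using norm_iteratedFDeriv_modulate_le φ
  refine ⟨∑ i ∈ s, C i, s.sup id, fun η => ?_⟩
  have hS : 0 ≤ ∑ i ∈ s, C i := Finset.sum_nonneg fun i _ => hC0 i
  rw [pi_norm_le_iff_of_nonneg (by positivity)]
  intro i
  refine (BoundedContinuousFunction.norm_le (by positivity)).2 fun x => ?_
  rw [derivativesIn_apply]
  refine (hC i η x).trans ?_
  gcongr
  · exact Finset.single_le_sum (f := C) (fun i _ => hC0 i) i.2
  · simp
  · exact Finset.le_sup (f := id) i.2

open scoped SchwartzMap in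
/-- If `χ = ψ φ`, then `ℱ (χ v)` is the convolution of the (normalised) Fourier transform of `ψ`
with `ℱ (φ v)`. -/
theorem fourierLoc_mul_eq_integral {v : 𝓓(Ω, ℂ) →ₗ[ℂ] ℂ} (hv : Continuous v) (φ χ : 𝓓(Ω, ℂ))
    {ψ : ℰ → ℂ} {κ : 𝓢(ℰ, ℂ)}
    (hκ : ∀ x, ψ x = ∫ η, Complex.exp (Complex.I * ((inner ℝ x η : ℝ) : ℂ)) * κ η)
    (hχ : ∀ x, χ x = ψ x * φ x) (ξ : ℰ) :
    fourierLoc v χ ξ = ∫ η, κ (ξ - η) * fourierLoc v φ η := by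
  let K : TopologicalSpace.Compacts ℰ := ⟨tsupport φ, φ.hasCompactSupport⟩
  have hφK : tsupport φ ⊆ K := subset_rfl
  have hχK : tsupport χ ⊆ K := by
    have : (χ : ℰ → ℂ) = fun x => ψ x * φ x := funext hχ
    rw [this]
    exact tsupport_mul_subset_right
  -- All modulated functions are supported in `K`, where `v` factors through finitely many
  -- derivatives. Hence `v` may be moved under the integral once the formula is known for each
  -- derivative.
  obtain ⟨s, ℓ, hℓ⟩ := exists_factor_derivativesIn hv K φ.tsupport_subset
  have hc : Continuous fun η => derivativesIn K s (modulateIn φ hφK η) :=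
    continuous_pi fun i => (ContDiffMapSupportedIn.structureMapCLM ℂ ⊤ (i : ℕ)).continuous.comp
      (continuous_modulateIn φ hφK)
  obtain ⟨C, n, hC⟩ := exists_norm_derivativesIn_modulateIn_le φ hφK s
  have h1 : fourierLoc v χ ξ = ℓ (derivativesIn K s (modulateIn χ hχK ξ)) :=
    hℓ (modulateIn χ hχK ξ)
  have h2 : ∀ η, fourierLoc v φ η = ℓ (derivativesIn K s (modulateIn φ hφK η)) := fun η =>
    hℓ (modulateIn φ hφK η)
  simp only [h1, h2]
  refine functional_eq_integral (μ := volume) ℓ hc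
    (κ.continuous.comp (continuous_const.sub continuous_id))
    ((integrable_schwartz_sub_mul_pow κ ξ n).const_mul C) (fun η => ?_) fun i x => ?_
  · calc _ ≤ ‖κ (ξ - η)‖ * (C * (1 + ‖η‖) ^ n) := by
          exact mul_le_mul_of_nonneg_left (hC η) (norm_nonneg _)
      _ = _ := by ring
  · simp only [derivativesIn_apply]
    exact iteratedFDeriv_modulate_mul_eq_integral φ χ hκ hχ ξ x i

end Convolution

/-! ### Weighted sup norms on a cone from weighted `L²` norms on a larger cone. -/

section ConeEstimate

variable {m : ℕ} {Ω : TopologicalSpace.Opens (EuclideanSpace ℝ (Fin m))}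

local notation "ℰ" => EuclideanSpace ℝ (Fin m)

lemma japanese_rpow_le {r : ℝ} (hr : 0 ≤ r) {N : ℕ} (hN : r ≤ N) (ξ : ℰ) :
    (1 + ‖ξ‖ ^ 2) ^ (r / 2) ≤ (1 + ‖ξ‖) ^ N := by
  have h0 : (0 : ℝ) ≤ ‖ξ‖ := norm_nonneg ξ
  calc (1 + ‖ξ‖ ^ 2) ^ (r / 2) ≤ ((1 + ‖ξ‖) ^ (2 : ℝ)) ^ (r / 2) := by
        gcongr
        rw [Real.rpow_two]
        nlinarith
    _ = (1 + ‖ξ‖) ^ r := by rw [← Real.rpow_mul (by positivity)]; congr 1; ring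
    _ ≤ (1 + ‖ξ‖) ^ (N : ℝ) := Real.rpow_le_rpow_of_exponent_le (by linarith) hN
    _ = _ := Real.rpow_natCast _ _

/-- Peetre's inequality. -/
lemma japanese_rpow_le_mul {r : ℝ} (hr : 0 ≤ r) (ξ η : ℰ) :
    (1 + ‖ξ‖ ^ 2) ^ (r / 2) ≤
      2 ^ (r / 2) * (1 + ‖ξ - η‖ ^ 2) ^ (r / 2) * (1 + ‖η‖ ^ 2) ^ (r / 2) := by
  rw [← Real.mul_rpow (by positivity) (by positivity),
    ← Real.mul_rpow (by positivity) (by positivity)]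
  refine Real.rpow_le_rpow (by positivity) ?_ (by positivity)
  have h1 : ‖ξ‖ ≤ ‖ξ - η‖ + ‖η‖ := by simpa using norm_add_le (ξ - η) η
  nlinarith [sq_nonneg (‖ξ - η‖ - ‖η‖), norm_nonneg ξ, norm_nonneg (ξ - η), norm_nonneg η,
    sq_nonneg (‖ξ - η‖ * ‖η‖)]

open scoped SchwartzMap in
-- The square of a bounded integrable function is integrable.
lemma lintegral_schwartz_mul_pow_sq_lt_top (κ : 𝓢(ℰ, ℂ)) (N : ℕ) :
    ∫⁻ ζ, ENNReal.ofReal (‖κ ζ‖ * (1 + ‖ζ‖) ^ N) ^ (2 : ℝ) < ⊤ := by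
  obtain ⟨C, hC0, hC⟩ := exists_schwartz_decay κ N
  have h1 := (integrable_schwartz_mul_pow κ N).const_mul C
  refine lt_of_le_of_lt (lintegral_mono fun ζ => ?_) h1.lintegral_lt_top
  have h0 : 0 ≤ ‖κ ζ‖ * (1 + ‖ζ‖) ^ N := by positivity
  rw [ENNReal.rpow_two, ← ENNReal.ofReal_pow h0, sq]
  exact ENNReal.ofReal_le_ofReal (mul_le_mul_of_nonneg_right (hC ζ) h0)

open scoped SchwartzMap in
/-- Cauchy--Schwarz for the part of the convolution over the cone. -/
lemma lintegral_cone_le {v : 𝓓(Ω, ℂ) →ₗ[ℂ] ℂ} (hv : Continuous v) (φ : 𝓓(Ω, ℂ)) (κ : 𝓢(ℰ, ℂ))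
    {r : ℝ} (hr : 0 ≤ r) {N : ℕ} (hN : r ≤ N) (V : Set ℰ) (ξ : ℰ) :
    ENNReal.ofReal ((1 + ‖ξ‖ ^ 2) ^ (r / 2)) * ∫⁻ η in V, ‖κ (ξ - η) * fourierLoc v φ η‖ₑ ≤
      ENNReal.ofReal (2 ^ (r / 2)) *
        (∫⁻ ζ, ENNReal.ofReal (‖κ ζ‖ * (1 + ‖ζ‖) ^ N) ^ (2 : ℝ)) ^ (1 / (2 : ℝ)) *
        coneNorm 2 r v φ V := by
  have hw := continuous_fourierLoc hv φ
  have hκ := κ.continuous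
  have hJ : Continuous fun η : ℰ => (1 + ‖η‖ ^ 2) ^ (r / 2) :=
    (by fun_prop : Continuous fun η : ℰ => 1 + ‖η‖ ^ 2).rpow_const fun η => Or.inr (by positivity)
  set g : ℰ → ℂ := fun η => (((1 + ‖η‖ ^ 2) ^ (r / 2) : ℝ) : ℂ) * fourierLoc v φ η with hg
  have hgc : Continuous g := (Complex.continuous_ofReal.comp hJ).mul hw
  set f : ℰ → ℝ≥0∞ := fun ζ => ENNReal.ofReal (‖κ ζ‖ * (1 + ‖ζ‖) ^ N) with hf
  have hfc : Continuous f := ENNReal.continuous_ofReal.comp (by fun_prop)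
  have hnorm : coneNorm 2 r v φ V = (∫⁻ η in V, ‖g η‖ₑ ^ (2 : ℝ)) ^ (1 / (2 : ℝ)) := by
    unfold coneNorm
    rw [eLpNorm_eq_lintegral_rpow_enorm_toReal (by norm_num) (by norm_num)]
    simp [hg]
  rw [hnorm, ← lintegral_const_mul' _ _ ENNReal.ofReal_ne_top]
  -- Peetre's inequality distributes the weight at `ξ`: the share at `ξ - η` is absorbed into `f`,
  -- and the share at `η` makes up `g`, whose `L²(V)` norm is the cone norm.
  have hpt : ∀ η, ENNReal.ofReal ((1 + ‖ξ‖ ^ 2) ^ (r / 2)) * ‖κ (ξ - η) * fourierLoc v φ η‖ₑ ≤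
      ENNReal.ofReal (2 ^ (r / 2)) * (f (ξ - η) * ‖g η‖ₑ) := fun η => by
    rw [← ofReal_norm, ← ofReal_norm, hf, ← ENNReal.ofReal_mul (by positivity),
      ← ENNReal.ofReal_mul (by positivity), ← ENNReal.ofReal_mul (by positivity)]
    refine ENNReal.ofReal_le_ofReal ?_
    rw [hg, norm_mul, norm_mul, Complex.norm_real, Real.norm_of_nonneg (by positivity)]
    calc _ ≤ (2 ^ (r / 2) * (1 + ‖ξ - η‖ ^ 2) ^ (r / 2) * (1 + ‖η‖ ^ 2) ^ (r / 2)) *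
          (‖κ (ξ - η)‖ * ‖fourierLoc v φ η‖) := by
          gcongr; exact japanese_rpow_le_mul hr ξ η
      _ ≤ (2 ^ (r / 2) * (1 + ‖ξ - η‖) ^ N * (1 + ‖η‖ ^ 2) ^ (r / 2)) *
          (‖κ (ξ - η)‖ * ‖fourierLoc v φ η‖) := by
          gcongr; exact japanese_rpow_le hr hN _
      _ = _ := by ring
  refine (lintegral_mono hpt).trans ?_
  rw [lintegral_const_mul' _ _ ENNReal.ofReal_ne_top, mul_assoc]
  gcongr
  refine (ENNReal.lintegral_mul_le_Lp_mul_Lq (volume.restrict V) Real.HolderConjugate.two_two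
    (hfc.comp (continuous_const.sub continuous_id)).aemeasurable
    hgc.enorm.aemeasurable).trans ?_
  refine mul_le_mul_left (ENNReal.rpow_le_rpow ?_ (by norm_num)) _
  refine (setLIntegral_le_lintegral V _).trans_eq ?_
  exact lintegral_sub_left_eq_self (fun ζ => f ζ ^ (2 : ℝ)) ξ

/-- The part of the convolution away from the cone. -/
lemma lintegral_compl_cone_le {w : ℰ → ℂ} {V : Set ℰ} (hV : MeasurableSet V) {J D : ℝ}
    (hJ : 0 ≤ J) (hD : 0 ≤ D) {k : ℰ → ℂ}
    (h : ∀ η ∉ V, ‖((J : ℂ) * k η * ((1 + ‖η‖ : ℝ) : ℂ) ^ (m + 1)) * w η‖ ≤ D) :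
    ENNReal.ofReal J * ∫⁻ η in Vᶜ, ‖k η * w η‖ₑ ≤
      ENNReal.ofReal (D * ∫ η : ℰ, (1 + ‖η‖) ^ (-((m + 1 : ℕ) : ℝ))) := by
  -- The factor `(1 + ‖η‖)^(m+1)` is included in `h` so that dividing by it leaves an integrable
  -- function of `η`.
  have hint : Integrable fun η : ℰ => D * (1 + ‖η‖) ^ (-((m + 1 : ℕ) : ℝ)) :=
    (integrable_one_add_norm (by simp)).const_mul D
  rw [← integral_const_mul, ofReal_integral_eq_lintegral_ofReal hint
    (.of_forall fun η => by positivity), ← lintegral_const_mul' _ _ ENNReal.ofReal_ne_top]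
  refine (setLIntegral_mono' hV.compl fun η hη => ?_).trans (setLIntegral_le_lintegral Vᶜ _)
  rw [← ofReal_norm, ← ENNReal.ofReal_mul hJ]
  refine ENNReal.ofReal_le_ofReal ?_
  have hp : 0 < 1 + ‖η‖ := by positivity
  rw [Real.rpow_neg hp.le, Real.rpow_natCast, ← div_eq_mul_inv, le_div_iff₀ (by positivity)]
  refine le_of_eq_of_le ?_ (h η hη)
  simp only [norm_mul, norm_pow, Complex.norm_real, Real.norm_of_nonneg hJ,
    Real.norm_of_nonneg hp.le]
  ring

open scoped SchwartzMap in
-- Separation bounds both `‖ξ‖` and `‖η‖` by `c⁻¹ ‖ξ - η‖`, so polynomial weights in either variable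
-- are absorbed by the decay of `κ` at `ξ - η`. This is the hypothesis of
-- `isVonNBounded_range_smul_modulate`.
lemma exists_rapid_decay_of_separated (κ : 𝓢(ℰ, ℂ)) {r : ℝ} (hr : 0 ≤ r) {V' V : Set ℰ} {c : ℝ}
    (hc : 0 < c) (hsep : ∀ ξ ∈ V', ∀ η ∉ V, c * (‖ξ‖ + ‖η‖) ≤ ‖ξ - η‖) (l n : ℕ) :
    ∃ C : ℝ, ∀ ξ ∈ V', ∀ η ∉ V,
      ‖(((1 + ‖ξ‖ ^ 2) ^ (r / 2) : ℝ) : ℂ) * κ (ξ - η) * ((1 + ‖η‖ : ℝ) : ℂ) ^ l‖ *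
        (1 + ‖η‖) ^ n ≤ C := by
  obtain ⟨N, hN⟩ := exists_nat_ge r
  obtain ⟨C, hC0, hC⟩ := exists_schwartz_decay κ (N + l + n)
  refine ⟨(1 + c⁻¹) ^ (N + l + n) * C, fun ξ hξ η hη => ?_⟩
  have hs := hsep ξ hξ η hη
  have h1 : ‖ξ‖ + ‖η‖ ≤ c⁻¹ * ‖ξ - η‖ := by
    rw [inv_mul_eq_div, le_div_iff₀ hc]; linarith
  have hci : 0 < c⁻¹ := inv_pos.2 hc
  have h2 : 1 + ‖ξ‖ ≤ (1 + c⁻¹) * (1 + ‖ξ - η‖) := by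
    nlinarith [norm_nonneg ξ, norm_nonneg η, norm_nonneg (ξ - η)]
  have h3 : 1 + ‖η‖ ≤ (1 + c⁻¹) * (1 + ‖ξ - η‖) := by
    nlinarith [norm_nonneg ξ, norm_nonneg η, norm_nonneg (ξ - η)]
  rw [norm_mul, norm_mul, norm_pow, Complex.norm_real, Complex.norm_real,
    Real.norm_of_nonneg (by positivity), Real.norm_of_nonneg (by positivity)]
  calc _ ≤ (1 + ‖ξ‖) ^ N * ‖κ (ξ - η)‖ * (1 + ‖η‖) ^ l * (1 + ‖η‖) ^ n := by
        gcongr; exact japanese_rpow_le hr hN ξ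
    _ ≤ ((1 + c⁻¹) * (1 + ‖ξ - η‖)) ^ N * ‖κ (ξ - η)‖ * ((1 + c⁻¹) * (1 + ‖ξ - η‖)) ^ l *
        ((1 + c⁻¹) * (1 + ‖ξ - η‖)) ^ n := by gcongr
    _ = (1 + c⁻¹) ^ (N + l + n) * (‖κ (ξ - η)‖ * (1 + ‖ξ - η‖) ^ (N + l + n)) := by
        rw [mul_pow, mul_pow, mul_pow]; ring
    _ ≤ _ := by gcongr; exact hC _

/-- Let `χ = ψ φ`. In a set `V'` that is conically separated from the complement of `V`, the
weighted supremum of `ℱ (χ v)` is bounded by the weighted `L²(V)` norm of `ℱ (φ v)` and the values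
of `v` on a bounded set of test functions. -/
theorem exists_fourierLoc_bound (φ χ : 𝓓(Ω, ℂ)) {ψ : ℰ → ℂ} (hψ : ContDiff ℝ ∞ ψ)
    (hψc : HasCompactSupport ψ) (hχ : ∀ x, χ x = ψ x * φ x) {r : ℝ} (hr : 0 ≤ r) {V' V : Set ℰ}
    (hV : MeasurableSet V) {c : ℝ} (hc : 0 < c)
    (hsep : ∀ ξ ∈ V', ∀ η ∉ V, c * (‖ξ‖ + ‖η‖) ≤ ‖ξ - η‖) :
    ∃ (C : ℝ) (B : Set 𝓓(Ω, ℂ)), 0 < C ∧ Bornology.IsVonNBounded ℝ B ∧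
      ∀ v : 𝓓(Ω, ℂ) →ₗ[ℂ] ℂ, Continuous v → ∀ M D : ℝ, 0 ≤ M → 0 ≤ D →
        coneNorm 2 r v φ V ≤ ENNReal.ofReal M → (∀ f ∈ B, ‖v f‖ ≤ D) →
        ∀ ξ ∈ V', (1 + ‖ξ‖ ^ 2) ^ (r / 2) * ‖fourierLoc v χ ξ‖ ≤ C * (M + D) := by
  obtain ⟨κ, hκ⟩ := exists_schwartz_eq_integral hψ hψc
  obtain ⟨N, hN⟩ := exists_nat_ge r
  -- The coefficients are such that `v (a p • modulate p.1.2 φ)` is the weighted integrand at `(ξ,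
  -- η) = p.1` times `(1 + ‖η‖)^(m+1)`. They do not involve `v`.
  let a : {p : ℰ × ℰ // p.1 ∈ V' ∧ p.2 ∉ V} → ℂ := fun p =>
    (((1 + ‖p.1.1‖ ^ 2) ^ (r / 2) : ℝ) : ℂ) * κ (p.1.1 - p.1.2) *
      ((1 + ‖p.1.2‖ : ℝ) : ℂ) ^ (m + 1)
  set A := (∫⁻ ζ, ENNReal.ofReal (‖κ ζ‖ * (1 + ‖ζ‖) ^ N) ^ (2 : ℝ)) ^ (1 / (2 : ℝ)) with hA
  have hAt : A ≠ ⊤ := ENNReal.rpow_ne_top_of_nonneg (by norm_num)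
    (lintegral_schwartz_mul_pow_sq_lt_top κ N).ne
  set I : ℝ := ∫ η : ℰ, (1 + ‖η‖) ^ (-((m + 1 : ℕ) : ℝ)) with hI
  have hI0 : 0 ≤ I := integral_nonneg fun η => by positivity
  -- The two parts of the integral contribute `2^(r/2) A M` and `I D`. The summand `1` makes the
  -- constant positive, so that it can be divided by later.
  refine ⟨2 ^ (r / 2) * A.toReal + I + 1, range fun p => a p • modulate p.1.2 φ,
    by positivity, isVonNBounded_range_smul_modulate φ a (fun p => p.1.2) fun n => ?_, ?_⟩
  · obtain ⟨C, hC⟩ := exists_rapid_decay_of_separated κ hr hc hsep (m + 1) n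
    exact ⟨C, fun p => hC _ p.2.1 _ p.2.2⟩
  intro v hv M D hM hD hM' hD' ξ hξ
  set J : ℝ := (1 + ‖ξ‖ ^ 2) ^ (r / 2) with hJ
  have hJ0 : 0 ≤ J := by positivity
  have h1 : ENNReal.ofReal (J * ‖fourierLoc v χ ξ‖) ≤
      ENNReal.ofReal (2 ^ (r / 2) * A.toReal * M) + ENNReal.ofReal (D * I) := by
    rw [ENNReal.ofReal_mul hJ0, ofReal_norm, fourierLoc_mul_eq_integral hv φ χ hκ hχ]
    refine (mul_le_mul_right (enorm_integral_le_lintegral_enorm _) _).trans ?_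
    rw [← lintegral_add_compl _ hV, mul_add]
    refine add_le_add ?_ ?_
    · refine (lintegral_cone_le hv φ κ hr hN V ξ).trans ?_
      rw [ENNReal.ofReal_mul (by positivity), ENNReal.ofReal_mul (by positivity),
        ENNReal.ofReal_toReal hAt]
      gcongr
    · refine lintegral_compl_cone_le hV hJ0 hD fun η hη => ?_
      have h2 := hD' _ ⟨⟨(ξ, η), hξ, hη⟩, rfl⟩
      rw [map_smul, smul_eq_mul] at h2
      exact h2
  rw [← ENNReal.ofReal_add (by positivity) (by positivity),
    ENNReal.ofReal_le_ofReal_iff (by positivity)] at h1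
  refine h1.trans ?_
  have h3 : 0 ≤ 2 ^ (r / 2) * A.toReal := by positivity
  nlinarith [mul_nonneg h3 hD, mul_nonneg hI0 hM]

end ConeEstimate

/-! ### Continuity of the passage from test functions on `x(O)` to test sections. -/

section LocalSections

/-- The bound is taken at least `1` so that it is dominated by its own positive powers, as the
estimate for derivatives of a composite requires. -/
lemma exists_norm_iteratedFDerivWithin_le_of_isCompact {X Z : Type*} [NormedAddCommGroup X]
    [NormedSpace ℝ X] [NormedAddCommGroup Z] [NormedSpace ℝ Z] {U S : Set X} (hU : IsOpen U)
    (hS : IsCompact S) (hSU : S ⊆ U) {q : X → Z} (hq : ContDiffOn ℝ ∞ q U) (n : ℕ) :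
    ∃ R : ℝ, 1 ≤ R ∧ ∀ i ≤ n, ∀ x ∈ S, ‖iteratedFDerivWithin ℝ i q U x‖ ≤ R := by
  have h1 : ∀ i : ℕ, ∃ R : ℝ, ∀ x ∈ S, ‖iteratedFDerivWithin ℝ i q U x‖ ≤ R := fun i =>
    hS.exists_bound_of_continuousOn
      ((hq.continuousOn_iteratedFDerivWithin (by exact_mod_cast le_top) hU.uniqueDiffOn).mono hSU)
  choose R hR using h1
  refine ⟨1 + ∑ i ∈ Finset.range (n + 1), |R i|, le_add_of_nonneg_right (by positivity),
    fun i hi x hx => (hR i x hx).trans ((le_abs_self _).trans ?_)⟩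
  have := Finset.single_le_sum (f := fun i => |R i|) (fun i _ => abs_nonneg _)
    (Finset.mem_range.2 (Nat.lt_succ_of_le hi))
  linarith

/-- The derivatives of `(f ∘ g) h` on a compact set are controlled by the derivatives of `f`. -/
lemma exists_norm_iteratedFDeriv_comp_mul_le {X Y : Type*} [NormedAddCommGroup X]
    [NormedSpace ℝ X] [NormedAddCommGroup Y] [NormedSpace ℝ Y] {U S : Set X} (hU : IsOpen U)
    (hS : IsCompact S) (hSU : S ⊆ U) {g : X → Y} (hg : ContDiffOn ℝ ∞ g U) {h : X → ℂ}
    (hh : ContDiffOn ℝ ∞ h U) (n : ℕ) :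
    ∃ C : ℝ, 0 ≤ C ∧ ∀ f : Y → ℂ, ContDiff ℝ ∞ f → ∀ D : ℝ,
      (∀ i ≤ n, ∀ y, ‖iteratedFDeriv ℝ i f y‖ ≤ D) → ∀ x ∈ S,
        ‖iteratedFDeriv ℝ n (fun t => f (g t) * h t) x‖ ≤ C * D := by
  have hUd := hU.uniqueDiffOn (𝕜 := ℝ)
  obtain ⟨G, hG1, hG⟩ := exists_norm_iteratedFDerivWithin_le_of_isCompact hU hS hSU hg n
  obtain ⟨H, hH1, hH⟩ := exists_norm_iteratedFDerivWithin_le_of_isCompact hU hS hSU hh n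
  refine ⟨∑ i ∈ Finset.range (n + 1), (n.choose i : ℝ) * (i.factorial * G ^ i) * H,
    Finset.sum_nonneg fun i _ => by positivity, fun f hf D hD x hx => ?_⟩
  have hD0 : 0 ≤ D := (norm_nonneg _).trans (hD 0 (Nat.zero_le n) (g x))
  have hfg : ContDiffOn ℝ ∞ (fun t => f (g t)) U := hf.comp_contDiffOn hg
  rw [← iteratedFDerivWithin_of_isOpen n hU (hSU hx)]
  refine (norm_iteratedFDerivWithin_mul_le hfg hh hUd (hSU hx) (n := n)
    (by exact_mod_cast le_top)).trans ?_
  rw [Finset.sum_mul]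
  refine Finset.sum_le_sum fun i hi => ?_
  have hin : i ≤ n := Nat.lt_succ_iff.1 (Finset.mem_range.1 hi)
  have h1 : ‖iteratedFDerivWithin ℝ i (fun t => f (g t)) U x‖ ≤ i.factorial * D * G ^ i := by
    refine norm_iteratedFDerivWithin_comp_le (g := f) (f := g) (t := univ) hf.contDiffOn hg
      (by exact_mod_cast le_top) uniqueDiffOn_univ hUd (fun _ _ => mem_univ _) (hSU hx)
      (fun l hl => ?_) fun l hl1 hl => ?_
    · rw [iteratedFDerivWithin_univ]
      exact hD l (hl.trans hin) _
    · exact (hG l (hl.trans hin) x hx).trans (le_self_pow₀ hG1 (by lia))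
  calc _ ≤ (n.choose i : ℝ) * (i.factorial * D * G ^ i) * H := by
        gcongr
        exact hH _ (Nat.sub_le n i) x hx
    _ = _ := by ring

variable {m k : ℕ} {M : Type*} [TopologicalSpace M]
  [ChartedSpace (EuclideanSpace ℝ (Fin m)) M] {E : M → Type*}
  [∀ p, AddCommGroup (E p)] [∀ p, Module ℂ (E p)] [∀ p, TopologicalSpace (E p)]
  [TopologicalSpace (TotalSpace (Fin k → ℂ) E)] [FiberBundle (Fin k → ℂ) E]
  [VectorBundle ℂ (Fin k → ℂ) E]

local notation "ℰ" => EuclideanSpace ℝ (Fin m)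

/-- The absolute value is harmless because the Jacobian determinant does not vanish. This factor of
`TrivChart.coeff_eq` is independent of the test function, so its derivatives enter only the
constants. -/
lemma TrivChart.contDiffAt_coeff_factor [IsManifold (𝓡 m) ∞ M] (c c' : TrivChart m k E)
    (j l : Fin k) {t : ℰ} (ht : t ∈ c'.chart.target) (hs : c'.chart.symm t ∈ c.chart.source) :
    ContDiffAt ℝ ∞ (fun t => c'.triv.coordChangeL ℂ c.triv (c'.chart.symm t) (Pi.single l 1) j *
      ((|(EuclideanSpace.basisFun (Fin m) ℝ).toBasis.det fun i =>
        fderiv ℝ (fun s => c.chart (c'.chart.symm s)) t (EuclideanSpace.single i 1)| : ℝ) : ℂ))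
      t := by
  have hg := c.contDiffAt_transition c' ht hs
  refine ContDiffAt.mul ?_ ?_
  · have h1 := ((c'.contMDiffOn_coordChangeL c).contMDiffAt
      ((c'.triv.open_baseSet.inter c.triv.open_baseSet).mem_nhds
        ⟨c'.source_subset (c'.chart.map_target ht), c.source_subset hs⟩)).comp t
      ((contMDiffOn_symm_of_mem_maximalAtlas c'.chart_mem).contMDiffAt
        (c'.chart.open_target.mem_nhds ht))
    rw [contMDiffAt_iff_contDiffAt] at h1
    let T : ((Fin k → ℂ) →L[ℂ] (Fin k → ℂ)) →L[ℝ] ℂ :=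
      ((ContinuousLinearMap.proj (R := ℂ) (φ := fun _ : Fin k => ℂ) j).comp
        (ContinuousLinearMap.apply ℂ (Fin k → ℂ) (Pi.single l (1 : ℂ)))).restrictScalars ℝ
    exact T.contDiff.contDiffAt.comp t h1
  · have hdet : ContDiffAt ℝ ∞ (fun t => (EuclideanSpace.basisFun (Fin m) ℝ).toBasis.det fun i =>
        fderiv ℝ (fun s => c.chart (c'.chart.symm s)) t (EuclideanSpace.single i 1)) t := by
      simp_rw [Module.Basis.det_apply, Matrix.det_apply]
      refine ContDiffAt.sum fun σ _ => ContDiffAt.const_smul _ ?_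
      refine contDiffAt_prod fun i _ => ?_
      have h1 : ContDiffAt ℝ ∞ (fderiv ℝ (fun s => c.chart (c'.chart.symm s))) t :=
        hg.fderiv_right (by simp)
      have h2 := h1.clm_apply (contDiffAt_const (c := EuclideanSpace.single i (1 : ℝ)))
      exact (EuclideanSpace.proj (σ i)).contDiff.contDiffAt.comp t h2
    refine Complex.ofRealCLM.contDiff.contDiffAt.comp t (ContDiffAt.comp t (contDiffAt_abs ?_) hdet)
    exact c.det_transition_ne_zero c' ht hs

/-- The section `(ϕ ∘ x) σ^j` vanishes outside the image of the support of `ϕ`. -/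
lemma TrivChart.roughSection_eq_zero (c : TrivChart m k E) (j : Fin k) (ϕ : 𝓓(c.dom, ℂ))
    {K : Set ℰ} (hK : tsupport ϕ ⊆ K) {p : M} (hp : p ∉ c.chart.symm '' K) :
    c.roughSection j ϕ p = 0 := by
  unfold TrivChart.roughSection
  split_ifs with h
  · have : ϕ (c.chart p) = 0 := by
      by_contra hne
      exact hp ⟨c.chart p, hK (subset_tsupport _ hne), c.chart.left_inv h⟩
    rw [this, zero_smul]
  · rfl

lemma SupportedSection.continuous_val {K : Set M} (hK : IsCompact K) :
    Continuous (fun φ : SupportedSection m k E K => φ.1) :=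
  continuous_sInf_rng.2 fun _ ht => ht.2.2.2 K hK

instance : ContinuousSMul ℝ (TestSection m k E) where
  continuous_smul := (Complex.continuous_ofReal.comp continuous_fst).smul continuous_snd

variable [T2Space M] [IsManifold (𝓡 m) ∞ M]

/-- Near points over the image of `K` the coefficient is the test function composed with the
transition map, times a fixed smooth factor; near all other points of `S` it vanishes. A constant
for the first kind of point therefore suffices. -/
lemma TrivChart.exists_norm_iteratedFDeriv_coeff_le (c c' : TrivChart m k E) (j l : Fin k)
    (K : TopologicalSpace.Compacts ℰ) (hK : (K : Set ℰ) ⊆ c.dom) {S : Set ℰ} (hS : IsCompact S)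
    (hSt : S ⊆ c'.chart.target) (n : ℕ) :
    ∃ C : ℝ, 0 ≤ C ∧ ∀ f : 𝓓_{K}(ℰ, ℂ), ∀ t ∈ S,
      ‖iteratedFDeriv ℝ n (c'.coeff l (c.roughSection j (TestFunction.ofSupportedIn hK f))) t‖ ≤
        C * ∑ i ∈ Finset.range (n + 1), N[ℝ]_{K, i} f := by
  set KM : Set M := c.chart.symm '' K with hKM
  have hKMc : IsCompact KM := K.isCompact.image_of_continuousOn (c.chart.continuousOn_symm.mono hK)
  have hKMs : KM ⊆ c.chart.source := by
    rintro _ ⟨s, hs, rfl⟩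
    exact c.chart.map_target (hK hs)
  set U : Set ℰ := c'.chart.target ∩ c'.chart.symm ⁻¹' c.chart.source with hU
  have hUo : IsOpen U := c'.chart.symm.isOpen_inter_preimage c.chart.open_source
  -- This part of `S` is compact because the compact set `KM` is closed in the Hausdorff space `M`,
  -- and it lies in the open overlap `U`, where the factors are smooth.
  set S₁ : Set ℰ := S ∩ c'.chart.symm ⁻¹' KM with hS₁
  have hS₁c : IsCompact S₁ := hS.of_isClosed_subset
    ((c'.chart.continuousOn_symm.mono hSt).preimage_isClosed_of_isClosed hS.isClosed
      hKMc.isClosed) inter_subset_left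
  have hS₁U : S₁ ⊆ U := fun t ht => ⟨hSt ht.1, hKMs ht.2⟩
  obtain ⟨C, hC0, hC⟩ := exists_norm_iteratedFDeriv_comp_mul_le hUo hS₁c hS₁U
    (g := fun t => c.chart (c'.chart.symm t))
    (fun t ht => (c.contDiffAt_transition c' ht.1 ht.2).contDiffWithinAt)
    (fun t ht => (c.contDiffAt_coeff_factor c' j l ht.1 ht.2).contDiffWithinAt) n
  refine ⟨C, hC0, fun f t ht => ?_⟩
  set ϕ : 𝓓(c.dom, ℂ) := TestFunction.ofSupportedIn hK f with hϕ
  have hsum : ∀ i ≤ n, ∀ y, ‖iteratedFDeriv ℝ i ϕ y‖ ≤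
      ∑ i ∈ Finset.range (n + 1), N[ℝ]_{K, i} f := fun i hi y =>
    (ContDiffMapSupportedIn.norm_iteratedFDeriv_apply_le_seminorm_top ℝ (f := f)).trans
      (Finset.single_le_sum (f := fun i => N[ℝ]_{K, i} f) (fun i _ => apply_nonneg _ _)
        (Finset.mem_range.2 (Nat.lt_succ_of_le hi)))
  by_cases htK : c'.chart.symm t ∈ KM
  · have htU : t ∈ U := hS₁U ⟨ht, htK⟩
    have hev : c'.coeff l (c.roughSection j ϕ) =ᶠ[𝓝 t] fun t => ϕ (c.chart (c'.chart.symm t)) *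
        (c'.triv.coordChangeL ℂ c.triv (c'.chart.symm t) (Pi.single l 1) j *
        ((|(EuclideanSpace.basisFun (Fin m) ℝ).toBasis.det fun i =>
        fderiv ℝ (fun s => c.chart (c'.chart.symm s)) t (EuclideanSpace.single i 1)| : ℝ) : ℂ)) := by
      filter_upwards [hUo.mem_nhds htU] with s hs using c.coeff_eq c' j l ϕ hs.1 hs.2
    rw [(hev.iteratedFDeriv ℝ n).eq_of_nhds]
    exact hC ϕ ϕ.contDiff _ hsum t ⟨ht, htK⟩
  · have hev : c'.coeff l (c.roughSection j ϕ) =ᶠ[𝓝 t] fun _ => 0 := by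
      filter_upwards [(c'.chart.symm.continuousAt (hSt ht))
        (hKMc.isClosed.isOpen_compl.mem_nhds htK)] with s hs
      unfold TrivChart.coeff
      rw [c.roughSection_eq_zero j ϕ f.tsupport_subset hs]
      rfl
    rw [(hev.iteratedFDeriv ℝ n).eq_of_nhds]
    have h0 : iteratedFDeriv ℝ n (fun _ : ℰ => (0 : ℂ)) t = 0 := by
      rw [iteratedFDeriv_fun_zero]; rfl
    rw [h0, norm_zero]
    exact mul_nonneg hC0 (Finset.sum_nonneg fun i _ => apply_nonneg _ _)

/-- The map `ϕ ↦ (ϕ ∘ x) σ^j` is continuous. -/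
theorem TrivChart.continuous_localSection (c : TrivChart m k E) (j : Fin k) :
    Continuous (c.localSection j) := by
  rw [TestFunction.continuous_iff_continuous_comp]
  intro K hK
  have hKMc : IsCompact (c.chart.symm '' K) :=
    K.isCompact.image_of_continuousOn (c.chart.continuousOn_symm.mono hK)
  -- For fixed `K` the sections stay in a single Fréchet space `Γ_{x⁻¹(K)}(E^∨)`, from which the
  -- inclusion into `Γ_c(E^∨)` is continuous.
  let F : 𝓓_{K}(ℰ, ℂ) → SupportedSection m k E (c.chart.symm '' K) := fun f =>
    ⟨c.localSection j (TestFunction.ofSupportedIn hK f), fun p hp =>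
      c.roughSection_eq_zero j (TestFunction.ofSupportedIn hK f) f.tsupport_subset hp⟩
  suffices hF : Continuous F from (SupportedSection.continuous_val hKMc).comp hF
  refine continuous_iInf_rng.2 fun c' => continuous_iInf_rng.2 fun l => continuous_iInf_rng.2
    fun n => continuous_induced_rng.2 (continuous_iff_continuousAt.2 fun f₀ => ?_)
  refine UniformOnFun.tendsto_iff_tendstoUniformlyOn.2 fun S hS => ?_
  obtain ⟨C, hC0, hC⟩ := c.exists_norm_iteratedFDeriv_coeff_le c' j l K hK hS.1 hS.2 n
  rw [Metric.tendstoUniformlyOn_iff]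
  intro ε hε
  have hcont : Continuous fun f : 𝓓_{K}(ℰ, ℂ) =>
      C * ∑ i ∈ Finset.range (n + 1), N[ℝ]_{K, i} (f - f₀) :=
    continuous_const.mul (continuous_finsetSum _ fun i _ =>
      ((ContDiffMapSupportedIn.withSeminorms ℝ ℰ ℂ ⊤ K).continuous_seminorm i).comp
        (continuous_id.sub continuous_const))
  have hlt : ∀ᶠ f in 𝓝 f₀, C * ∑ i ∈ Finset.range (n + 1), N[ℝ]_{K, i} (f - f₀) < ε :=
    hcont.continuousAt.eventually_lt continuousAt_const (by simpa using hε)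
  filter_upwards [hlt] with f hf t ht
  refine lt_of_le_of_lt ?_ hf
  refine le_of_eq_of_le ?_ (hC (f - f₀) t ht)
  have hdiff : ∀ ϕ : 𝓓(c.dom, ℂ),
      ContDiffAt ℝ n (c'.coeff l (c.roughSection j ϕ)) t := fun ϕ =>
    ((c.contDiffOn_coeff c' j l ϕ).contDiffAt (c'.chart.open_target.mem_nhds (hS.2 ht))).of_le
      (by exact_mod_cast le_top)
  have hsub : c'.coeff l (c.roughSection j (TestFunction.ofSupportedIn hK (f - f₀))) =
      c'.coeff l (c.roughSection j (TestFunction.ofSupportedIn hK f)) -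
        c'.coeff l (c.roughSection j (TestFunction.ofSupportedIn hK f₀)) := by
    have h1 : (c.localSection j (TestFunction.ofSupportedIn hK (f - f₀))) =
        c.localSection j (TestFunction.ofSupportedIn hK f) -
          c.localSection j (TestFunction.ofSupportedIn hK f₀) := by
      rw [← map_sub]; rfl
    funext s
    exact congrArg (fun φ : TestSection m k E => c'.coeff l φ.1 s) h1
  rw [hsub, dist_comm, dist_eq_norm]
  congr 1
  exact (iteratedFDeriv_sub_apply (hdiff _) (hdiff _)).symm

/-- The components, so far mere linear functionals, are thereby distributions, and the Euclidean
estimates apply to them. -/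
lemma TrivChart.continuous_localRep (c : TrivChart m k E) (j : Fin k) (u : DistSection m k E) :
    Continuous (c.localRep j u) :=
  u.continuous.comp (c.continuous_localSection j)

/-- The image of a bounded set of test functions is bounded in `Γ_c(E^∨)`. -/
lemma TrivChart.isVonNBounded_image_localSection (c : TrivChart m k E) (j : Fin k)
    {B : Set 𝓓(c.dom, ℂ)} (hB : Bornology.IsVonNBounded ℝ B) :
    Bornology.IsVonNBounded ℂ (c.localSection j '' B) := by
  let T : 𝓓(c.dom, ℂ) →L[ℝ] TestSection m k E :=
    ⟨(c.localSection j).restrictScalars ℝ, c.continuous_localSection j⟩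
  exact (hB.image T).extend_scalars ℂ

end LocalSections

/-! ### Patching microlocal decay over compact sets. -/

section Microlocalization

variable {m : ℕ} {Ω : TopologicalSpace.Opens (EuclideanSpace ℝ (Fin m))}

local notation "ℰ" => EuclideanSpace ℝ (Fin m)

lemma exists_contDiff_hasCompactSupport_eq_one {K : Set ℰ} (hK : IsCompact K) :
    ∃ β : ℰ → ℂ, ContDiff ℝ ∞ β ∧ HasCompactSupport β ∧ ∀ x ∈ K, β x = 1 := by
  obtain ⟨R, hR⟩ := hK.isBounded.exists_norm_le
  let b : ContDiffBump (0 : ℰ) := ⟨|R| + 1, |R| + 2, by positivity, by linarith⟩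
  refine ⟨fun x => (b x : ℂ), Complex.ofRealCLM.contDiff.comp b.contDiff,
    b.hasCompactSupport.comp_left (g := fun r : ℝ => (r : ℂ)) Complex.ofReal_zero, fun x hx => ?_⟩
  have : b x = 1 := b.one_of_mem_closedBall (by
    rw [mem_closedBall_zero_iff]
    exact (hR x hx).trans ((le_abs_self R).trans (by change |R| ≤ |R| + 1; linarith)))
  simp [this]

/-- The product of a test function with a smooth function. -/
def smoothMul {ψ : ℰ → ℂ} (hψ : ContDiff ℝ ∞ ψ) (φ : 𝓓(Ω, ℂ)) : 𝓓(Ω, ℂ) where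
  toFun x := ψ x * φ x
  contDiff' := hψ.mul φ.contDiff
  hasCompactSupport' := φ.hasCompactSupport.mul_left
  tsupport_subset' := tsupport_mul_subset_right.trans φ.tsupport_subset

@[simp] lemma smoothMul_apply {ψ : ℰ → ℂ} (hψ : ContDiff ℝ ∞ ψ) (φ : 𝓓(Ω, ℂ)) (x : ℰ) :
    smoothMul hψ φ x = ψ x * φ x := rfl

/-- Only the values of the multiplier on `supp φ` matter, so it can be cut off; Fourier inversion
requires compact support. -/
lemma exists_eq_mul_hasCompactSupport {ψ : ℰ → ℂ} (hψ : ContDiff ℝ ∞ ψ) (φ : 𝓓(Ω, ℂ)) :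
    ∃ ψ' : ℰ → ℂ, ContDiff ℝ ∞ ψ' ∧ HasCompactSupport ψ' ∧ ∀ x, ψ x * φ x = ψ' x * φ x := by
  obtain ⟨β, hβ, hβc, hβ1⟩ := exists_contDiff_hasCompactSupport_eq_one φ.hasCompactSupport
  refine ⟨fun x => ψ x * β x, hψ.mul hβ, hβc.mul_left, fun x => ?_⟩
  by_cases hx : x ∈ tsupport φ
  · change ψ x * φ x = ψ x * β x * φ x
    rw [hβ1 x hx, mul_one]
  · rw [image_eq_zero_of_notMem_tsupport hx, mul_zero, mul_zero]

/-- The cone generated by a set. -/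
def coneOver (t : Set ℰ) : Set ℰ := {ξ | ∃ s : ℝ, 0 < s ∧ ∃ x ∈ t, ξ = s • x}

lemma coneOver_mono {s t : Set ℰ} (h : s ⊆ t) : coneOver s ⊆ coneOver t := by
  rintro _ ⟨a, ha, x, hx, rfl⟩
  exact ⟨a, ha, x, h hx, rfl⟩

lemma isCone_coneOver (t : Set ℰ) : IsCone (coneOver t) := by
  rintro _ ⟨a, ha, x, hx, rfl⟩ s hs
  exact ⟨s * a, mul_pos hs ha, x, hx, (mul_smul _ _ _).symm⟩

lemma subset_coneOver (t : Set ℰ) : t ⊆ coneOver t := fun x hx =>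
  ⟨1, one_pos, x, hx, (one_smul _ _).symm⟩

lemma isOpen_coneOver {t : Set ℰ} (ht : IsOpen t) : IsOpen (coneOver t) := by
  have : coneOver t = ⋃ (s : ℝ) (_ : 0 < s), (s • ·) '' t := by
    ext ξ
    simp only [coneOver, mem_ofPred_eq, mem_iUnion, mem_image, exists_prop]
    exact ⟨fun ⟨s, hs, x, hx, h⟩ => ⟨s, hs, x, hx, h.symm⟩,
      fun ⟨s, hs, x, hx, h⟩ => ⟨s, hs, x, hx, h.symm⟩⟩
  rw [this]
  exact isOpen_iUnion fun s => isOpen_iUnion fun hs => isOpenMap_smul₀ hs.ne' t ht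

/-- `⟨·⟩ ^ r ℱ (χ v)` is bounded on the cone over `t` for all multiples `χ` of `φ`. -/
def DecaysOver (r : ℝ) (v : 𝓓(Ω, ℂ) →ₗ[ℂ] ℂ) (φ : 𝓓(Ω, ℂ)) (t : Set ℰ) : Prop :=
  ∀ (ψ : ℰ → ℂ) (hψ : ContDiff ℝ ∞ ψ), ∃ C : ℝ, ∀ ξ ∈ coneOver t,
    (1 + ‖ξ‖ ^ 2) ^ (r / 2) * ‖fourierLoc v (smoothMul hψ φ) ξ‖ ≤ C

lemma DecaysOver.mono {r : ℝ} {v : 𝓓(Ω, ℂ) →ₗ[ℂ] ℂ} {φ : 𝓓(Ω, ℂ)} {s t : Set ℰ}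
    (h : DecaysOver r v φ t) (hst : s ⊆ t) : DecaysOver r v φ s := fun ψ hψ => by
  obtain ⟨C, hC⟩ := h ψ hψ
  exact ⟨C, fun ξ hξ => hC ξ (coneOver_mono hst hξ)⟩

lemma DecaysOver.union {r : ℝ} {v : 𝓓(Ω, ℂ) →ₗ[ℂ] ℂ} {φ : 𝓓(Ω, ℂ)} {s t : Set ℰ}
    (hs : DecaysOver r v φ s) (ht : DecaysOver r v φ t) : DecaysOver r v φ (s ∪ t) :=
  fun ψ hψ => by
  obtain ⟨C, hC⟩ := hs ψ hψ
  obtain ⟨D, hD⟩ := ht ψ hψ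
  refine ⟨max C D, ?_⟩
  rintro _ ⟨a, ha, x, hx | hx, rfl⟩
  · exact (hC _ ⟨a, ha, x, hx, rfl⟩).trans (le_max_left _ _)
  · exact (hD _ ⟨a, ha, x, hx, rfl⟩).trans (le_max_right _ _)

/-- Multiples of a multiple are multiples. This stability is what the quantifier over `ψ` in
`DecaysOver` is for. -/
lemma DecaysOver.smoothMul {r : ℝ} {v : 𝓓(Ω, ℂ) →ₗ[ℂ] ℂ} {φ : 𝓓(Ω, ℂ)} {t : Set ℰ}
    (h : DecaysOver r v φ t) {θ : ℰ → ℂ} (hθ : ContDiff ℝ ∞ θ) :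
    DecaysOver r v (smoothMul hθ φ) t := fun ψ hψ => by
  have h1 : _root_.smoothMul hψ (_root_.smoothMul hθ φ) = _root_.smoothMul (hψ.mul hθ) φ :=
    TestFunction.ext fun x => (mul_assoc _ _ _).symm
  rw [h1]
  exact h _ _

lemma fourierLoc_add (v : 𝓓(Ω, ℂ) →ₗ[ℂ] ℂ) (φ χ : 𝓓(Ω, ℂ)) (ξ : ℰ) :
    fourierLoc v (φ + χ) ξ = fourierLoc v φ ξ + fourierLoc v χ ξ := by
  have : modulate ξ (φ + χ) = modulate ξ φ + modulate ξ χ :=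
    TestFunction.ext fun x => mul_add _ _ _
  rw [fourierLoc, this, map_add]
  rfl

lemma DecaysOver.add {r : ℝ} {v : 𝓓(Ω, ℂ) →ₗ[ℂ] ℂ} {φ χ : 𝓓(Ω, ℂ)} {t : Set ℰ}
    (hφ : DecaysOver r v φ t) (hχ : DecaysOver r v χ t) : DecaysOver r v (φ + χ) t :=
  fun ψ hψ => by
  obtain ⟨C, hC⟩ := hφ ψ hψ
  obtain ⟨D, hD⟩ := hχ ψ hψ
  refine ⟨C + D, fun ξ hξ => ?_⟩
  have h1 : _root_.smoothMul hψ (φ + χ) = _root_.smoothMul hψ φ + _root_.smoothMul hψ χ :=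
    TestFunction.ext fun x => mul_add _ _ _
  rw [h1, fourierLoc_add]
  calc _ ≤ (1 + ‖ξ‖ ^ 2) ^ (r / 2) * (‖fourierLoc v (_root_.smoothMul hψ φ) ξ‖ +
        ‖fourierLoc v (_root_.smoothMul hψ χ) ξ‖) := by gcongr; exact norm_add_le _ _
    _ ≤ _ := by rw [mul_add]; exact add_le_add (hC ξ hξ) (hD ξ hξ)

/-- By the triangle inequality `‖ξ‖ + ‖η‖ ≤ 2‖ξ‖ + ‖ξ - η‖`, which gives the factor `2 / c + 1`. -/
lemma separated_of_le {ξ η : ℰ} {c : ℝ} (hc : 0 < c) (h : c * ‖ξ‖ ≤ ‖ξ - η‖) :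
    (2 / c + 1)⁻¹ * (‖ξ‖ + ‖η‖) ≤ ‖ξ - η‖ := by
  have h1 : ‖η‖ ≤ ‖ξ‖ + ‖ξ - η‖ := by
    calc ‖η‖ = ‖ξ - (ξ - η)‖ := by rw [sub_sub_cancel]
      _ ≤ _ := norm_sub_le _ _
  have h2 : ‖ξ‖ ≤ ‖ξ - η‖ / c := by rw [le_div_iff₀ hc]; linarith
  rw [inv_mul_le_iff₀ (by positivity)]
  have h3 : (2 / c + 1) * ‖ξ - η‖ = ‖ξ - η‖ / c + ‖ξ - η‖ / c + ‖ξ - η‖ := by ring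
  linarith

lemma exists_bound_on_isVonNBounded {v : 𝓓(Ω, ℂ) →ₗ[ℂ] ℂ} (hv : Continuous v) {B : Set 𝓓(Ω, ℂ)}
    (hB : Bornology.IsVonNBounded ℝ B) : ∃ D : ℝ, 0 ≤ D ∧ ∀ f ∈ B, ‖v f‖ ≤ D := by
  let T : 𝓓(Ω, ℂ) →L[ℝ] ℂ := ⟨v.restrictScalars ℝ, hv⟩
  obtain ⟨D, hD⟩ := (NormedSpace.image_isVonNBounded_iff ℝ).1 (hB.image T)
  exact ⟨max D 0, le_max_right _ _, fun f hf => (hD f hf).trans (le_max_left _ _)⟩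

/-- A point outside the Sobolev wave front set has a microlocal neighbourhood with decay. -/
lemma exists_decaysOver_of_notMem {v : 𝓓(Ω, ℂ) →ₗ[ℂ] ℂ} (hv : Continuous v) {r : ℝ} (hr : 0 ≤ r)
    {y η : ℰ} (hy : y ∈ Ω) (hη : η ≠ 0) (h : (y, η) ∉ euclSobolevWF r v) :
    ∃ φ : 𝓓(Ω, ℂ), φ y ≠ 0 ∧ ∃ s ∈ 𝓝 η, DecaysOver r v φ s := by
  have h1 : ∃ V : Set ℰ, IsOpen V ∧ IsCone V ∧ η ∈ V ∧
      ∃ φ : 𝓓(Ω, ℂ), φ y ≠ 0 ∧ coneNorm 2 r v φ V < ⊤ := by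
    by_contra hne
    exact h ⟨hy, hη, hne⟩
  obtain ⟨V, hVo, hVc, hηV, φ, hφ, hfin⟩ := h1
  obtain ⟨ε, hε, hball⟩ := Metric.isOpen_iff.1 hVo η hηV
  refine ⟨φ, hφ, Metric.ball η (ε / 2), Metric.ball_mem_nhds _ (half_pos hε), fun ψ hψ => ?_⟩
  -- After rescaling by `t⁻¹`, a point of the half-radius ball has distance at least `ε / 2` from
  -- the complement of the cone `V` and norm at most `‖η‖ + ε / 2`; the constant is the quotient.
  have hc : 0 < ε / 2 / (‖η‖ + ε / 2) := by positivity
  have hsep : ∀ ξ ∈ coneOver (Metric.ball η (ε / 2)), ∀ ζ ∉ V,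
      (2 / (ε / 2 / (‖η‖ + ε / 2)) + 1)⁻¹ * (‖ξ‖ + ‖ζ‖) ≤ ‖ξ - ζ‖ := by
    rintro _ ⟨t, ht, x, hx, rfl⟩ ζ hζ
    refine separated_of_le hc ?_
    have hx' : ‖x - η‖ < ε / 2 := by simpa [dist_eq_norm] using hx
    have h2 : t⁻¹ • ζ ∉ V := fun hmem => hζ (by
      have := hVc _ hmem t ht
      rwa [smul_inv_smul₀ ht.ne'] at this)
    have h3 : ε ≤ ‖t⁻¹ • ζ - η‖ := by
      by_contra hlt
      exact h2 (hball (by simpa [dist_eq_norm] using hlt))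
    have h4 : ‖t⁻¹ • ζ - η‖ ≤ ‖x - t⁻¹ • ζ‖ + ‖x - η‖ := by
      calc ‖t⁻¹ • ζ - η‖ = ‖(x - η) - (x - t⁻¹ • ζ)‖ := by congr 1; abel
        _ ≤ _ := (norm_sub_le _ _).trans_eq (add_comm _ _)
    have h5 : ‖x‖ ≤ ‖η‖ + ε / 2 := by
      calc ‖x‖ = ‖η + (x - η)‖ := by congr 1; abel
        _ ≤ _ := (norm_add_le _ _).trans (by linarith)
    have h6 : ‖t • x - ζ‖ = t * ‖x - t⁻¹ • ζ‖ := by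
      rw [← Real.norm_of_nonneg ht.le, ← norm_smul, Real.norm_of_nonneg ht.le, smul_sub,
        smul_inv_smul₀ ht.ne']
    rw [h6, norm_smul, Real.norm_of_nonneg ht.le, div_mul_eq_mul_div, div_le_iff₀ (by positivity)]
    have h7 : ε / 2 ≤ ‖x - t⁻¹ • ζ‖ := by linarith
    calc ε / 2 * (t * ‖x‖) = t * (ε / 2 * ‖x‖) := by ring
      _ ≤ t * (‖x - t⁻¹ • ζ‖ * (‖η‖ + ε / 2)) := by gcongr
      _ = _ := by ring
  obtain ⟨ψ', hψ', hψ'c, hψψ'⟩ := exists_eq_mul_hasCompactSupport hψ φ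
  obtain ⟨C, B, hC, hB, hbound⟩ := exists_fourierLoc_bound φ (smoothMul hψ φ) hψ' hψ'c hψψ' hr
    hVo.measurableSet (by positivity) hsep
  obtain ⟨D, hD0, hD⟩ := exists_bound_on_isVonNBounded hv hB
  exact ⟨C * ((coneNorm 2 r v φ V).toReal + D), hbound v hv _ D ENNReal.toReal_nonneg hD0
    (ENNReal.ofReal_toReal hfin.ne).ge hD⟩

/-- If no point of `{y} × t`, `t` compact, is in the Sobolev wave front set, then there is decay
over `t` near `y`. -/
lemma exists_decaysOver_of_isCompact {v : 𝓓(Ω, ℂ) →ₗ[ℂ] ℂ} (hv : Continuous v) {r : ℝ}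
    (hr : 0 ≤ r) {y : ℰ} (hy : y ∈ Ω) {t : Set ℰ} (ht : IsCompact t)
    (h : ∀ η ∈ t, η ≠ 0 ∧ (y, η) ∉ euclSobolevWF r v) :
    ∃ φ : 𝓓(Ω, ℂ), φ y ≠ 0 ∧ DecaysOver r v φ t := by
  refine ht.induction_on (p := fun s => ∃ φ : 𝓓(Ω, ℂ), φ y ≠ 0 ∧ DecaysOver r v φ s) ?_ ?_ ?_ ?_
  · obtain ⟨f, hf1, hf2, hf3, -, hf4⟩ :=
      exists_contDiff_tsupport_subset (n := ⊤) (Ω.isOpen.mem_nhds hy)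
    have hsub : tsupport (fun x => (f x : ℂ)) ⊆ tsupport f :=
      closure_mono fun x hx => by simpa using hx
    refine ⟨⟨fun x => (f x : ℂ), Complex.ofRealCLM.contDiff.comp hf3,
      hf2.comp_left (g := fun r : ℝ => (r : ℂ)) Complex.ofReal_zero, hsub.trans hf1⟩, ?_,
      fun ψ hψ => ⟨0, ?_⟩⟩
    · change (f y : ℂ) ≠ 0
      simp [hf4]
    · rintro _ ⟨_, _, _, hx, _⟩
      exact absurd hx (notMem_empty _)
  · rintro s t hst ⟨φ, hφ, hd⟩
    exact ⟨φ, hφ, hd.mono hst⟩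
  -- The product of the two cutoffs is a multiple of each of them, hence decays over both sets, and
  -- it still does not vanish at `y`.
  · rintro s t ⟨φ, hφ, hd⟩ ⟨χ, hχ, he⟩
    refine ⟨smoothMul φ.contDiff χ, mul_ne_zero hφ hχ, DecaysOver.union ?_ (he.smoothMul _)⟩
    have : smoothMul φ.contDiff χ = smoothMul χ.contDiff φ :=
      TestFunction.ext fun x => mul_comm _ _
    rw [this]
    exact hd.smoothMul _
  · intro η hη
    obtain ⟨φ, hφ, s, hs, hd⟩ := exists_decaysOver_of_notMem hv hr hy (h η hη).1 (h η hη).2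
    exact ⟨s, mem_nhdsWithin_of_mem_nhds hs, φ, hφ, hd⟩

/-- If the Sobolev wave front set of order `r` does not meet `supp φ × t`, `t` compact, then
`⟨·⟩ ^ r ℱ (φ v)` is bounded on the cone over `t`. -/
theorem exists_bound_of_disjoint_euclSobolevWF {v : 𝓓(Ω, ℂ) →ₗ[ℂ] ℂ} (hv : Continuous v) {r : ℝ}
    (hr : 0 ≤ r) (φ : 𝓓(Ω, ℂ)) {t : Set ℰ} (ht : IsCompact t)
    (h : ∀ y ∈ tsupport φ, ∀ η ∈ t, η ≠ 0 ∧ (y, η) ∉ euclSobolevWF r v) :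
    ∃ C : ℝ, ∀ ξ ∈ coneOver t, (1 + ‖ξ‖ ^ 2) ^ (r / 2) * ‖fourierLoc v φ ξ‖ ≤ C := by
  -- Nonnegative real parts prevent cancellation when local cutoffs are added. Replacing a cutoff
  -- `χ` by `|χ|²`, which is a multiple of it, achieves this.
  have h1 : ∃ Φ : 𝓓(Ω, ℂ), (∀ x, 0 ≤ (Φ x).re) ∧ (∀ x ∈ tsupport φ, 0 < (Φ x).re) ∧
      DecaysOver r v Φ t := by
    refine IsCompact.induction_on φ.hasCompactSupport (p := fun s => ∃ Φ : 𝓓(Ω, ℂ),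
      (∀ x, 0 ≤ (Φ x).re) ∧ (∀ x ∈ s, 0 < (Φ x).re) ∧ DecaysOver r v Φ t) ?_ ?_ ?_ ?_
    · refine ⟨0, fun x => le_rfl, fun x hx => absurd hx (notMem_empty _), fun ψ hψ =>
        ⟨0, fun ξ _ => ?_⟩⟩
      have h0 : modulate ξ (smoothMul hψ (0 : 𝓓(Ω, ℂ))) = 0 :=
        TestFunction.ext fun x => by simp
      simp [fourierLoc, h0]
    · rintro s s' hs ⟨Φ, h1, h2, h3⟩
      exact ⟨Φ, h1, fun x hx => h2 x (hs hx), h3⟩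
    · rintro s s' ⟨Φ, h1, h2, h3⟩ ⟨Φ', h1', h2', h3'⟩
      refine ⟨Φ + Φ', fun x => add_nonneg (h1 x) (h1' x), ?_, h3.add h3'⟩
      rintro x (hx | hx)
      · exact add_pos_of_pos_of_nonneg (h2 x hx) (h1' x)
      · exact add_pos_of_nonneg_of_pos (h1 x) (h2' x hx)
    · intro y hy
      obtain ⟨χ, hχ, hd⟩ := exists_decaysOver_of_isCompact hv hr (φ.tsupport_subset hy) ht (h y hy)
      have hconj : ContDiff ℝ ∞ fun x => (starRingEnd ℂ) (χ x) :=
        Complex.conjCLE.contDiff.comp χ.contDiff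
      have hre : ∀ x, (smoothMul hconj χ x).re = Complex.normSq (χ x) := fun x => by
        rw [smoothMul_apply, mul_comm, Complex.mul_conj, Complex.ofReal_re]
      refine ⟨{x | χ x ≠ 0}, mem_nhdsWithin_of_mem_nhds
        ((isOpen_ne_fun χ.continuous continuous_const).mem_nhds hχ), smoothMul hconj χ,
        fun x => ?_, fun x hx => ?_, hd.smoothMul hconj⟩
      · rw [hre]; exact Complex.normSq_nonneg _
      · rw [hre]; exact Complex.normSq_pos.2 hx
  obtain ⟨Φ, -, hΦ, hd⟩ := h1
  have hΦ0 : ∀ x ∈ tsupport φ, Φ x ≠ 0 := fun x hx h0 => by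
    have := hΦ x hx
    rw [h0] at this
    exact lt_irrefl _ this
  -- Since `Φ` has no zeros on `supp φ`, the quotient is smooth and exhibits `φ` as a multiple of
  -- `Φ`.
  have hψ : ContDiff ℝ ∞ fun x => φ x / Φ x := by
    rw [contDiff_iff_contDiffAt]
    intro x
    by_cases hx : x ∈ tsupport φ
    · simp_rw [div_eq_mul_inv]
      exact φ.contDiff.contDiffAt.mul (Φ.contDiff.contDiffAt.inv (hΦ0 x hx))
    · refine (contDiffAt_const (c := (0 : ℂ))).congr_of_eventuallyEq ?_
      filter_upwards [(isClosed_tsupport φ).isOpen_compl.mem_nhds hx] with z hz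
      rw [image_eq_zero_of_notMem_tsupport hz, zero_div]
  have hφ : smoothMul hψ Φ = φ := TestFunction.ext fun x => by
    rw [smoothMul_apply]
    by_cases hx : x ∈ tsupport φ
    · exact div_mul_cancel₀ _ (hΦ0 x hx)
    · rw [image_eq_zero_of_notMem_tsupport hx, zero_div, zero_mul]
  have := hd _ hψ
  rwa [hφ] at this

end Microlocalization

/-! ## Coordinates on the cotangent bundle -/

section Cotangent

variable {m k : ℕ} {M : Type*} [TopologicalSpace M] [ChartedSpace (EuclideanSpace ℝ (Fin m)) M]
  [IsManifold (𝓡 m) ∞ M] {E : M → Type*}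
  [∀ p, AddCommGroup (E p)] [∀ p, Module ℂ (E p)] [∀ p, TopologicalSpace (E p)]
  [TopologicalSpace (TotalSpace (Fin k → ℂ) E)] [FiberBundle (Fin k → ℂ) E]
  [VectorBundle ℂ (Fin k → ℂ) E]

lemma TrivChart.dChart_coordVec_self (c : TrivChart m k E) {y : EuclideanSpace ℝ (Fin m)}
    (hy : y ∈ c.chart.target) (i : Fin m) :
    dChart m c.chart (c.chart.symm y) (coordVec m c.chart y i) = EuclideanSpace.single i 1 := by
  rw [c.dChart_coordVec c hy (c.chart.map_target hy)]
  have : (fun s => c.chart (c.chart.symm s)) =ᶠ[𝓝 y] id := by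
    filter_upwards [c.chart.open_target.mem_nhds hy] with s hs using c.chart.right_inv hs
  rw [this.fderiv_eq, fderiv_id]
  rfl

/-- The covector `η_i dx^i` at the point with coordinates `y`. -/
def TrivChart.covector (c : TrivChart m k E) (y η : EuclideanSpace ℝ (Fin m)) :
    TangentSpace (𝓡 m) (c.chart.symm y) →L[ℝ] ℝ :=
  (innerSL ℝ η).comp (dChart m c.chart (c.chart.symm y))

lemma TrivChart.covectorCoord_covector (c : TrivChart m k E) {y : EuclideanSpace ℝ (Fin m)}
    (hy : y ∈ c.chart.target) (η : EuclideanSpace ℝ (Fin m)) :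
    covectorCoord c.chart (c.chart.symm y) (c.covector y η) = η := by
  ext i
  have h : covectorCoord c.chart (c.chart.symm y) (c.covector y η) i =
      inner ℝ η (dChart m c.chart (c.chart.symm y) (coordVec m c.chart y i)) := by
    conv_rhs => rw [← c.chart.right_inv hy]
    rw [c.chart.right_inv hy]
    change inner ℝ η (dChart m c.chart (c.chart.symm y) (coordVec m c.chart
      (c.chart (c.chart.symm y)) i)) = _
    rw [c.chart.right_inv hy]
  rw [h, c.dChart_coordVec_self hy, EuclideanSpace.inner_single_right]
  simp

lemma TrivChart.covector_covectorCoord (c : TrivChart m k E) {y : EuclideanSpace ℝ (Fin m)}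
    (hy : y ∈ c.chart.target) (ξ : TangentSpace (𝓡 m) (c.chart.symm y) →L[ℝ] ℝ) :
    c.covector y (covectorCoord c.chart (c.chart.symm y) ξ) = ξ := by
  let A : EuclideanSpace ℝ (Fin m) →ₗ[ℝ] EuclideanSpace ℝ (Fin m) :=
    (dChart m c.chart (c.chart.symm y)).toLinearMap
  let B : EuclideanSpace ℝ (Fin m) →ₗ[ℝ] EuclideanSpace ℝ (Fin m) :=
    (mfderiv (𝓡 m) (𝓡 m) c.chart.symm y).toLinearMap
  have hAB : A ∘ₗ B = LinearMap.id := by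
    refine (EuclideanSpace.basisFun (Fin m) ℝ).toBasis.ext fun i => ?_
    simp only [OrthonormalBasis.coe_toBasis, EuclideanSpace.basisFun_apply]
    exact c.dChart_coordVec_self hy i
  -- In finite dimension a one-sided inverse is two-sided, so only the derivative of `x ∘ x⁻¹` had
  -- to be computed.
  have hBA : B ∘ₗ A = LinearMap.id := (LinearMap.comp_eq_id_comm ℝ _).1 hAB
  let ξ' : EuclideanSpace ℝ (Fin m) →L[ℝ] ℝ := ξ
  have hξ : ∀ i, covectorCoord c.chart (c.chart.symm y) ξ i =
      ξ' (B (EuclideanSpace.single i 1)) := fun i => by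
    change ξ' (coordVec m c.chart (c.chart (c.chart.symm y)) i) = _
    rw [c.chart.right_inv hy]
    rfl
  have hlin : ∀ v : EuclideanSpace ℝ (Fin m),
      inner ℝ (covectorCoord c.chart (c.chart.symm y) ξ) v = ξ' (B v) := by
    intro v
    have : (innerSL ℝ (covectorCoord c.chart (c.chart.symm y) ξ)).toLinearMap =
        ξ'.toLinearMap ∘ₗ B := by
      refine (EuclideanSpace.basisFun (Fin m) ℝ).toBasis.ext fun i => ?_
      simp only [OrthonormalBasis.coe_toBasis, EuclideanSpace.basisFun_apply]
      change inner ℝ (covectorCoord c.chart (c.chart.symm y) ξ) (EuclideanSpace.single i 1) =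
        ξ' (B (EuclideanSpace.single i 1))
      rw [← hξ, EuclideanSpace.inner_single_right]
      simp
    exact LinearMap.congr_fun this v
  refine ContinuousLinearMap.ext fun w => ?_
  change inner ℝ _ (A w) = ξ' w
  rw [hlin]
  exact congrArg ξ' (LinearMap.congr_fun hBA w)

/-- The coordinates `(x(p), (ξ_1, …, ξ_m))` of a covector. -/
def TrivChart.cotangentCoord (c : TrivChart m k E) (z : CotangentMinusZero m M) :
    EuclideanSpace ℝ (Fin m) × EuclideanSpace ℝ (Fin m) :=
  (c.chart z.1.1, covectorCoord c.chart z.1.1 z.1.2)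

/-- The point of `T*M` with given coordinates. -/
def TrivChart.cotangentMk (c : TrivChart m k E)
    (q : EuclideanSpace ℝ (Fin m) × EuclideanSpace ℝ (Fin m)) :
    TotalSpace (EuclideanSpace ℝ (Fin m) →L[ℝ] ℝ)
      (fun p : M => TangentSpace (𝓡 m) p →L[ℝ] Bundle.Trivial M ℝ p) :=
  ⟨c.chart.symm q.1, c.covector q.1 q.2⟩

lemma TrivChart.cotangentMk_cotangentCoord (c : TrivChart m k E) (z : CotangentMinusZero m M)
    (hz : z.1.1 ∈ c.chart.source) : c.cotangentMk (c.cotangentCoord z) = z.1 := by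
  obtain ⟨⟨p, ξ⟩, hξ⟩ := z
  change p ∈ c.chart.source at hz
  obtain ⟨y, hy, rfl⟩ : ∃ y ∈ c.chart.target, c.chart.symm y = p :=
    ⟨c.chart p, c.chart.map_source hz, c.chart.left_inv hz⟩
  have h : c.cotangentCoord ⟨⟨c.chart.symm y, ξ⟩, hξ⟩ =
      (y, covectorCoord c.chart (c.chart.symm y) ξ) :=
    Prod.ext (c.chart.right_inv hy) rfl
  rw [h]
  exact congrArg (TotalSpace.mk (c.chart.symm y)) (c.covector_covectorCoord hy ξ)

lemma TrivChart.snd_cotangentMk_ne_zero (c : TrivChart m k E)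
    {q : EuclideanSpace ℝ (Fin m) × EuclideanSpace ℝ (Fin m)} (hq : q.1 ∈ c.chart.target)
    (hq' : q.2 ≠ 0) : (c.cotangentMk q).2 ≠ 0 := fun h => hq' <| by
  rw [← c.covectorCoord_covector hq q.2]
  have h' : c.covector q.1 q.2 = 0 := h
  rw [h']
  ext i
  rfl

lemma TrivChart.cotangentCoord_mk (c : TrivChart m k E)
    {q : EuclideanSpace ℝ (Fin m) × EuclideanSpace ℝ (Fin m)} (hq : q.1 ∈ c.chart.target)
    (hq' : (c.cotangentMk q).2 ≠ 0) : c.cotangentCoord ⟨c.cotangentMk q, hq'⟩ = q :=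
  Prod.ext (c.chart.right_inv hq) (c.covectorCoord_covector hq q.2)

lemma TrivChart.cotangentCoord_snd_ne_zero (c : TrivChart m k E) (z : CotangentMinusZero m M)
    (hz : z.1.1 ∈ c.chart.source) : (c.cotangentCoord z).2 ≠ 0 := fun h => z.2 <| by
  rw [← c.cotangentMk_cotangentCoord z hz]
  change (innerSL ℝ (c.cotangentCoord z).2).comp _ = 0
  rw [h, map_zero, ContinuousLinearMap.zero_comp]

/-- In the hom bundle, continuity of the fibre part is that of `⟨η, dx ·⟩` in tangent coordinates,
and `dx` varies continuously because the chart is smooth. -/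
lemma TrivChart.continuousAt_cotangentMk (c : TrivChart m k E)
    {q : EuclideanSpace ℝ (Fin m) × EuclideanSpace ℝ (Fin m)} (hq : q.1 ∈ c.chart.target) :
    ContinuousAt c.cotangentMk q := by
  have hs : ContinuousAt (fun q : EuclideanSpace ℝ (Fin m) × EuclideanSpace ℝ (Fin m) =>
      c.chart.symm q.1) q := (c.chart.symm.continuousAt hq).comp continuousAt_fst
  rw [continuousAt_hom_bundle]
  refine ⟨hs, ?_⟩
  have h1 : ContMDiffAt (𝓡 m) (𝓡 m) ∞ c.chart (c.chart.symm q.1) :=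
    contMDiffAt_of_mem_maximalAtlas c.chart_mem (c.chart.map_target hq)
  have h2 := (h1.mfderiv_const (m := 0) (by simp)).continuousAt
  have h3 := (((innerSL ℝ (E := EuclideanSpace ℝ (Fin m))).continuous.comp
    continuous_snd).continuousAt (x := q)).clm_comp (ContinuousAt.comp (f := fun q :
      EuclideanSpace ℝ (Fin m) × EuclideanSpace ℝ (Fin m) => c.chart.symm q.1) h2 hs)
  refine h3.congr (Eventually.of_forall fun q' => ?_)
  refine ContinuousLinearMap.ext fun v => ?_
  simp only [Function.comp_apply, inTangentCoordinates, ContinuousLinearMap.inCoordinates,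
    TangentBundle.continuousLinearMapAt_model_space, ContinuousLinearMap.comp_apply, id_eq]
  have h4 : (trivializationAt ℝ (Bundle.Trivial M ℝ) (c.cotangentMk q).proj).continuousLinearMapAt ℝ
      (c.cotangentMk q').proj = ContinuousLinearMap.id ℝ ℝ :=
    Bundle.Trivial.continuousLinearMapAt_trivialization ℝ M ℝ _
  rw [h4]
  rfl

/-- The coordinates of the covectors in `L`. -/
def TrivChart.coordSet (c : TrivChart m k E) (L : Set (CotangentMinusZero m M)) :
    Set (EuclideanSpace ℝ (Fin m) × EuclideanSpace ℝ (Fin m)) :=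
  c.cotangentCoord '' {z ∈ L | z.1.1 ∈ c.chart.source}

lemma TrivChart.mem_coordSet_iff (c : TrivChart m k E) (L : Set (CotangentMinusZero m M))
    {q : EuclideanSpace ℝ (Fin m) × EuclideanSpace ℝ (Fin m)} (hq : q.1 ∈ c.chart.target)
    (hq' : q.2 ≠ 0) :
    q ∈ c.coordSet L ↔ (⟨c.cotangentMk q, c.snd_cotangentMk_ne_zero hq hq'⟩ :
      CotangentMinusZero m M) ∈ L := by
  constructor
  · rintro ⟨z, ⟨hzL, hz⟩, rfl⟩
    convert hzL
    exact c.cotangentMk_cotangentCoord z hz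
  · exact fun h => ⟨_, ⟨h, c.chart.map_target hq⟩, c.cotangentCoord_mk hq _⟩

/-- Closedness of `L` enters here: the set is the preimage of the complement of `L` under the
parametrisation `cotangentMk`, so continuity of that map alone suffices. -/
lemma TrivChart.isOpen_diff_coordSet (c : TrivChart m k E) {L : Set (CotangentMinusZero m M)}
    (hL : IsClosed L) : IsOpen ((c.chart.target ×ˢ {0}ᶜ) \ c.coordSet L) := by
  have hU : IsOpen (c.chart.target ×ˢ ({0}ᶜ : Set (EuclideanSpace ℝ (Fin m)))) :=
    c.chart.open_target.prod isOpen_compl_singleton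
  let Ψ : (c.chart.target ×ˢ ({0}ᶜ : Set (EuclideanSpace ℝ (Fin m))) : Set _) →
      CotangentMinusZero m M := fun q => ⟨c.cotangentMk q.1, c.snd_cotangentMk_ne_zero q.2.1 q.2.2⟩
  have hΨ : Continuous Ψ := by
    refine Continuous.subtype_mk (continuous_iff_continuousAt.2 fun q => ?_) _
    exact (c.continuousAt_cotangentMk q.2.1).comp continuousAt_subtype_val
  have h := hU.isOpenMap_subtype_val _ (hL.isOpen_compl.preimage hΨ)
  convert h using 1
  ext q
  simp only [Set.mem_sdiff, mem_image, mem_preimage, mem_compl_iff, Subtype.exists, exists_and_right,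
    exists_eq_right]
  constructor
  · exact fun ⟨h1, h2⟩ => ⟨h1, fun h3 => h2 ((c.mem_coordSet_iff L h1.1 h1.2).2 h3)⟩
  · exact fun ⟨h1, h2⟩ => ⟨h1, fun h3 => h2 ((c.mem_coordSet_iff L h1.1 h1.2).1 h3)⟩

lemma TrivChart.smul_mem_coordSet (c : TrivChart m k E) {L : Set (CotangentMinusZero m M)}
    (hL : IsConic L) {y η : EuclideanSpace ℝ (Fin m)} (h : (y, η) ∈ c.coordSet L) {s : ℝ}
    (hs : 0 < s) : (y, s • η) ∈ c.coordSet L := by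
  have h0 : y ∈ c.chart.target ∧ η ≠ 0 := by
    obtain ⟨z, ⟨-, hz⟩, h⟩ := h
    have h1 := c.chart.map_source hz
    have h2 := c.cotangentCoord_snd_ne_zero z hz
    rw [h] at h2
    have h3 : c.chart z.1.1 = y := congrArg Prod.fst h
    exact ⟨h3 ▸ h1, h2⟩
  rw [c.mem_coordSet_iff L h0.1 h0.2] at h
  rw [c.mem_coordSet_iff L h0.1 (smul_ne_zero hs.ne' h0.2)]
  refine hL _ h s hs _ ?_
  refine congrArg (TotalSpace.mk (c.chart.symm y)) ?_
  change (innerSL ℝ (s • η)).comp _ = s • (innerSL ℝ η).comp _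
  rw [map_smul, ContinuousLinearMap.smul_comp]

lemma TrivChart.avoids_iff (c : TrivChart m k E) {L : Set (CotangentMinusZero m M)}
    {ϕ : 𝓓(c.dom, ℂ)} {V : Set (EuclideanSpace ℝ (Fin m))} :
    c.Avoids L ϕ V ↔ ∀ y ∈ tsupport ϕ, ∀ η ∈ V, (y, η) ∉ c.coordSet L := by
  constructor
  · rintro h y hy η hη ⟨z, ⟨hzL, hz⟩, hq⟩
    obtain ⟨rfl, rfl⟩ := Prod.ext_iff.1 hq
    exact h z hzL hz hy hη
  · exact fun h z hzL hz hy hη => h _ hy _ hη ⟨z, ⟨hzL, hz⟩, rfl⟩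

/-- Cones that avoid `L` over the support of `ϕ` are separated from a larger such cone. -/
lemma TrivChart.Avoids.exists_isClosed_separated {c : TrivChart m k E}
    {L : Set (CotangentMinusZero m M)} (hL : IsClosed L) (hconic : IsConic L) {ϕ : 𝓓(c.dom, ℂ)}
    {V : Set (EuclideanSpace ℝ (Fin m))} (hV : IsClosed V) (hVc : IsCone V)
    (h : c.Avoids L ϕ V) :
    ∃ V' : Set (EuclideanSpace ℝ (Fin m)), IsClosed V' ∧ IsCone V' ∧ c.Avoids L ϕ V' ∧
      ∃ a : ℝ, 0 < a ∧ ∀ ξ ∈ V, ∀ η ∉ V', a * (‖ξ‖ + ‖η‖) ≤ ‖ξ - η‖ := by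
  rw [c.avoids_iff] at h
  -- The unit directions of `L` over `supp ϕ`. They form a compact set, being the projection of a
  -- closed part of `supp ϕ × S^(m-1)`, and by conicity they determine all directions of `L` there.
  set P : Set (EuclideanSpace ℝ (Fin m)) :=
    {η | η ∈ Metric.sphere 0 1 ∧ ∃ y ∈ tsupport ϕ, (y, η) ∈ c.coordSet L} with hP
  have hS : Metric.sphere (0 : EuclideanSpace ℝ (Fin m)) 1 ⊆ {0}ᶜ := fun η hη h0 => by
    rw [mem_singleton_iff.1 h0, mem_sphere_zero_iff_norm, norm_zero] at hη
    exact zero_ne_one hη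
  have hPc : IsCompact P := by
    have h1 : IsCompact ((tsupport ϕ ×ˢ Metric.sphere 0 1) \
        ((c.chart.target ×ˢ {0}ᶜ) \ c.coordSet L)) :=
      (ϕ.hasCompactSupport.isCompact.prod (isCompact_sphere 0 1)).diff (c.isOpen_diff_coordSet hL)
    convert h1.image continuous_snd using 1
    ext η
    constructor
    · rintro ⟨h2, y, hy, h3⟩
      exact ⟨(y, η), ⟨⟨hy, h2⟩, fun h4 => h4.2 h3⟩, rfl⟩
    · rintro ⟨⟨y, η⟩, ⟨⟨h1, h2⟩, h3⟩, rfl⟩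
      refine ⟨h2, y, h1, ?_⟩
      by_contra h4
      exact h3 ⟨⟨ϕ.tsupport_subset h1, hS h2⟩, h4⟩
  have hPV : Disjoint P V := disjoint_left.2 fun η ⟨_, y, hy, h1⟩ h2 => h y hy η h2 h1
  obtain ⟨δ, hδ, hd⟩ := hPV.exists_thickenings hPc hV
  -- The complement of this open conic neighbourhood of `P` is the larger cone.
  set O := coneOver (Metric.thickening δ P) with hO
  have hOc : IsCone O := isCone_coneOver _
  refine ⟨Oᶜ, (isOpen_coneOver Metric.isOpen_thickening).isClosed_compl, fun ξ hξ t ht hO => hξ ?_,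
    ?_, (2 / (δ / (1 + δ)) + 1)⁻¹, by positivity, fun ξ hξ η hη => ?_⟩
  · have := hOc _ hO t⁻¹ (inv_pos.2 ht)
    rwa [inv_smul_smul₀ ht.ne'] at this
  · rw [c.avoids_iff]
    intro y hy η hη hyη
    have hη0 : η ≠ 0 := by
      obtain ⟨z, ⟨-, hz⟩, h1⟩ := hyη
      have h2 := c.cotangentCoord_snd_ne_zero z hz
      rwa [h1] at h2
    have hn := norm_pos_iff.2 hη0
    refine hη ⟨‖η‖, hn, ‖η‖⁻¹ • η, Metric.self_subset_thickening hδ _ ⟨?_, y, hy,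
      c.smul_mem_coordSet hconic hyη (inv_pos.2 hn)⟩, (smul_inv_smul₀ hn.ne' η).symm⟩
    rw [mem_sphere_zero_iff_norm, norm_smul, norm_inv, norm_norm, inv_mul_cancel₀ hn.ne']
  -- A point off the larger cone is `s • x` with `x` within `δ` of `P`. Thus `‖x‖ ≤ 1 + δ`, whereas
  -- `x` is at distance at least `δ` from the cone `V`; hence the ratio `δ / (1 + δ)`. In
  -- `separated_of_le` the two points exchange roles.
  · obtain ⟨s, hs, x, hx, rfl⟩ := not_not.1 hη
    obtain ⟨p, hp, hxp⟩ := Metric.mem_thickening_iff.1 hx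
    have hxn : ‖x‖ ≤ 1 + δ := by
      have h1 : ‖p‖ = 1 := mem_sphere_zero_iff_norm.1 hp.1
      have h2 : ‖x‖ ≤ ‖p‖ + ‖x - p‖ := by simpa using norm_add_le p (x - p)
      rw [dist_eq_norm] at hxp
      linarith
    have hxV : δ ≤ dist x (s⁻¹ • ξ) := by
      by_contra! h1
      exact disjoint_left.1 hd hx
        (Metric.mem_thickening_iff.2 ⟨_, hVc ξ hξ _ (inv_pos.2 hs), h1⟩)
    have hmul : s • x - ξ = s • (x - s⁻¹ • ξ) := by rw [smul_sub, smul_inv_smul₀ hs.ne']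
    have h2 := separated_of_le (ξ := s • x) (η := ξ) (c := δ / (1 + δ)) (by positivity) (by
      rw [hmul, norm_smul, norm_smul, ← dist_eq_norm, Real.norm_of_nonneg hs.le]
      calc δ / (1 + δ) * (s * ‖x‖) ≤ δ / (1 + δ) * (s * (1 + δ)) := by gcongr
        _ = s * δ := by field_simp
        _ ≤ _ := by gcongr)
    rwa [norm_sub_rev ξ, add_comm ‖ξ‖]

end Cotangent

/-! ## Comparison of the norms on cones -/

section ConeNorm

variable {m : ℕ} {Ω : TopologicalSpace.Opens (EuclideanSpace ℝ (Fin m))}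

lemma coneNorm_top_le {r C : ℝ} {v : 𝓓(Ω, ℂ) →ₗ[ℂ] ℂ} {φ : 𝓓(Ω, ℂ)}
    {V : Set (EuclideanSpace ℝ (Fin m))} (hV : MeasurableSet V)
    (h : ∀ ξ ∈ V, (1 + ‖ξ‖ ^ 2) ^ (r / 2) * ‖fourierLoc v φ ξ‖ ≤ C) :
    coneNorm ⊤ r v φ V ≤ ENNReal.ofReal C := by
  rw [coneNorm, eLpNorm_exponent_top]
  refine eLpNormEssSup_le_of_ae_bound (ae_restrict_of_forall_mem hV fun ξ hξ => ?_)
  rw [norm_mul, Complex.norm_real, Real.norm_of_nonneg (by positivity)]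
  exact h ξ hξ

/-- Weighted `L²`-norms on cones are bounded by weighted `L^∞`-norms. -/
lemma exists_coneNorm_two_le {r s : ℝ} (hrs : r + (m + 1) ≤ s) :
    ∃ C : ℝ≥0∞, C ≠ ⊤ ∧ C ≠ 0 ∧ ∀ (v : 𝓓(Ω, ℂ) →ₗ[ℂ] ℂ) (φ : 𝓓(Ω, ℂ))
      (V : Set (EuclideanSpace ℝ (Fin m))), coneNorm 2 r v φ V ≤ C * coneNorm ⊤ s v φ V := by
  set g : EuclideanSpace ℝ (Fin m) → ℝ := fun ξ => (1 + ‖ξ‖ ^ 2) ^ (-((m : ℝ) + 1) / 2) with hg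
  have hgc : Continuous g := Continuous.rpow_const (by fun_prop) fun ξ => .inl (by positivity)
  have hg2 : MemLp g 2 volume := by
    rw [memLp_two_iff_integrable_sq hgc.aestronglyMeasurable]
    have := integrable_rpow_neg_one_add_norm_sq (E := EuclideanSpace ℝ (Fin m)) (μ := volume)
      (r := 2 * ((m : ℝ) + 1)) (by rw [finrank_euclideanSpace_fin]; linarith)
    refine this.congr (Eventually.of_forall fun ξ => ?_)
    simp only [hg]
    rw [← Real.rpow_mul_natCast (by positivity)]
    congr 1
    push_cast
    ring
  -- The summand `1` keeps the constant away from `0`, so that radii can be divided by it.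
  refine ⟨eLpNorm g 2 volume + 1, by finiteness [hg2.2.ne], by simp, fun v φ V => ?_⟩
  have hae : ∀ᵐ ξ ∂(volume.restrict V),
      ‖(((1 + ‖ξ‖ ^ 2) ^ (r / 2) : ℝ) : ℂ) * fourierLoc v φ ξ‖ₑ ≤ coneNorm ⊤ s v φ V * ‖g ξ‖ₑ := by
    filter_upwards [enorm_ae_le_eLpNormEssSup (fun ξ =>
      (((1 + ‖ξ‖ ^ 2) ^ (s / 2) : ℝ) : ℂ) * fourierLoc v φ ξ) (volume.restrict V)] with ξ hξ
    rw [coneNorm, eLpNorm_exponent_top]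
    refine le_trans ?_ (mul_le_mul_left hξ _)
    rw [← ofReal_norm, ← ofReal_norm, ← ofReal_norm, ← ENNReal.ofReal_mul (norm_nonneg _)]
    refine ENNReal.ofReal_le_ofReal ?_
    have hb : (1 : ℝ) ≤ 1 + ‖ξ‖ ^ 2 := le_add_of_nonneg_right (sq_nonneg _)
    have hb0 : (0 : ℝ) < 1 + ‖ξ‖ ^ 2 := zero_lt_one.trans_le hb
    rw [norm_mul, norm_mul, Complex.norm_real, Complex.norm_real,
      Real.norm_of_nonneg (by positivity), Real.norm_of_nonneg (by positivity),
      Real.norm_of_nonneg (by positivity), mul_right_comm, ← Real.rpow_add hb0]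
    exact mul_le_mul_of_nonneg_right (Real.rpow_le_rpow_of_exponent_le hb (by linarith))
      (norm_nonneg _)
  calc coneNorm 2 r v φ V ≤ coneNorm ⊤ s v φ V * eLpNorm g 2 (volume.restrict V) :=
        eLpNorm_le_mul_eLpNorm_of_ae_le_mul'' 2 hgc.aestronglyMeasurable hae
    _ ≤ coneNorm ⊤ s v φ V * (eLpNorm g 2 volume + 1) := by
        gcongr
        exact (eLpNorm_mono_measure _ Measure.restrict_le_self).trans le_self_add
    _ = _ := mul_comm _ _

lemma euclSobolevWF_subset_euclWF (r : ℝ) (v : 𝓓(Ω, ℂ) →ₗ[ℂ] ℂ) :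
    euclSobolevWF r v ⊆ euclWF v := by
  rintro z ⟨h1, h2, h3⟩
  refine ⟨h1, h2, fun ⟨V, hV, hc, hz, φ, hφ, hb⟩ => h3 ⟨V, hV, hc, hz, φ, hφ, ?_⟩⟩
  -- The maximum with `1` keeps the order positive, since only `ν > 0` occurs in the definition of
  -- `euclWF`.
  obtain ⟨C, hC, -, h⟩ := exists_coneNorm_two_le (Ω := Ω)
    (le_max_left (r + ((m : ℝ) + 1)) 1)
  exact (h v φ V).trans_lt (ENNReal.mul_lt_top hC.lt_top (hb _ (by positivity)))

lemma fourierLoc_add_left (v w : 𝓓(Ω, ℂ) →ₗ[ℂ] ℂ) (φ : 𝓓(Ω, ℂ)) (ξ : EuclideanSpace ℝ (Fin m)) :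
    fourierLoc (v + w) φ ξ = fourierLoc v φ ξ + fourierLoc w φ ξ := rfl

/-- Minkowski's inequality requires measurable integrands, which is why `v` and `w` have to be
distributions and not just linear functionals. -/
lemma coneNorm_add_le {q : ℝ≥0∞} (hq : 1 ≤ q) (r : ℝ) {v w : 𝓓(Ω, ℂ) →ₗ[ℂ] ℂ} (hv : Continuous v)
    (hw : Continuous w) (φ : 𝓓(Ω, ℂ)) (V : Set (EuclideanSpace ℝ (Fin m))) :
    coneNorm q r (v + w) φ V ≤ coneNorm q r v φ V + coneNorm q r w φ V := by
  have hcont : Continuous fun ξ : EuclideanSpace ℝ (Fin m) =>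
      (((1 + ‖ξ‖ ^ 2) ^ (r / 2) : ℝ) : ℂ) :=
    Complex.continuous_ofReal.comp
      (Continuous.rpow_const (by fun_prop) fun ξ => .inl (by positivity))
  refine le_trans (le_of_eq ?_) (eLpNorm_add_le
    (hcont.mul (continuous_fourierLoc hv φ)).aestronglyMeasurable
    (hcont.mul (continuous_fourierLoc hw φ)).aestronglyMeasurable hq)
  unfold coneNorm
  congr 1
  funext ξ
  simp only [Pi.add_apply, fourierLoc_add_left, mul_add]

/-- A direction over `y` in a relatively open set free of Sobolev singularities of all orders is
not a smooth singularity. -/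
lemma notMem_euclWF {v : 𝓓(Ω, ℂ) →ₗ[ℂ] ℂ} (hv : Continuous v)
    {G : Set (EuclideanSpace ℝ (Fin m) × EuclideanSpace ℝ (Fin m))} (hG : IsOpen G)
    (hG0 : ∀ q ∈ G, q.1 ∈ Ω ∧ q.2 ≠ 0 ∧ ∀ r, q ∉ euclSobolevWF r v)
    {q : EuclideanSpace ℝ (Fin m) × EuclideanSpace ℝ (Fin m)} (hq : q ∈ G) : q ∉ euclWF v := by
  rintro ⟨-, -, h⟩
  refine h ?_
  obtain ⟨y, ξ⟩ := q
  -- The cutoff and the cone are taken from a product of balls inside `G`, before `ν` is given: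
  -- `euclWF` demands one choice for all orders.
  obtain ⟨ρ, hρ, hball⟩ := Metric.isOpen_iff.1 hG _ hq
  rw [← ball_prod_same] at hball
  obtain ⟨f, hfs, hfc, hf, -, hf1⟩ := exists_contDiff_tsupport_subset (n := ⊤)
    (Metric.ball_mem_nhds y hρ)
  have hsupp : tsupport (fun x => (f x : ℂ)) ⊆ tsupport f :=
    closure_mono fun x hx h0 => hx (by simp only [h0, Complex.ofReal_zero])
  have hsub : Metric.closedBall ξ (ρ / 2) ⊆ Metric.ball ξ ρ :=
    Metric.closedBall_subset_ball (half_lt_self hρ)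
  let φ : 𝓓(Ω, ℂ) := ⟨fun x => (f x : ℂ), Complex.ofRealCLM.contDiff.comp hf,
    hfc.comp_left Complex.ofReal_zero, fun x hx =>
      (hG0 (x, ξ) (hball ⟨hfs (hsupp hx), Metric.mem_ball_self hρ⟩)).1⟩
  have hV := isOpen_coneOver (Metric.isOpen_ball (x := ξ) (ε := ρ / 2))
  refine ⟨_, hV, isCone_coneOver _, subset_coneOver _ (Metric.mem_ball_self (half_pos hρ)), φ, ?_,
    fun ν hν => ?_⟩
  · change (f y : ℂ) ≠ 0
    rw [hf1, Complex.ofReal_one]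
    exact one_ne_zero
  · obtain ⟨C, hC⟩ := exists_bound_of_disjoint_euclSobolevWF hv hν.le φ
      (isCompact_closedBall ξ (ρ / 2)) fun x hx η hη =>
        (hG0 (x, η) (hball ⟨hfs (hsupp hx), hsub hη⟩)).2.imp_right fun h => h ν
    exact (coneNorm_top_le hV.measurableSet fun η hη => hC η
      (coneOver_mono Metric.ball_subset_closedBall hη)).trans_lt ENNReal.ofReal_lt_top

end ConeNorm

/-! ## The spaces of distributions on the manifold -/

section Spaces

variable {m k : ℕ} {M : Type*} [TopologicalSpace M] [ChartedSpace (EuclideanSpace ℝ (Fin m)) M]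
  [T2Space M] [IsManifold (𝓡 m) ∞ M] {E : M → Type*}
  [∀ p, AddCommGroup (E p)] [∀ p, Module ℂ (E p)] [∀ p, TopologicalSpace (E p)]
  [TopologicalSpace (TotalSpace (Fin k → ℂ) E)] [FiberBundle (Fin k → ℂ) E]
  [VectorBundle ℂ (Fin k → ℂ) E]

/-- For a covector outside `L`, the chart and component witnessing a smooth singularity are kept:
near its coordinates the complement of `L` is free of Sobolev singularities of this component, for
every order. No change of charts is involved. -/
theorem hormanderSet_eq_iInter {L : Set (CotangentMinusZero m M)} (hL : IsClosed L) :
    (hormanderSet E L : Set (DistSection m k E)) = ⋂ r : ℝ, sobolevSet E r L := by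
  ext u
  simp only [mem_iInter]
  constructor
  · rintro h r z ⟨c, hc, j, hj⟩
    exact h ⟨c, hc, j, euclSobolevWF_subset_euclWF r _ hj⟩
  · rintro h z ⟨c, hc, j, hj⟩
    by_contra hz
    have hz0 := c.cotangentCoord_snd_ne_zero z hc
    refine notMem_euclWF (c.continuous_localRep j u) (c.isOpen_diff_coordSet hL)
      (fun q hq => ⟨hq.1.1, hq.1.2, fun r hr => hq.2 ?_⟩)
      ⟨⟨c.chart.map_source hc, hz0⟩, fun hq => hz ?_⟩ hj
    · have h1 : c.cotangentCoord ⟨c.cotangentMk q, c.snd_cotangentMk_ne_zero hq.1.1 hq.1.2⟩ = q :=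
        c.cotangentCoord_mk hq.1.1 _
      refine (c.mem_coordSet_iff L hq.1.1 hq.1.2).2 (h r ⟨c, c.chart.map_target hq.1.1, j, ?_⟩)
      change c.cotangentCoord _ ∈ _
      rwa [h1]
    · change c.cotangentCoord z ∈ _ at hq
      rw [c.mem_coordSet_iff L (c.chart.map_source hc) hz0] at hq
      convert hq
      exact (c.cotangentMk_cotangentCoord z hc).symm

lemma TrivChart.coneSeminorm_add_le (c : TrivChart m k E) {q : ℝ≥0∞} (hq : 1 ≤ q) (r : ℝ)
    (ϕ : 𝓓(c.dom, ℂ)) (V : Set (EuclideanSpace ℝ (Fin m))) (u w : DistSection m k E) :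
    c.coneSeminorm q r ϕ V (u + w) ≤ c.coneSeminorm q r ϕ V u + c.coneSeminorm q r ϕ V w :=
  iSup_le fun j => (coneNorm_add_le hq r (c.continuous_localRep j u) (c.continuous_localRep j w)
    ϕ V).trans (add_le_add (le_iSup (fun j => coneNorm q r (c.localRep j u) ϕ V) j)
      (le_iSup (fun j => coneNorm q r (c.localRep j w) ϕ V) j))

lemma TrivChart.exists_coneSeminorm_two_le (c : TrivChart m k E) {r s : ℝ}
    (hrs : r + (m + 1) ≤ s) :
    ∃ C : ℝ≥0∞, C ≠ ⊤ ∧ C ≠ 0 ∧ ∀ (ϕ : 𝓓(c.dom, ℂ)) (V : Set (EuclideanSpace ℝ (Fin m)))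
      (u : DistSection m k E), c.coneSeminorm 2 r ϕ V u ≤ C * c.coneSeminorm ⊤ s ϕ V u := by
  obtain ⟨C, hC, hC0, h⟩ := exists_coneNorm_two_le (Ω := c.dom) hrs
  refine ⟨C, hC, hC0, fun ϕ V u => iSup_le fun j => (h _ ϕ V).trans ?_⟩
  gcongr
  exact le_iSup (fun j => coneNorm ⊤ s (c.localRep j u) ϕ V) j

/-- The test sections coming from `B` form a bounded set, and smallness on a bounded set defines a
neighbourhood of `0` in the strong dual. -/
lemma TrivChart.eventually_norm_localRep_le (c : TrivChart m k E) {B : Set 𝓓(c.dom, ℂ)}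
    (hB : Bornology.IsVonNBounded ℝ B) {D : ℝ} (hD : 0 < D) :
    ∀ᶠ w : DistSection m k E in 𝓝 0, ∀ j, ∀ f ∈ B, ‖c.localRep j w f‖ ≤ D := by
  refine eventually_all.2 fun j => ?_
  filter_upwards [ContinuousLinearMap.eventually_nhds_zero_mapsTo
    (c.isVonNBounded_image_localSection j hB) (Metric.closedBall_mem_nhds (0 : ℂ) hD)] with w hw f hf
  exact mem_closedBall_zero_iff.1 (hw (mem_image_of_mem _ hf))

/-- On distributions, small `L²`-type seminorms and smallness in `𝒟'(M; E)` imply small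
`L^∞`-type seminorms. -/
lemma TrivChart.exists_coneSeminorm_top_lt {L : Set (CotangentMinusZero m M)} (hL : IsClosed L)
    (hconic : IsConic L) (c : TrivChart m k E) {r : ℝ} (hr : 0 ≤ r) {ϕ : 𝓓(c.dom, ℂ)}
    {V : Set (EuclideanSpace ℝ (Fin m))} (hV : IsClosed V) (hVc : IsCone V) (h : c.Avoids L ϕ V) :
    ∃ V' : Set (EuclideanSpace ℝ (Fin m)), IsClosed V' ∧ IsCone V' ∧ c.Avoids L ϕ V' ∧
      ∀ ε : ℝ≥0∞, 0 < ε → ∃ δ : ℝ≥0∞, 0 < δ ∧ ∀ᶠ w : DistSection m k E in 𝓝 0,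
        c.coneSeminorm 2 r ϕ V' w < δ → c.coneSeminorm ⊤ r ϕ V w < ε := by
  obtain ⟨V', hV', hVc', h', a, ha, hsep⟩ := h.exists_isClosed_separated hL hconic hV hVc
  -- With `ψ = 1` on `supp ϕ` the convolution estimate applies with `ϕ` as both cutoffs.
  obtain ⟨ψ, hψ, hψc, hψ1⟩ := exists_contDiff_hasCompactSupport_eq_one ϕ.hasCompactSupport
  have hmul : ∀ x, ϕ x = ψ x * ϕ x := fun x => by
    by_cases hx : x ∈ tsupport ϕ
    · rw [hψ1 x hx, one_mul]
    · rw [image_eq_zero_of_notMem_tsupport hx, mul_zero]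
  obtain ⟨C, B, hC, hB, hbd⟩ := exists_fourierLoc_bound ϕ ϕ hψ hψc hmul hr hV'.measurableSet ha hsep
  refine ⟨V', hV', hVc', h', fun ε hε => ?_⟩
  obtain ⟨e, he, heε⟩ := ENNReal.lt_iff_exists_nnreal_btwn.1 hε
  have he0 : (0 : ℝ) < e := by exact_mod_cast he
  -- Half of `e / C` for the `L²` norm and half for the values on `B`: then `C (M + D) = e < ε`.
  have hD : 0 < (e : ℝ) / (2 * C) := by positivity
  refine ⟨ENNReal.ofReal (e / (2 * C)), ENNReal.ofReal_pos.2 hD, ?_⟩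
  filter_upwards [c.eventually_norm_localRep_le hB hD] with w hw hlt
  refine lt_of_le_of_lt (iSup_le fun j => ?_) heε
  have h1 := hbd (c.localRep j w) (c.continuous_localRep j w) _ _ hD.le hD.le
    ((le_iSup (fun j => coneNorm 2 r (c.localRep j w) ϕ V') j).trans hlt.le) (hw j)
  refine (coneNorm_top_le hV.measurableSet h1).trans (le_of_eq ?_)
  rw [show C * ((e : ℝ) / (2 * C) + e / (2 * C)) = e by field_simp; ring, ENNReal.ofReal_coe_nnreal]

lemma HormanderSpace.continuous_val (L : Set (CotangentMinusZero m M)) :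
    Continuous fun u : HormanderSpace k E L => u.1 :=
  continuous_iff_le_induced.2 inf_le_left

lemma SobolevSpace.continuous_val (r : ℝ) (L : Set (CotangentMinusZero m M)) :
    Continuous fun u : SobolevSpace k E r L => u.1 :=
  continuous_iff_le_induced.2 inf_le_left

lemma TrivChart.coneSeminorm_zero (c : TrivChart m k E) (q : ℝ≥0∞) (r : ℝ) (ϕ : 𝓓(c.dom, ℂ))
    (V : Set (EuclideanSpace ℝ (Fin m))) : c.coneSeminorm q r ϕ V 0 = 0 := by
  refine le_antisymm (iSup_le fun j => le_of_eq ?_) zero_le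
  have h : (fun ξ : EuclideanSpace ℝ (Fin m) => (((1 + ‖ξ‖ ^ 2) ^ (r / 2) : ℝ) : ℂ) *
      fourierLoc (c.localRep j (0 : DistSection m k E)) ϕ ξ) = 0 :=
    funext fun ξ => mul_zero _
  rw [coneNorm, h, eLpNorm_zero]

lemma HormanderSpace.eventually_coneSeminorm_lt {L : Set (CotangentMinusZero m M)} {ν : ℝ}
    (hν : 0 < ν) {c : TrivChart m k E} {ϕ : 𝓓(c.dom, ℂ)} {V : Set (EuclideanSpace ℝ (Fin m))}
    (hV : IsClosed V) (hVc : IsCone V) (h : c.Avoids L ϕ V) (u₀ : HormanderSpace k E L) {ε : ℝ≥0∞}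
    (hε : 0 < ε) : ∀ᶠ u in 𝓝 u₀, c.coneSeminorm ⊤ ν ϕ V (u.1 - u₀.1) < ε := by
  refine IsOpen.mem_nhds (inf_le_right (α := TopologicalSpace _) _
    (.basic _ ⟨ν, c, ϕ, V, u₀, ε, hν, hV, hVc, h, hε, rfl⟩)) ?_
  change c.coneSeminorm ⊤ ν ϕ V (u₀.1 - u₀.1) < ε
  rwa [sub_self, c.coneSeminorm_zero]

lemma SobolevSpace.eventually_coneSeminorm_lt {L : Set (CotangentMinusZero m M)} {r : ℝ}
    {c : TrivChart m k E} {ϕ : 𝓓(c.dom, ℂ)} {V : Set (EuclideanSpace ℝ (Fin m))}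
    (hV : IsClosed V) (hVc : IsCone V) (h : c.Avoids L ϕ V) (u₀ : SobolevSpace k E r L) {ε : ℝ≥0∞}
    (hε : 0 < ε) : ∀ᶠ u in 𝓝 u₀, c.coneSeminorm 2 r ϕ V (u.1 - u₀.1) < ε := by
  refine IsOpen.mem_nhds (inf_le_right (α := TopologicalSpace _) _
    (.basic _ ⟨c, ϕ, V, u₀, ε, hV, hVc, h, hε, rfl⟩)) ?_
  change c.coneSeminorm 2 r ϕ V (u₀.1 - u₀.1) < ε
  rwa [sub_self, c.coneSeminorm_zero]

/-- A map into `𝒟'^r_L(M; E)` is continuous if it is so into `𝒟'(M; E)` and for the seminorms. -/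
lemma SobolevSpace.continuous_of {X : Type*} [TopologicalSpace X] {L : Set (CotangentMinusZero m M)}
    {r : ℝ} {f : X → SobolevSpace k E r L} (hf : Continuous fun x => (f x).1)
    (h : ∀ (c : TrivChart m k E) (ϕ : 𝓓(c.dom, ℂ)) (V : Set (EuclideanSpace ℝ (Fin m))), IsClosed V →
      IsCone V → c.Avoids L ϕ V → ∀ (x₁ : X) (ε : ℝ≥0∞), 0 < ε →
      ∀ᶠ x in 𝓝 x₁, c.coneSeminorm 2 r ϕ V ((f x).1 - (f x₁).1) < ε) : Continuous f := by
  refine continuous_inf_rng.2 ⟨continuous_induced_rng.2 hf, continuous_generateFrom_iff.2 ?_⟩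
  rintro _ ⟨c, ϕ, V, u₀, ε, hV, hVc, hav, hε, rfl⟩
  refine isOpen_iff_mem_nhds.2 fun x₁ (hx₁ : c.coneSeminorm 2 r ϕ V ((f x₁).1 - u₀.1) < ε) => ?_
  filter_upwards [h c ϕ V hV hVc hav x₁ _ (tsub_pos_of_lt hx₁)] with x hx
  change c.coneSeminorm 2 r ϕ V ((f x).1 - u₀.1) < ε
  rw [← sub_add_sub_cancel (f x).1 (f x₁).1 u₀.1]
  exact (c.coneSeminorm_add_le one_le_two r ϕ V _ _).trans_lt (lt_tsub_iff_right.1 hx)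

/-- A map into `𝒟'_L(M; E)` is continuous if it is so into `𝒟'(M; E)` and for the seminorms. -/
lemma HormanderSpace.continuous_of {X : Type*} [TopologicalSpace X]
    {L : Set (CotangentMinusZero m M)} {f : X → HormanderSpace k E L}
    (hf : Continuous fun x => (f x).1)
    (h : ∀ (ν : ℝ) (c : TrivChart m k E) (ϕ : 𝓓(c.dom, ℂ)) (V : Set (EuclideanSpace ℝ (Fin m))),
      0 < ν → IsClosed V → IsCone V → c.Avoids L ϕ V → ∀ (x₁ : X) (ε : ℝ≥0∞), 0 < ε →
      ∀ᶠ x in 𝓝 x₁, c.coneSeminorm ⊤ ν ϕ V ((f x).1 - (f x₁).1) < ε) : Continuous f := by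
  refine continuous_inf_rng.2 ⟨continuous_induced_rng.2 hf, continuous_generateFrom_iff.2 ?_⟩
  rintro _ ⟨ν, c, ϕ, V, u₀, ε, hν, hV, hVc, hav, hε, rfl⟩
  refine isOpen_iff_mem_nhds.2 fun x₁ (hx₁ : c.coneSeminorm ⊤ ν ϕ V ((f x₁).1 - u₀.1) < ε) => ?_
  filter_upwards [h ν c ϕ V hν hV hVc hav x₁ _ (tsub_pos_of_lt hx₁)] with x hx
  change c.coneSeminorm ⊤ ν ϕ V ((f x).1 - u₀.1) < ε
  rw [← sub_add_sub_cancel (f x).1 (f x₁).1 u₀.1]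
  exact (c.coneSeminorm_add_le le_top ν ϕ V _ _).trans_lt (lt_tsub_iff_right.1 hx)

lemma SobolevSpace.val_incl {r₁ r₂ : ℝ} (h : r₁ ≤ r₂) (L : Set (CotangentMinusZero m M))
    (u : SobolevSpace k E r₂ L) : (SobolevSpace.incl h L u).1 = u.1 := Subtype.coe_mk _ _

lemma SobolevSpace.ext_val {r : ℝ} {L : Set (CotangentMinusZero m M)} {u w : SobolevSpace k E r L}
    (h : u.1 = w.1) : u = w := Subtype.ext h

lemma HormanderSpace.ext_val {L : Set (CotangentMinusZero m M)} {u w : HormanderSpace k E L}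
    (h : u.1 = w.1) : u = w := Subtype.ext h

/-- The members of a compatible family are the same distribution. -/
lemma val_eq_of_compatible {L : Set (CotangentMinusZero m M)} (f : SobolevProjLimit k E L)
    (r s : ℝ) : (f.1 r).1 = (f.1 s).1 := by
  rcases le_total r s with h | h
  · rw [← f.2 r s h, SobolevSpace.val_incl]
  · rw [← f.2 s r h, SobolevSpace.val_incl]

lemma mem_hormanderSet_of_compatible {L : Set (CotangentMinusZero m M)} (hL : IsClosed L)
    (f : SobolevProjLimit k E L) : (f.1 0).1 ∈ hormanderSet E L := by
  rw [hormanderSet_eq_iInter hL, mem_iInter]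
  intro r
  rw [val_eq_of_compatible f 0 r]
  exact (f.1 r).2

lemma HormanderSpace.mem_sobolevSet {L : Set (CotangentMinusZero m M)} (hL : IsClosed L)
    (u : HormanderSpace k E L) (r : ℝ) : u.1 ∈ sobolevSet E r L :=
  mem_iInter.1 ((hormanderSet_eq_iInter hL).subset u.2) r

/-- An element of `𝒟'_L(M; E)` as an element of `𝒟'^r_L(M; E)`. -/
def HormanderSpace.toSobolev {L : Set (CotangentMinusZero m M)} (hL : IsClosed L)
    (u : HormanderSpace k E L) (r : ℝ) : SobolevSpace k E r L := ⟨u.1, u.mem_sobolevSet hL r⟩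

lemma HormanderSpace.val_toSobolev {L : Set (CotangentMinusZero m M)} (hL : IsClosed L)
    (u : HormanderSpace k E L) (r : ℝ) : (u.toSobolev hL r).1 = u.1 := Subtype.coe_mk _ _

/-- The common member of a compatible family, as an element of `𝒟'_L(M; E)`. -/
def HormanderSpace.ofCompatible {L : Set (CotangentMinusZero m M)} (hL : IsClosed L)
    (f : SobolevProjLimit k E L) : HormanderSpace k E L :=
  ⟨(f.1 0).1, mem_hormanderSet_of_compatible hL f⟩

lemma HormanderSpace.val_ofCompatible {L : Set (CotangentMinusZero m M)} (hL : IsClosed L)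
    (f : SobolevProjLimit k E L) (r : ℝ) : (ofCompatible hL f).1 = (f.1 r).1 :=
  (Subtype.coe_mk (f.1 0).1 (mem_hormanderSet_of_compatible hL f)).trans
    (val_eq_of_compatible f 0 r)

/-- The bijection between `𝒟'_L(M; E)` and the compatible families. -/
def hormanderEquiv {L : Set (CotangentMinusZero m M)} (hL : IsClosed L) :
    HormanderSpace k E L ≃ SobolevProjLimit k E L where
  toFun u := ⟨u.toSobolev hL, fun r₁ r₂ h => SobolevSpace.ext_val <| by
    rw [SobolevSpace.val_incl, u.val_toSobolev, u.val_toSobolev]⟩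
  invFun := HormanderSpace.ofCompatible hL
  left_inv u := HormanderSpace.ext_val <|
    (HormanderSpace.val_ofCompatible hL _ 0).trans (u.val_toSobolev hL 0)
  right_inv f := Subtype.ext <| funext fun r => SobolevSpace.ext_val <|
    ((HormanderSpace.ofCompatible hL f).val_toSobolev hL r).trans
      (HormanderSpace.val_ofCompatible hL f r)

lemma val_hormanderEquiv {L : Set (CotangentMinusZero m M)} (hL : IsClosed L)
    (u : HormanderSpace k E L) (r : ℝ) : ((hormanderEquiv hL u).1 r).1 = u.1 :=
  u.val_toSobolev hL r

lemma val_hormanderEquiv_symm {L : Set (CotangentMinusZero m M)} (hL : IsClosed L)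
    (f : SobolevProjLimit k E L) (r : ℝ) : ((hormanderEquiv hL).symm f).1 = (f.1 r).1 :=
  HormanderSpace.val_ofCompatible hL f r

/-- A ball of order `r` in `L²` contains an `L^∞` ball of order `max (r + m + 1) 1` for the same
cutoff and cone. -/
theorem continuous_hormanderEquiv {L : Set (CotangentMinusZero m M)} (hL : IsClosed L) :
    Continuous (hormanderEquiv (k := k) (E := E) hL) := by
  refine continuous_induced_rng.2 (continuous_pi fun r => SobolevSpace.continuous_of
    ((HormanderSpace.continuous_val L).congr fun u => (val_hormanderEquiv hL u r).symm)
    fun c ϕ V hV hVc h u₁ ε hε => ?_)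
  obtain ⟨C, hC, hC0, hle⟩ := c.exists_coneSeminorm_two_le (le_max_left (r + ((m : ℝ) + 1)) 1)
  filter_upwards [HormanderSpace.eventually_coneSeminorm_lt (ν := max (r + ((m : ℝ) + 1)) 1)
    (by positivity) hV hVc h u₁ (ENNReal.div_pos hε.ne' hC)] with u hu
  change c.coneSeminorm 2 r ϕ V (((hormanderEquiv hL u).1 r).1 -
    ((hormanderEquiv hL u₁).1 r).1) < ε
  rw [val_hormanderEquiv, val_hormanderEquiv]
  refine (hle ϕ V _).trans_lt ?_
  rw [mul_comm]
  exact (ENNReal.lt_div_iff_mul_lt (.inl hC0) (.inl hC)).1 hu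

/-- The `L^∞` seminorm of order `ν` is already controlled by the single factor `r = ν` of the
product, on a larger cone, together with the strong topology, which every factor carries. -/
theorem continuous_hormanderEquiv_symm {L : Set (CotangentMinusZero m M)} (hL : IsClosed L)
    (hconic : IsConic L) : Continuous (hormanderEquiv (k := k) (E := E) hL).symm := by
  have hval : ∀ r : ℝ, Continuous fun f : SobolevProjLimit k E L => f.1 r := fun r =>
    (continuous_apply r).comp continuous_subtype_val
  have hcont : Continuous fun f : SobolevProjLimit k E L =>
      ((hormanderEquiv hL).symm f).1 :=
    ((SobolevSpace.continuous_val 0 L).comp (hval 0)).congr fun f =>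
      (val_hormanderEquiv_symm hL f 0).symm
  refine HormanderSpace.continuous_of hcont fun ν c ϕ V hν hV hVc h f₁ ε hε => ?_
  obtain ⟨V', hV', hVc', h', hlt⟩ := c.exists_coneSeminorm_top_lt hL hconic hν.le hV hVc h
  obtain ⟨δ, hδ, hev⟩ := hlt ε hε
  have h0 : Tendsto (fun f : SobolevProjLimit k E L => ((hormanderEquiv hL).symm f).1 -
      ((hormanderEquiv hL).symm f₁).1) (𝓝 f₁) (𝓝 0) := by
    have := (hcont.sub continuous_const).tendsto (f := fun f : SobolevProjLimit k E L =>
      ((hormanderEquiv hL).symm f).1 - ((hormanderEquiv hL).symm f₁).1) f₁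
    rwa [sub_self] at this
  filter_upwards [h0.eventually hev, (hval ν).continuousAt.eventually
    (SobolevSpace.eventually_coneSeminorm_lt hV' hVc' h' (f₁.1 ν) hδ)] with f h1 h2
  rw [← val_hormanderEquiv_symm hL f, ← val_hormanderEquiv_symm hL f₁] at h2
  exact h1 h2

end Spaces

end

theorem mainTheorem7 (m k : ℕ) {M : Type*} [TopologicalSpace M] [T2Space M]
    [SecondCountableTopology M] [ChartedSpace (EuclideanSpace ℝ (Fin m)) M]
    [IsManifold (𝓡 m) ∞ M] (E : M → Type*)
    [∀ p, AddCommGroup (E p)] [∀ p, Module ℂ (E p)] [∀ p, TopologicalSpace (E p)]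
    [TopologicalSpace (TotalSpace (Fin k → ℂ) E)] [FiberBundle (Fin k → ℂ) E]
    [VectorBundle ℂ (Fin k → ℂ) E] [SmoothComplexVectorBundle m k E]
    (L : Set (CotangentMinusZero m M)) (hL : IsClosed L) (hconic : IsConic L) :
    ((hormanderSet E L : Set (DistSection m k E)) = ⋂ r : ℝ, sobolevSet E r L) ∧
    ∃ Θ : HormanderSpace k E L ≃ₜ SobolevProjLimit k E L,
      ∀ (u : HormanderSpace k E L) (r : ℝ), ((Θ u).1 r).1 = u.1 :=
  ⟨hormanderSet_eq_iInter hL,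
    { hormanderEquiv hL with
      continuous_toFun := continuous_hormanderEquiv hL
      continuous_invFun := continuous_hormanderEquiv_symm hL hconic },
    val_hormanderEquiv hL⟩
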